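/- Let $\beta>0$ and $0<d\le 1$. For each integer $m\ge 1$ let $B_m$ be the $m\times m$ lower bidiagonal random matrix with independent entries, whose diagonal entries are distributed as $\chi_{2a_m},\chi_{2a_m-\beta},\dots,\chi_{2a_m-\beta(m-1)}$ with $a_m=m\beta/(2d)$, and whose subdiagonal entries are distributed as $\chi_{\beta(m-1)},\chi_{\beta(m-2)},\dots,\chi_{\beta}$ (from top to bottom); here $\chi_r$ is the distribution on $(0,\infty)$ with density $\frac{2^{1-r/2}}{\Gamma(r/2)}x^{r-1}e^{-x^2/2}$. Let $$M_m=\frac{d}{\beta m}B_mB_m^{t},\qquad s(z)=\frac1m\operatorname{tr}(M_m-z)^{-1},\qquad R_{11}(z)=\big((M_m-z)^{-1}\big)_{11},$$ and let $$s_{MP}(z)=\int\frac{\rho(x)}{x-z}\,dx,\qquad \rho(x)=\frac{\sqrt{(\lambda_+-x)(x-\lambda_-)}}{2\pi d x}\mathbf 1_{[\lambda_-,\lambda_+]}(x),\qquad \lambda_\pm=(1\pm\sqrt d)^2,$$ be the Stieltjes transform of the Marchenko--Pastur distribution. Events $E_m$ are said to hold with overwhelming probability if for each $k\in\mathbb N$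 there is $C_k$ with $\mathbb P(E_m^c)\le C_k m^{-k}$ for all $m\ge1$. Fix $\kappa>0$ and, for $b\in\mathbb R$, put $$D_m(b)=\{z\in\mathbb C:\ \lambda_-+\kappa\le \Re z\le\lambda_+-\kappa,\ \Im z>m^{b}\}.$$ **Proposition.** Let $-1<a\le 0$, and suppose that 1. the Marchenko--Pastur law holds at level $m^a$: for every $c>0$, for every $z\in D_m(a)$ the event $|s(z)-s_{MP}(z)|<c$ holds with overwhelming probability, with constants $C_k$ that do not depend on $z$; 2. $|R_{11}-s_{MP}|=O(1)$ at level $m^a$: there is a constant $K$ such that for every $z\in D_m(a)$ the event $|R_{11}(z)-s_{MP}(z)|\le K$ holds with overwhelming probability, with constants $C_k$ that do not depend on $z$. Then, for every $\delta>0$, $$\sup_{z\in D_m((a-1)/2+\delta)}|R_{11}(z)-s_{MP}(z)|=o(1)\quad\text{with overwhelming probability,}$$ that is, for every $c>0$ the event $\{|R_{11}(z)-s_{MP}(z)|\le c \text{ for all } z\in D_m((a-1)/2+\delta)\}$ holds with overwhelming probability. -/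

import Mathlib

open MeasureTheory ProbabilityTheory

/-- The chi distribution with `r` degrees of freedom (`r > 0`), given by its density
`2 ^ (1 - r / 2) / Γ(r / 2) * x ^ (r - 1) * exp (- x ^ 2 / 2)` on `(0, ∞)`. -/
noncomputable def chiMeasure (r : ℝ) : Measure ℝ :=
  volume.withDensity fun x => ENNReal.ofReal
    (if 0 < x then
      2 ^ (1 - r / 2) / Real.Gamma (r / 2) * x ^ (r - 1) * Real.exp (-x ^ 2 / 2)
    else 0)

/-- The lower bidiagonal `m × m` matrix with diagonal `x` and subdiagonal `y`. -/
def lowerBidiagonal {m : ℕ} (x : Fin m → ℝ) (y : Fin (m - 1) → ℝ) : Matrix (Fin m) (Fin m) ℝ :=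
  Matrix.of fun i j =>
    if i = j then x i
    else if h : (i : ℕ) = j + 1 then y ⟨j, by have := i.isLt; omega⟩
    else 0

/-- `x` and `y` are the diagonal and the subdiagonal of the random bidiagonal matrix `B_β` of the
`β`-Laguerre ensemble of size `m` with parameter `a = m β / (2 d)`: all the entries are independent,
the diagonal is `χ_{2a}, χ_{2a-β}, …, χ_{2a-β(m-1)}` and the subdiagonal is
`χ_{β(m-1)}, χ_{β(m-2)}, …, χ_β`. -/
structure IsBetaLaguerre (β d : ℝ) {m : ℕ} {Ω : Type*} [MeasurableSpace Ω] (P : Measure Ω)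
    (x : Fin m → Ω → ℝ) (y : Fin (m - 1) → Ω → ℝ) : Prop where
  hasLaw_diag : ∀ i : Fin m, HasLaw (x i) (chiMeasure (2 * (m * β / (2 * d)) - β * (i : ℕ))) P
  hasLaw_sub : ∀ i : Fin (m - 1), HasLaw (y i) (chiMeasure (β * ((m : ℝ) - 1 - (i : ℕ)))) P
  indep : iIndepFun (Sum.elim x y) P

/-- The normalized `β`-Laguerre matrix `M = (d / (β m)) B Bᵗ`, where `B` is bidiagonal with diagonal
`x` and subdiagonal `y`. -/
noncomputable def laguerreMatrix (β d : ℝ) {m : ℕ} (x : Fin m → ℝ) (y : Fin (m - 1) → ℝ) :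
    Matrix (Fin m) (Fin m) ℝ :=
  (d / (β * m)) • (lowerBidiagonal x y * (lowerBidiagonal x y).transpose)

/-- The resolvent `(M - z)⁻¹` of a real matrix at `z ∈ ℂ`. -/
noncomputable def matrixResolvent {m : ℕ} (M : Matrix (Fin m) (Fin m) ℝ) (z : ℂ) :
    Matrix (Fin m) (Fin m) ℂ :=
  (M.map Complex.ofReal - z • (1 : Matrix (Fin m) (Fin m) ℂ))⁻¹

/-- The normalized trace `(1 / m) tr (M - z)⁻¹` of the resolvent. -/
noncomputable def empiricalStieltjes {m : ℕ} (M : Matrix (Fin m) (Fin m) ℝ) (z : ℂ) : ℂ :=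
  (1 / (m : ℂ)) * (matrixResolvent M z).trace

/-- The lower edge `λ₋ = (1 - √d)²` of the Marchenko-Pastur distribution. -/
noncomputable def mpLower (d : ℝ) : ℝ := (1 - Real.sqrt d) ^ 2

/-- The upper edge `λ₊ = (1 + √d)²` of the Marchenko-Pastur distribution. -/
noncomputable def mpUpper (d : ℝ) : ℝ := (1 + Real.sqrt d) ^ 2

/-- The density of the Marchenko-Pastur distribution with parameter `d`. -/
noncomputable def mpDensity (d : ℝ) : ℝ → ℝ :=
  (Set.Icc (mpLower d) (mpUpper d)).indicator fun x =>
    1 / (2 * d * Real.pi * x) * Real.sqrt ((mpUpper d - x) * (x - mpLower d))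

/-- The Stieltjes transform of the Marchenko-Pastur distribution. -/
noncomputable def mpStieltjes (d : ℝ) (z : ℂ) : ℂ :=
  ∫ x : ℝ, (1 / ((x : ℂ) - z)) * (mpDensity d x : ℂ)

/-- The bulk spectral domain above level `m ^ b`:
`λ₋ + κ ≤ Re z ≤ λ₊ - κ` and `Im z > m ^ b`. -/
def bulkDomain (d κ b : ℝ) (m : ℕ) : Set ℂ :=
  {z | mpLower d + κ ≤ z.re ∧ z.re ≤ mpUpper d - κ ∧ (m : ℝ) ^ b < z.im}

/-- The events `E m`, `m ≥ 1`, hold with overwhelming probability: for each `k` there is `C`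
with `ℙ((E m)ᶜ) ≤ C m ^ (-k)`. -/
def OverwhelmingProb {Ω : ℕ → Type*} [∀ m, MeasurableSpace (Ω m)] (P : ∀ m, Measure (Ω m))
    (E : ∀ (m : ℕ) [NeZero m], Set (Ω m)) : Prop :=
  ∀ k : ℕ, ∃ C : ℝ, ∀ (m : ℕ) [NeZero m], (P m).real (E m)ᶜ ≤ C * (m : ℝ) ^ (-(k : ℝ))

/-- For every `z ∈ D m` the event `E m z` holds with overwhelming probability, with constants that
do not depend on `z` (no simultaneity in `z` is required). -/
def OverwhelmingProbOn {Ω : ℕ → Type*} [∀ m, MeasurableSpace (Ω m)] (P : ∀ m, Measure (Ω m))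
    (D : ℕ → Set ℂ) (E : ∀ (m : ℕ) [NeZero m], ℂ → Set (Ω m)) : Prop :=
  ∀ k : ℕ, ∃ C : ℝ, ∀ (m : ℕ) [NeZero m], ∀ z ∈ D m,
    (P m).real (E m z)ᶜ ≤ C * (m : ℝ) ^ (-(k : ℝ))

/-- The Marchenko-Pastur law holds at level `m ^ a` for the random matrices `M m`. -/
def MPLawAtLevel {Ω : ℕ → Type*} [∀ m, MeasurableSpace (Ω m)] (P : ∀ m, Measure (Ω m))
    (M : ∀ m : ℕ, Ω m → Matrix (Fin m) (Fin m) ℝ) (d κ a : ℝ) : Prop :=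
  ∀ c : ℝ, 0 < c → OverwhelmingProbOn P (bulkDomain d κ a)
    fun m _ z => {ω | ‖empiricalStieltjes (M m ω) z - mpStieltjes d z‖ < c}

/-! Notation: X and Y are the resolvents at z of cBBᵗ and cBᵗB, η = Im z, and g = X₁₁ − s(z) is the
quantity `stieltjesGap`. The argument has two halves: g is small above the scale m^((a−1)/2), and a
small g forces X₁₁ to be close to s_MP.

Smallness of g. Consider the vector field that multiplies the diagonal entries of B by Y_ii − X_ii
and the subdiagonal ones by X_(i+1,i+1) − Y_ii. It is a Toda flow: it acts on BBᵗ by a commutator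
(`resolventDeriv_todaVelocity`). Integrating by parts along it against the product of the χ
densities gives three terms besides the derivative of the test function. The divergence in the
coordinates log u_k vanishes (`sum_toda_flux`). The Gaussian term vanishes because the flow
preserves tr BBᵗ (`sum_sq_mul_toda`). The χ parameters are arithmetic progressions, so their term
collapses to −βm g (`sum_laguerreParam_mul_toda`). Hence βm E[gG] is the expectation of the
derivative of G along the flow. That derivative of g is a corner entry of a commutator, bounded by 2
Im X₁₁ / η through the Ward identity. Taking for G a power of g times a power of its conjugate
yields βm E|g|^(2k+2) ≤ 2(2k+1)/η · E[Im X₁₁ |g|^(2k)] (`integral_norm_stieltjesGap_pow_le`). Now Im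
X₁₁ ≤ |g| + Im s(z), and η Im s is nondecreasing in η, so control of s at level m^a gives Im s(z) =
O(m^a/η) below that level. Thus |g|² is typically O((mη)⁻² + m^(a−1)/η²), and high moments with
Markov's inequality give overwhelming probability (`rapidlySmall_gap`).

From g to s_MP. Deleting the first row and column of B leaves a matrix of the same family and
changes the trace of the resolvent by at most 1/η. As g is small for both matrices, their corner
entries nearly agree. A Schur complement relates w = 1 + zX₁₁ to its analogue w' exactly: w(A + D −
z − Dw') = A, where A and D are the normalized squares of the first two entries and concentrate at 1
and d. So w almost solves dw² + (z − 1 − d)w + 1 = 0. In the bulk the condition Im w ≥ 0 keeps w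
away from the wrong root, hence w is close to 1 + z s_MP (`mp_stability`). A polynomial net and
Lipschitz bounds make the estimate simultaneous in z. -/

open scoped Matrix ComplexConjugate

/-- The resolvent `(H - z)⁻¹` of a complex matrix. -/
noncomputable def resolventMatrix {n : Type*} [Fintype n] [DecidableEq n] (H : Matrix n n ℂ) (z : ℂ) :
    Matrix n n ℂ :=
  (H - z • (1 : Matrix n n ℂ))⁻¹

/-! ### Resolvents of Hermitian matrices: spectral form, Ward identity, monotonicity -/

section resolvent

variable {n : Type*} [Fintype n] [DecidableEq n] {H : Matrix n n ℂ}

lemma ofReal_sub_ne_zero (x : ℝ) {z : ℂ} (hz : z.im ≠ 0) : (x : ℂ) - z ≠ 0 := fun h => by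
  apply hz
  have := congrArg Complex.im h
  simpa using this

lemma abs_im_le_norm_ofReal_sub (x : ℝ) (z : ℂ) : |z.im| ≤ ‖(x : ℂ) - z‖ := by
  simpa using Complex.abs_im_le_norm ((x : ℂ) - z)

/-- The eigenvalues and the unitary are chosen before z, so that resolvents at different points can
be compared term by term. -/
lemma exists_spectral_resolvent (hH : H.IsHermitian) :
    ∃ (lam : n → ℝ) (U : Matrix n n ℂ), U * Uᴴ = 1 ∧ Uᴴ * U = 1 ∧ ∀ z : ℂ, z.im ≠ 0 →
      (H - z • (1 : Matrix n n ℂ)) * resolventMatrix H z = 1 ∧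
      resolventMatrix H z = U * Matrix.diagonal (fun k => ((lam k : ℂ) - z)⁻¹) * Uᴴ := by
  have h1 : (hH.eigenvectorUnitary : Matrix n n ℂ) * (hH.eigenvectorUnitary : Matrix n n ℂ)ᴴ = 1 :=
    Unitary.coe_mul_star_self _
  have h2 : (hH.eigenvectorUnitary : Matrix n n ℂ)ᴴ * (hH.eigenvectorUnitary : Matrix n n ℂ) = 1 :=
    Unitary.coe_star_mul_self _
  refine ⟨hH.eigenvalues, hH.eigenvectorUnitary.1, h1, h2, fun z hz => ?_⟩
  set U : Matrix n n ℂ := (hH.eigenvectorUnitary).1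
  have hs : H = U * Matrix.diagonal (fun k => (hH.eigenvalues k : ℂ)) * Uᴴ := by
    conv_lhs => rw [hH.spectral_theorem, Unitary.conjStarAlgAut_apply]
    rfl
  have hz' : z • (1 : Matrix n n ℂ) = U * Matrix.diagonal (fun _ => z) * Uᴴ := by
    rw [← Matrix.smul_one_eq_diagonal, Matrix.mul_smul, Matrix.mul_one, Matrix.smul_mul, h1]
  have hsub : H - z • (1 : Matrix n n ℂ)
      = U * Matrix.diagonal (fun k => (hH.eigenvalues k : ℂ) - z) * Uᴴ := by
    conv_lhs => rw [hs, hz', ← Matrix.sub_mul, ← Matrix.mul_sub, Matrix.diagonal_sub]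
  have hinv : (H - z • (1 : Matrix n n ℂ)) *
      (U * Matrix.diagonal (fun k => ((hH.eigenvalues k : ℂ) - z)⁻¹) * Uᴴ) = 1 := by
    rw [hsub]
    calc _ = U * Matrix.diagonal (fun k => (hH.eigenvalues k : ℂ) - z) * (Uᴴ * U) *
          Matrix.diagonal (fun k => ((hH.eigenvalues k : ℂ) - z)⁻¹) * Uᴴ := by
          simp only [Matrix.mul_assoc]
      _ = 1 := by
          rw [h2, Matrix.mul_one, Matrix.mul_assoc U, Matrix.diagonal_mul_diagonal]
          simp only [mul_inv_cancel₀ (ofReal_sub_ne_zero _ hz), Matrix.diagonal_one,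
            Matrix.mul_one, h1]
  have := Matrix.inv_eq_right_inv hinv
  exact ⟨by rw [resolventMatrix, this, hinv], this⟩

lemma sub_mul_resolventMatrix (hH : H.IsHermitian) {z : ℂ} (hz : z.im ≠ 0) :
    (H - z • (1 : Matrix n n ℂ)) * resolventMatrix H z = 1 := by
  obtain ⟨_, _, _, _, h⟩ := exists_spectral_resolvent hH
  exact (h z hz).1

lemma resolventMatrix_mul_sub (hH : H.IsHermitian) {z : ℂ} (hz : z.im ≠ 0) :
    resolventMatrix H z * (H - z • (1 : Matrix n n ℂ)) = 1 :=
  mul_eq_one_comm.1 (sub_mul_resolventMatrix hH hz)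

lemma mul_resolventMatrix (hH : H.IsHermitian) {z : ℂ} (hz : z.im ≠ 0) :
    H * resolventMatrix H z = 1 + z • resolventMatrix H z := by
  have := sub_mul_resolventMatrix hH hz
  rw [Matrix.sub_mul, Matrix.smul_mul, Matrix.one_mul] at this
  rw [← this, sub_add_cancel]

lemma resolventMatrix_mul (hH : H.IsHermitian) {z : ℂ} (hz : z.im ≠ 0) :
    resolventMatrix H z * H = 1 + z • resolventMatrix H z := by
  have := resolventMatrix_mul_sub hH hz
  rw [Matrix.mul_sub, Matrix.mul_smul, Matrix.mul_one] at this
  rw [← this, sub_add_cancel]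

/-- Spectral form of the entries of the resolvent. -/
lemma exists_spectral_resolvent_apply (hH : H.IsHermitian) :
    ∃ (lam : n → ℝ) (U : n → n → ℂ), (∀ i, ∑ k, ‖U i k‖ ^ 2 = 1) ∧
      ∀ z : ℂ, z.im ≠ 0 →
      (∀ i j, resolventMatrix H z i j = ∑ k, U i k * ((lam k : ℂ) - z)⁻¹ * conj (U j k)) ∧
      (∀ i, ∑ j, ‖resolventMatrix H z i j‖ ^ 2 = ∑ k, ‖U i k‖ ^ 2 * (‖(lam k : ℂ) - z‖ ^ 2)⁻¹) ∧
      (resolventMatrix H z).trace = ∑ k, ((lam k : ℂ) - z)⁻¹ := by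
  obtain ⟨lam, U, h1, h2, h⟩ := exists_spectral_resolvent hH
  have key : ∀ i, ∀ f : n → ℂ, (U * Matrix.diagonal f * Uᴴ) i i = ∑ k, f k * (‖U i k‖ ^ 2 : ℝ) := by
    intro i f
    rw [Matrix.mul_apply]
    refine Finset.sum_congr rfl fun k _ => ?_
    rw [Matrix.mul_diagonal, Matrix.conjTranspose_apply, mul_right_comm, RCLike.star_def, Complex.mul_conj, Complex.normSq_eq_norm_sq, mul_comm]
  refine ⟨lam, U, fun i => ?_, fun z hz => ⟨fun i j => ?_, fun i => ?_, ?_⟩⟩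
  · have := key i (fun _ => 1)
    simp only [Matrix.diagonal_one, Matrix.mul_one, h1, Matrix.one_apply_eq, one_mul] at this
    exact_mod_cast this.symm
  · rw [(h z hz).2]
    rw [Matrix.mul_apply]
    simp only [Matrix.mul_diagonal, Matrix.conjTranspose_apply]
    rfl
  · have e : resolventMatrix H z * (resolventMatrix H z)ᴴ
        = U * Matrix.diagonal (fun k => (((‖(lam k : ℂ) - z‖ ^ 2)⁻¹ : ℝ) : ℂ)) * Uᴴ := by
      rw [(h z hz).2]
      calc _ = U * Matrix.diagonal (fun k => ((lam k : ℂ) - z)⁻¹) * (Uᴴ * U) *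
          (Matrix.diagonal (fun k => ((lam k : ℂ) - z)⁻¹))ᴴ * Uᴴ := by
            simp only [Matrix.conjTranspose_mul, Matrix.conjTranspose_conjTranspose,
              Matrix.mul_assoc]
        _ = _ := by
            rw [h2, Matrix.mul_one, Matrix.diagonal_conjTranspose, Matrix.mul_assoc U,
              Matrix.diagonal_mul_diagonal]
            congr 3
            funext k
            rw [Pi.star_apply, RCLike.star_def, Complex.mul_conj, Complex.normSq_eq_norm_sq,
              norm_inv, inv_pow]
    have e1 := congrFun (congrFun e i) i
    rw [key] at e1
    have e2 : (resolventMatrix H z * (resolventMatrix H z)ᴴ) i i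
        = ((∑ j, ‖resolventMatrix H z i j‖ ^ 2 : ℝ) : ℂ) := by
      simp only [Matrix.mul_apply, Matrix.conjTranspose_apply]
      push_cast
      refine Finset.sum_congr rfl fun k _ => ?_
      rw [RCLike.star_def, Complex.mul_conj, Complex.normSq_eq_norm_sq]
      push_cast; rfl
    rw [e2] at e1
    have e3 : ((∑ j, ‖resolventMatrix H z i j‖ ^ 2 : ℝ) : ℂ)
      = ((∑ k, ‖U i k‖ ^ 2 * (‖(lam k : ℂ) - z‖ ^ 2)⁻¹ : ℝ) : ℂ) := by
      rw [e1]; push_cast; exact Finset.sum_congr rfl fun k _ => mul_comm _ _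
    exact_mod_cast e3
  · rw [(h z hz).2, Matrix.mul_assoc, Matrix.trace_mul_comm, Matrix.mul_assoc, h2, Matrix.mul_one,
      Matrix.trace_diagonal]

lemma im_inv_ofReal_sub (x : ℝ) (z : ℂ) :
    (((x : ℂ) - z)⁻¹).im = z.im * (‖(x : ℂ) - z‖ ^ 2)⁻¹ := by
  rw [Complex.inv_im, Complex.normSq_eq_norm_sq]
  simp [div_eq_mul_inv]

/-- Ward identity. -/
lemma sum_norm_sq_resolventMatrix (hH : H.IsHermitian) {z : ℂ} (hz : z.im ≠ 0) (i : n) :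
    z.im * ∑ j, ‖resolventMatrix H z i j‖ ^ 2 = (resolventMatrix H z i i).im := by
  obtain ⟨lam, U, h1, h⟩ := exists_spectral_resolvent_apply hH
  rw [(h z hz).2.1, (h z hz).1, Complex.im_sum, Finset.mul_sum]
  refine Finset.sum_congr rfl fun k _ => ?_
  rw [mul_right_comm, Complex.mul_conj, Complex.normSq_eq_norm_sq, Complex.im_ofReal_mul,
    im_inv_ofReal_sub]
  ring

lemma norm_resolventMatrix_apply_le (hH : H.IsHermitian) {z : ℂ} (hz : z.im ≠ 0) (i j : n) :
    ‖resolventMatrix H z i j‖ ≤ |z.im|⁻¹ := by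
  obtain ⟨lam, U, h1, h⟩ := exists_spectral_resolvent_apply hH
  have hp : 0 < |z.im| := abs_pos.2 hz
  have h2 : ∑ j, ‖resolventMatrix H z i j‖ ^ 2 ≤ (|z.im|⁻¹) ^ 2 := by
    rw [(h z hz).2.1]
    calc _ ≤ ∑ k, ‖U i k‖ ^ 2 * (|z.im|⁻¹) ^ 2 := by
          refine Finset.sum_le_sum fun k _ => ?_
          rw [inv_pow]
          gcongr
          exact abs_im_le_norm_ofReal_sub _ _
      _ = _ := by rw [← Finset.sum_mul, h1, one_mul]
  refine le_of_sq_le_sq ?_ (by positivity)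
  exact (Finset.single_le_sum (f := fun j => ‖resolventMatrix H z i j‖ ^ 2)
    (fun j _ => by positivity) (Finset.mem_univ j)).trans h2

lemma conj_resolventMatrix (hH : H.IsHermitian) {z : ℂ} (hz : z.im ≠ 0) (i j : n) :
    conj (resolventMatrix H z i j) = resolventMatrix H (conj z) j i := by
  obtain ⟨lam, U, h1, h⟩ := exists_spectral_resolvent_apply hH
  rw [(h z hz).1, (h (conj z) (by simpa using hz)).1, map_sum]
  refine Finset.sum_congr rfl fun k _ => ?_
  simp only [map_mul, map_inv₀, map_sub, Complex.conj_ofReal, Complex.conj_conj]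
  ring

lemma im_resolventMatrix_nonneg (hH : H.IsHermitian) {z : ℂ} (hz : 0 < z.im) (i : n) :
    0 ≤ (resolventMatrix H z i i).im := by
  rw [← sum_norm_sq_resolventMatrix hH hz.ne']
  positivity

lemma norm_inv_ofReal_sub_sub_le (x : ℝ) {z w : ℂ} (hz : z.im ≠ 0) (hw : w.im ≠ 0) :
    ‖((x : ℂ) - z)⁻¹ - ((x : ℂ) - w)⁻¹‖ ≤ ‖z - w‖ * (|z.im|⁻¹ * |w.im|⁻¹) := by
  rw [inv_sub_inv (ofReal_sub_ne_zero _ hz) (ofReal_sub_ne_zero _ hw), norm_div, norm_mul,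
    div_eq_mul_inv, mul_inv]
  have h1 := abs_pos.2 hz
  have h2 := abs_pos.2 hw
  have h3 := abs_im_le_norm_ofReal_sub x z
  have h4 := abs_im_le_norm_ofReal_sub x w
  rw [show (x : ℂ) - w - (x - z) = z - w by ring]
  gcongr

lemma norm_resolventMatrix_sub_le (hH : H.IsHermitian) {z w : ℂ} (hz : z.im ≠ 0) (hw : w.im ≠ 0)
    (i : n) : ‖resolventMatrix H z i i - resolventMatrix H w i i‖
      ≤ ‖z - w‖ * (|z.im|⁻¹ * |w.im|⁻¹) := by
  obtain ⟨lam, U, h1, h⟩ := exists_spectral_resolvent_apply hH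
  rw [(h z hz).1, (h w hw).1, ← Finset.sum_sub_distrib]
  calc _ ≤ ∑ k, ‖U i k‖ ^ 2 * (‖z - w‖ * (|z.im|⁻¹ * |w.im|⁻¹)) := by
        refine norm_sum_le_of_le _ fun k _ => ?_
        rw [← sub_mul, ← mul_sub, norm_mul, norm_mul, RCLike.norm_conj, mul_right_comm, ← sq]
        exact mul_le_mul_of_nonneg_left (norm_inv_ofReal_sub_sub_le _ hz hw) (by positivity)
    _ = _ := by rw [← Finset.sum_mul, h1, one_mul]

lemma norm_trace_resolventMatrix_le (hH : H.IsHermitian) {z : ℂ} (hz : z.im ≠ 0) :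
    ‖(resolventMatrix H z).trace‖ ≤ Fintype.card n * |z.im|⁻¹ := by
  calc _ ≤ ∑ _i : n, |z.im|⁻¹ :=
        norm_sum_le_of_le _ fun i _ => norm_resolventMatrix_apply_le hH hz i i
    _ = _ := by simp

lemma im_trace_resolventMatrix_nonneg (hH : H.IsHermitian) {z : ℂ} (hz : 0 < z.im) :
    0 ≤ (resolventMatrix H z).trace.im := by
  rw [Matrix.trace, Complex.im_sum]
  exact Finset.sum_nonneg fun i _ => im_resolventMatrix_nonneg hH hz i

/-- `η ↦ η Im tr (H - E - iη)⁻¹` is nondecreasing. -/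
lemma im_mul_im_trace_resolventMatrix_mono (hH : H.IsHermitian) {z w : ℂ} (hz : 0 < z.im)
    (hzw : z.im ≤ w.im) (hre : z.re = w.re) :
    z.im * (resolventMatrix H z).trace.im ≤ w.im * (resolventMatrix H w).trace.im := by
  obtain ⟨lam, U, h1, h⟩ := exists_spectral_resolvent_apply hH
  have hw : 0 < w.im := hz.trans_le hzw
  rw [(h z hz.ne').2.2, (h w hw.ne').2.2, Complex.im_sum, Complex.im_sum, Finset.mul_sum,
    Finset.mul_sum]
  refine Finset.sum_le_sum fun k _ => ?_
  rw [im_inv_ofReal_sub, im_inv_ofReal_sub, ← Complex.normSq_eq_norm_sq, ← Complex.normSq_eq_norm_sq,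
    Complex.normSq_apply, Complex.normSq_apply]
  simp only [Complex.sub_re, Complex.sub_im, Complex.ofReal_re, Complex.ofReal_im, zero_sub, hre]
  have p1 : 0 < (lam k - w.re) * (lam k - w.re) + -z.im * -z.im := by nlinarith [sq_nonneg (lam k - w.re)]
  have p2 : 0 < (lam k - w.re) * (lam k - w.re) + -w.im * -w.im := by nlinarith [sq_nonneg (lam k - w.re)]
  -- Each eigenvalue contributes η² / ((λ − E)² + η²), which increases with η.
  rw [← mul_assoc, ← mul_assoc, ← div_eq_mul_inv, ← div_eq_mul_inv, div_le_div_iff₀ p1 p2]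
  have : z.im * z.im ≤ w.im * w.im := by nlinarith
  nlinarith [mul_le_mul_of_nonneg_left this (mul_self_nonneg (lam k - w.re))]

end resolvent

/-! ### Removal of the first row and column: Schur complement and interlacing of traces -/

section minor

variable {n : ℕ} {H : Matrix (Fin (n + 1)) (Fin (n + 1)) ℂ} {z : ℂ}

/-- By the Ward identity, a vanishing diagonal entry would make its whole row vanish, which is
impossible for an invertible matrix. -/
lemma resolventMatrix_apply_self_ne_zero (hH : H.IsHermitian) (hz : z.im ≠ 0) (i : Fin (n + 1)) :
    resolventMatrix H z i i ≠ 0 := by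
  intro h0
  have hw := sum_norm_sq_resolventMatrix hH hz i
  rw [h0, Complex.zero_im, mul_eq_zero, or_iff_right hz,
    Finset.sum_eq_zero_iff_of_nonneg (fun _ _ => by positivity)] at hw
  have h1 := congrFun (congrFun (resolventMatrix_mul_sub hH hz) i) i
  rw [Matrix.mul_apply, Matrix.one_apply_eq] at h1
  have h2 : ∀ j, resolventMatrix H z i j = 0 := fun j => by simpa using hw j (Finset.mem_univ j)
  simp [h2] at h1

/-- The rank-one correction cancels column 0 of G, so the rows of H − z with positive index act on
what remains without seeing column 0 of H. This checks the right-hand side as an inverse. -/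
lemma resolventMatrix_minor (hH : H.IsHermitian) (hz : z.im ≠ 0) (i j : Fin n) :
    resolventMatrix (H.submatrix Fin.succ Fin.succ) z i j =
      resolventMatrix H z i.succ j.succ
        - resolventMatrix H z i.succ 0 * resolventMatrix H z 0 j.succ / resolventMatrix H z 0 0 := by
  set G := resolventMatrix H z with hG
  have hG0 : G 0 0 ≠ 0 := resolventMatrix_apply_self_ne_zero hH hz 0
  have hmul : ∀ i j, ∑ k, (H - z • (1 : Matrix (Fin (n + 1)) (Fin (n + 1)) ℂ)) i k * G k j
      = (1 : Matrix (Fin (n + 1)) (Fin (n + 1)) ℂ) i j := fun i j => by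
    rw [← Matrix.mul_apply, sub_mul_resolventMatrix hH hz]
  have hinv : (H.submatrix Fin.succ Fin.succ - z • (1 : Matrix (Fin n) (Fin n) ℂ)) *
      (Matrix.of fun i j : Fin n => G i.succ j.succ - G i.succ 0 * G 0 j.succ / G 0 0) = 1 := by
    ext i j
    have e1 := hmul i.succ j.succ
    have e2 := hmul i.succ 0
    rw [Fin.sum_univ_succ] at e1 e2
    have hsub : ∀ i k : Fin n, (H.submatrix Fin.succ Fin.succ - z • (1 : Matrix (Fin n) (Fin n) ℂ)) i k
        = (H - z • (1 : Matrix (Fin (n + 1)) (Fin (n + 1)) ℂ)) i.succ k.succ := by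
      intro i k
      simp [Matrix.one_apply]
    rw [Matrix.mul_apply]
    simp only [hsub, Matrix.of_apply, mul_sub, Finset.sum_sub_distrib]
    have e3 : ∑ k : Fin n, (H - z • (1 : Matrix (Fin (n + 1)) (Fin (n + 1)) ℂ)) i.succ k.succ
        * (G k.succ 0 * G 0 j.succ / G 0 0)
        = (∑ k : Fin n, (H - z • (1 : Matrix (Fin (n + 1)) (Fin (n + 1)) ℂ)) i.succ k.succ * G k.succ 0)
          * (G 0 j.succ / G 0 0) := by
      rw [Finset.sum_mul]; exact Finset.sum_congr rfl fun k _ => by ring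
    rw [e3, eq_sub_iff_add_eq'.2 e1, eq_sub_iff_add_eq'.2 e2]
    simp only [Matrix.one_apply, Fin.succ_inj, Fin.succ_ne_zero, if_false]
    field_simp
    ring
  rw [resolventMatrix, Matrix.inv_eq_right_inv hinv, Matrix.of_apply]

/-- The minor formula turns the inner sums into entries of G(H − z) and (H − z)G, which are known.
-/
lemma schur_resolventMatrix (hH : H.IsHermitian) (hz : z.im ≠ 0) :
    resolventMatrix H z 0 0 * (H 0 0 - z - ∑ k : Fin n, ∑ l : Fin n, H 0 k.succ *
      resolventMatrix (H.submatrix Fin.succ Fin.succ) z k l * H l.succ 0) = 1 := by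
  have hG0 := resolventMatrix_apply_self_ne_zero hH hz 0
  have hmul : ∀ i j, ∑ k, (H - z • (1 : Matrix (Fin (n + 1)) (Fin (n + 1)) ℂ)) i k * resolventMatrix H z k j
      = (1 : Matrix (Fin (n + 1)) (Fin (n + 1)) ℂ) i j := fun i j => by
    rw [← Matrix.mul_apply, sub_mul_resolventMatrix hH hz]
  have hmul' : ∀ i j, ∑ k, resolventMatrix H z i k * (H - z • (1 : Matrix (Fin (n + 1)) (Fin (n + 1)) ℂ)) k j
      = (1 : Matrix (Fin (n + 1)) (Fin (n + 1)) ℂ) i j := fun i j => by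
    rw [← Matrix.mul_apply, resolventMatrix_mul_sub hH hz]
  simp only [resolventMatrix_minor hH hz]
  set G := resolventMatrix H z with hG
  have key : ∀ k : Fin n, ∑ l : Fin n, H 0 k.succ * (G k.succ l.succ - G k.succ 0 * G 0 l.succ / G 0 0)
      * H l.succ 0 = - (H 0 k.succ * G k.succ 0 / G 0 0) := by
    intro k
    have e1 := hmul' k.succ 0
    have e2 := hmul' 0 0
    rw [Fin.sum_univ_succ] at e1 e2
    simp only [Matrix.sub_apply, Matrix.smul_apply, Matrix.one_apply, Fin.succ_ne_zero, if_false,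
      if_true, smul_eq_mul, mul_zero, sub_zero, mul_one] at e1 e2
    have e3 : ∑ l : Fin n, H 0 k.succ * (G k.succ l.succ - G k.succ 0 * G 0 l.succ / G 0 0)
        * H l.succ 0 = H 0 k.succ * (∑ l : Fin n, G k.succ l.succ * H l.succ 0)
          - H 0 k.succ * (G k.succ 0 / G 0 0) * ∑ l : Fin n, G 0 l.succ * H l.succ 0 := by
      rw [Finset.mul_sum, Finset.mul_sum, ← Finset.sum_sub_distrib]
      exact Finset.sum_congr rfl fun l _ => by ring
    rw [e3, eq_sub_iff_add_eq'.2 e1, eq_sub_iff_add_eq'.2 e2]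
    field_simp
    ring
  have e1 := hmul 0 0
  rw [Fin.sum_univ_succ] at e1
  simp only [Matrix.sub_apply, Matrix.smul_apply, Matrix.one_apply, (Fin.succ_ne_zero _).symm, if_false,
      if_true, smul_eq_mul, mul_zero, sub_zero, mul_one] at e1
  rw [Finset.sum_congr rfl fun k _ => key k, Finset.sum_neg_distrib, ← Finset.sum_div,
    eq_sub_iff_add_eq'.2 e1]
  field_simp
  ring

/-- Removing a row and a column changes the trace of the resolvent by at most `1 / η`. -/
lemma norm_trace_resolventMatrix_sub_minor_le (hH : H.IsHermitian) (hz : z.im ≠ 0) :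
    ‖(resolventMatrix H z).trace - (resolventMatrix (H.submatrix Fin.succ Fin.succ) z).trace‖
      ≤ |z.im|⁻¹ := by
  have hG0 := resolventMatrix_apply_self_ne_zero hH hz 0
  -- The difference of traces is (∑ G_i0 G_0i) / G_00. The Ward identity at z bounds row 0 of G by
  -- |G_00| / |η|; at the conjugate point it bounds column 0 in the same way.
  have hz' : (conj z).im ≠ 0 := by simpa using hz
  have w1 := sum_norm_sq_resolventMatrix hH hz 0
  have w2 := sum_norm_sq_resolventMatrix hH hz' 0
  have hc : ∀ j, ‖resolventMatrix H (conj z) 0 j‖ = ‖resolventMatrix H z j 0‖ := fun j => by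
    rw [← conj_resolventMatrix hH hz, RCLike.norm_conj]
  simp only [hc] at w2
  rw [← conj_resolventMatrix hH hz] at w2
  simp only [Complex.conj_im, neg_mul, neg_inj] at w2
  simp only [Matrix.trace, Matrix.diag_apply, resolventMatrix_minor hH hz]
  set G := resolventMatrix H z with hG
  have e : ∑ i, G i i - ∑ i : Fin n, (G i.succ i.succ - G i.succ 0 * G 0 i.succ / G 0 0)
      = (∑ i, G i 0 * G 0 i) / G 0 0 := by
    rw [Fin.sum_univ_succ, Fin.sum_univ_succ, Finset.sum_sub_distrib, ← Finset.sum_div]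
    field_simp
    ring
  rw [e, norm_div, div_le_iff₀ (norm_pos_iff.2 hG0)]
  have hp := abs_pos.2 hz
  rw [inv_mul_eq_div, le_div_iff₀ hp]
  have h1 : ‖∑ i, G i 0 * G 0 i‖ ≤ ∑ i, (‖G i 0‖ ^ 2 + ‖G 0 i‖ ^ 2) / 2 := by
    refine norm_sum_le_of_le _ fun i _ => ?_
    rw [norm_mul]
    nlinarith [sq_nonneg (‖G i 0‖ - ‖G 0 i‖)]
  rw [← Finset.sum_div, Finset.sum_add_distrib] at h1
  have h2 : |z.im| * ∑ i, ‖G 0 i‖ ^ 2 ≤ ‖G 0 0‖ := by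
    rw [← abs_of_nonneg (Finset.sum_nonneg fun i _ => sq_nonneg ‖G 0 i‖), ← abs_mul, w1]
    exact Complex.abs_im_le_norm _
  have h3 : |z.im| * ∑ i, ‖G i 0‖ ^ 2 ≤ ‖G 0 0‖ := by
    rw [← abs_of_nonneg (Finset.sum_nonneg fun i _ => sq_nonneg ‖G i 0‖), ← abs_mul, w2]
    exact Complex.abs_im_le_norm _
  nlinarith [mul_le_mul_of_nonneg_right h1 hp.le]

end minor

/-! ### Bidiagonal matrices, their two resolvents and the algebra of the Toda field -/

section bidiagonal

/-- The coordinates of a lower bidiagonal matrix of size `n + 1`: diagonal and subdiagonal. -/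
abbrev BidiagIdx (n : ℕ) := Fin (n + 1) ⊕ Fin n

variable {n : ℕ}

/-- The row of a coordinate. -/
def bidiagRow : BidiagIdx n → Fin (n + 1) := Sum.elim id Fin.succ

/-- The column of a coordinate. -/
def bidiagCol : BidiagIdx n → Fin (n + 1) := Sum.elim id Fin.castSucc

/-- The complex lower bidiagonal matrix with real coordinates `u`. -/
noncomputable def bidiag (u : BidiagIdx n → ℝ) : Matrix (Fin (n + 1)) (Fin (n + 1)) ℂ :=
  ∑ k, (u k : ℂ) • Matrix.single (bidiagRow k) (bidiagCol k) 1

lemma bidiagIdx_ext {k l : BidiagIdx n} (h1 : bidiagRow k = bidiagRow l)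
    (h2 : bidiagCol k = bidiagCol l) : k = l := by
  rcases k with i | i <;> rcases l with j | j <;>
    simp only [bidiagRow, bidiagCol, Sum.elim_inl, Sum.elim_inr, id] at h1 h2
  · rw [h1]
  · have := h1.symm.trans h2
    simp [Fin.ext_iff] at this
  · have := h1.trans h2.symm
    simp [Fin.ext_iff] at this
  · rw [Fin.succ_inj.1 h1]

lemma sum_smul_single_apply (f : BidiagIdx n → ℂ) (i j : Fin (n + 1)) :
    (∑ k, f k • Matrix.single (bidiagRow k) (bidiagCol k) (1 : ℂ)) i j
      = ∑ k, if bidiagRow k = i ∧ bidiagCol k = j then f k else 0 := by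
  rw [Matrix.sum_apply]
  refine Finset.sum_congr rfl fun k _ => ?_
  rw [Matrix.smul_apply, Matrix.single_apply]
  simp

lemma bidiag_row_col (u : BidiagIdx n → ℝ) (k : BidiagIdx n) :
    bidiag u (bidiagRow k) (bidiagCol k) = u k := by
  rw [bidiag, sum_smul_single_apply, Fintype.sum_eq_single k, if_pos ⟨rfl, rfl⟩]
  rintro l hl
  rw [if_neg]
  exact fun h => hl (bidiagIdx_ext h.1 h.2)

lemma bidiag_eq_zero (u : BidiagIdx n → ℝ) {i j : Fin (n + 1)} (h1 : i ≠ j)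
    (h2 : (i : ℕ) ≠ j + 1) : bidiag u i j = 0 := by
  rw [bidiag, sum_smul_single_apply]
  refine Finset.sum_eq_zero fun k _ => if_neg ?_
  rintro ⟨rfl, rfl⟩
  rcases k with k | k <;> simp [bidiagRow, bidiagCol] at h1 h2

lemma bidiag_update (u : BidiagIdx n → ℝ) (k : BidiagIdx n) (t : ℝ) :
    bidiag (Function.update u k t) = bidiag u
      + ((t - u k : ℝ) : ℂ) • Matrix.single (bidiagRow k) (bidiagCol k) 1 := by
  rw [bidiag, bidiag, ← sub_eq_iff_eq_add', ← Finset.sum_sub_distrib, Fintype.sum_eq_single k]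
  · rw [Function.update_self, ← sub_smul]; push_cast; rfl
  · intro l hl
    rw [Function.update_of_ne hl, sub_self]

lemma bidiag_eq_map (u : BidiagIdx n → ℝ) :
    bidiag u = (lowerBidiagonal (m := n + 1) (fun i => u (.inl i)) (fun j => u (.inr j))).map
      Complex.ofReal := by
  ext i j
  rw [Matrix.map_apply, lowerBidiagonal, Matrix.of_apply]
  split_ifs with h1 h2
  · subst h1
    exact bidiag_row_col u (.inl i)
  · have := bidiag_row_col u (.inr ⟨j, by omega⟩)
    rw [← this]
    congr 1
    exact Fin.ext (by simp [bidiagRow, h2])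
  · exact bidiag_eq_zero u h1 h2

lemma conj_bidiag (u : BidiagIdx n → ℝ) (i j : Fin (n + 1)) : conj (bidiag u i j) = bidiag u i j := by
  rw [bidiag_eq_map, Matrix.map_apply, Complex.conj_ofReal]

lemma conjTranspose_bidiag (u : BidiagIdx n → ℝ) : (bidiag u)ᴴ = (bidiag u)ᵀ := by
  ext i j
  exact conj_bidiag u j i

/-- The resolvent of `c B Bᵗ`. -/
noncomputable def resolventLeft (c : ℝ) (u : BidiagIdx n → ℝ) (z : ℂ) :
    Matrix (Fin (n + 1)) (Fin (n + 1)) ℂ :=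
  resolventMatrix ((c : ℂ) • (bidiag u * (bidiag u)ᵀ)) z

/-- The resolvent of `c Bᵗ B`. -/
noncomputable def resolventRight (c : ℝ) (u : BidiagIdx n → ℝ) (z : ℂ) :
    Matrix (Fin (n + 1)) (Fin (n + 1)) ℂ :=
  resolventMatrix ((c : ℂ) • ((bidiag u)ᵀ * bidiag u)) z

lemma isHermitian_left (c : ℝ) (u : BidiagIdx n → ℝ) :
    ((c : ℂ) • (bidiag u * (bidiag u)ᵀ)).IsHermitian := by
  rw [← conjTranspose_bidiag, Matrix.IsHermitian, Matrix.conjTranspose_smul,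
    Matrix.conjTranspose_mul, Matrix.conjTranspose_conjTranspose]
  simp

lemma isHermitian_right (c : ℝ) (u : BidiagIdx n → ℝ) :
    ((c : ℂ) • ((bidiag u)ᵀ * bidiag u)).IsHermitian := by
  rw [← conjTranspose_bidiag, Matrix.IsHermitian, Matrix.conjTranspose_smul,
    Matrix.conjTranspose_mul, Matrix.conjTranspose_conjTranspose]
  simp

lemma transpose_resolventMatrix {m : Type*} [Fintype m] [DecidableEq m] {H : Matrix m m ℂ}
    (hH : Hᵀ = H) (z : ℂ) : (resolventMatrix H z)ᵀ = resolventMatrix H z := by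
  rw [resolventMatrix, Matrix.transpose_nonsing_inv, Matrix.transpose_sub, hH]
  simp

lemma transpose_resolventLeft (c : ℝ) (u : BidiagIdx n → ℝ) (z : ℂ) :
    (resolventLeft c u z)ᵀ = resolventLeft c u z :=
  transpose_resolventMatrix (by simp [Matrix.transpose_mul]) z

lemma transpose_resolventRight (c : ℝ) (u : BidiagIdx n → ℝ) (z : ℂ) :
    (resolventRight c u z)ᵀ = resolventRight c u z :=
  transpose_resolventMatrix (by simp [Matrix.transpose_mul]) z

variable {c : ℝ} {u : BidiagIdx n → ℝ} {z : ℂ}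

lemma resolventLeft_comm (i j : Fin (n + 1)) :
    resolventLeft c u z i j = resolventLeft c u z j i :=
  congrFun (congrFun (transpose_resolventLeft c u z) j) i

/-- This follows from the intertwining (cBBᵗ − z)B = B(cBᵗB − z). -/
lemma resolventLeft_mul_bidiag (hz : z.im ≠ 0) :
    resolventLeft c u z * bidiag u = bidiag u * resolventRight c u z := by
  have h1 := resolventMatrix_mul_sub (isHermitian_left c u) hz
  have h2 := sub_mul_resolventMatrix (isHermitian_right c u) hz
  have h3 : ((c : ℂ) • (bidiag u * (bidiag u)ᵀ) - z • (1 : Matrix (Fin (n + 1)) (Fin (n + 1)) ℂ))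
      * bidiag u = bidiag u * ((c : ℂ) • ((bidiag u)ᵀ * bidiag u)
        - z • (1 : Matrix (Fin (n + 1)) (Fin (n + 1)) ℂ)) := by
    simp only [Matrix.sub_mul, Matrix.mul_sub, Matrix.smul_mul, Matrix.mul_smul, Matrix.one_mul,
      Matrix.mul_one, Matrix.mul_assoc]
  calc _ = resolventLeft c u z * (bidiag u * (((c : ℂ) • ((bidiag u)ᵀ * bidiag u)
        - z • (1 : Matrix (Fin (n + 1)) (Fin (n + 1)) ℂ)) * resolventRight c u z)) := by
        rw [resolventRight, h2, Matrix.mul_one]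
    _ = (resolventLeft c u z * ((c : ℂ) • (bidiag u * (bidiag u)ᵀ)
        - z • (1 : Matrix (Fin (n + 1)) (Fin (n + 1)) ℂ))) * bidiag u * resolventRight c u z := by
        rw [← Matrix.mul_assoc (bidiag u), ← h3]
        simp only [Matrix.mul_assoc]
    _ = _ := by rw [resolventLeft, h1, Matrix.one_mul]

/-- Here and in `one_add_mul_resolventRight` both resolvents are expressed through the same matrix Q
= XB. Their diagonals then involve Q only at the positions where B is supported. -/
lemma one_add_mul_resolventLeft (hz : z.im ≠ 0) :
    1 + z • resolventLeft c u z = (c : ℂ) • (resolventLeft c u z * bidiag u * (bidiag u)ᵀ) := by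
  rw [resolventLeft, ← resolventMatrix_mul (isHermitian_left c u) hz, Matrix.mul_smul,
    Matrix.mul_assoc]

lemma one_add_mul_resolventRight (hz : z.im ≠ 0) :
    1 + z • resolventRight c u z
      = (c : ℂ) • ((bidiag u)ᵀ * (resolventLeft c u z * bidiag u)) := by
  rw [resolventLeft_mul_bidiag hz, resolventRight,
    ← mul_resolventMatrix (isHermitian_right c u) hz, Matrix.smul_mul, Matrix.mul_assoc]

lemma sum_bidiag_castSucc (f : Fin (n + 1) → ℂ) (j : Fin n) :
    ∑ k, bidiag u k j.castSucc * f k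
      = u (.inl j.castSucc) * f j.castSucc + u (.inr j) * f j.succ := by
  rw [Fintype.sum_eq_add j.castSucc j.succ (Fin.castSucc_lt_succ).ne]
  · congr 2
    · exact bidiag_row_col u (.inl j.castSucc)
    · exact bidiag_row_col u (.inr j)
  · rintro k ⟨h1, h2⟩
    rw [bidiag_eq_zero u h1, zero_mul]
    intro h
    exact h2 (Fin.ext (by simpa using h))

lemma sum_bidiag_last (f : Fin (n + 1) → ℂ) :
    ∑ k, bidiag u k (Fin.last n) * f k = u (.inl (Fin.last n)) * f (Fin.last n) := by
  rw [Fintype.sum_eq_single (Fin.last n)]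
  · congr 1
    exact bidiag_row_col u (.inl (Fin.last n))
  · rintro k h1
    rw [bidiag_eq_zero u h1, zero_mul]
    simp only [Fin.val_last]
    omega

lemma sum_bidiag_succ (f : Fin (n + 1) → ℂ) (j : Fin n) :
    ∑ k, f k * bidiag u j.succ k
      = f j.succ * u (.inl j.succ) + f j.castSucc * u (.inr j) := by
  rw [Fintype.sum_eq_add j.succ j.castSucc (Fin.castSucc_lt_succ).ne']
  · congr 2
    · exact bidiag_row_col u (.inl j.succ)
    · exact bidiag_row_col u (.inr j)
  · rintro k ⟨h1, h2⟩
    rw [bidiag_eq_zero u h1.symm, mul_zero]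
    intro h
    exact h2 (Fin.ext (by simpa using h.symm))

lemma sum_bidiag_zero (f : Fin (n + 1) → ℂ) :
    ∑ k, f k * bidiag u 0 k = f 0 * u (.inl 0) := by
  rw [Fintype.sum_eq_single 0]
  · congr 1
    exact bidiag_row_col u (.inl 0)
  · rintro k h1
    rw [bidiag_eq_zero u h1.symm (by simp), mul_zero]

/-- The components of the Toda vector field, divided by the coordinates. -/
noncomputable def toda (c : ℝ) (z : ℂ) (k : BidiagIdx n) (u : BidiagIdx n → ℝ) : ℂ :=
  k.elim (fun _ => 1) (fun _ => -1) * (resolventRight c u z (bidiagCol k) (bidiagCol k)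
    - resolventLeft c u z (bidiagRow k) (bidiagRow k))

/-- By `hasDerivAt_toda` this sum is, up to the factor −2, the divergence of the Toda field in
logarithmic coordinates. With p_i and e_j the fluxes through the diagonal and subdiagonal entries,
zX_ii + 1 = p_i + e_(i−1) and zY_ii + 1 = p_i + e_i, where the fluxes outside the range are zero.
The squares of p and all the mixed products then cancel. -/
lemma sum_toda_flux (hz : z.im ≠ 0) :
    ∑ k, (c * u k * (resolventLeft c u z * bidiag u) (bidiagRow k) (bidiagCol k)) * toda c z k u
      = 0 := by
  have hz0 : z ≠ 0 := fun h => hz (by simp [h])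
  set Q := resolventLeft c u z * bidiag u with hQ
  set p : Fin (n + 1) → ℂ := fun i => c * u (.inl i) * Q i i with hp
  set e : Fin n → ℂ := fun j => c * u (.inr j) * Q j.succ j.castSucc with he
  have hl : ∀ i, 1 + z * resolventLeft c u z i i = c * ∑ k, Q i k * bidiag u i k := by
    intro i
    have := congrFun (congrFun (one_add_mul_resolventLeft (c := c) (u := u) hz) i) i
    rw [← hQ] at this
    simpa [Matrix.mul_apply] using this
  have hr : ∀ i, 1 + z * resolventRight c u z i i = c * ∑ k, bidiag u k i * Q k i := by
    intro i
    have := congrFun (congrFun (one_add_mul_resolventRight (c := c) (u := u) hz) i) i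
    rw [← hQ] at this
    rw [Matrix.smul_apply, Matrix.mul_apply] at this
    simpa using this
  have hl0 : z * resolventLeft c u z 0 0 = p 0 - 1 := by
    rw [eq_sub_iff_add_eq', hl, sum_bidiag_zero]; simp only [hp]; ring
  have hls : ∀ j : Fin n, z * resolventLeft c u z j.succ j.succ = p j.succ + e j - 1 := by
    intro j
    rw [eq_sub_iff_add_eq', hl, sum_bidiag_succ]; simp only [hp, he]; ring
  have hrl : z * resolventRight c u z (Fin.last n) (Fin.last n) = p (Fin.last n) - 1 := by
    rw [eq_sub_iff_add_eq', hr, sum_bidiag_last]; simp only [hp]; ring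
  have hrc : ∀ j : Fin n, z * resolventRight c u z j.castSucc j.castSucc
      = p j.castSucc + e j - 1 := by
    intro j
    rw [eq_sub_iff_add_eq', hr, sum_bidiag_castSucc]; simp only [hp, he]; ring
  have s1 : ∑ i, p i * (z * resolventRight c u z i i)
      = ∑ i, p i * (p i - 1) + ∑ j : Fin n, p j.castSucc * e j := by
    rw [Fin.sum_univ_castSucc, Fin.sum_univ_castSucc (f := fun i => p i * (p i - 1)), hrl]
    simp only [hrc, mul_sub, mul_add, Finset.sum_add_distrib, Finset.sum_sub_distrib]
    ring
  have s2 : ∑ i, p i * (z * resolventLeft c u z i i)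
      = ∑ i, p i * (p i - 1) + ∑ j : Fin n, p j.succ * e j := by
    rw [Fin.sum_univ_succ, Fin.sum_univ_succ (f := fun i => p i * (p i - 1)), hl0]
    simp only [hls, mul_sub, mul_add, Finset.sum_add_distrib, Finset.sum_sub_distrib]
    ring
  have s3 : ∑ j, e j * (z * resolventLeft c u z j.succ j.succ
      - z * resolventRight c u z j.castSucc j.castSucc)
      = ∑ j : Fin n, p j.succ * e j - ∑ j : Fin n, p j.castSucc * e j := by
    rw [← Finset.sum_sub_distrib]
    exact Finset.sum_congr rfl fun j _ => by rw [hls, hrc]; ring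
  rw [← mul_right_inj' hz0, mul_zero, Fintype.sum_sum_type, mul_add, Finset.mul_sum, Finset.mul_sum]
  have t1 : ∑ i, z * (c * u (.inl i) * Q (bidiagRow (.inl i)) (bidiagCol (.inl i))
      * toda c z (.inl i) u) = ∑ i, p i * (z * resolventRight c u z i i)
        - ∑ i, p i * (z * resolventLeft c u z i i) := by
    rw [← Finset.sum_sub_distrib]
    refine Finset.sum_congr rfl fun i _ => ?_
    simp only [toda, bidiagRow, bidiagCol, Sum.elim_inl, id, hp]
    ring
  have t2 : ∑ j, z * (c * u (.inr j) * Q (bidiagRow (.inr j)) (bidiagCol (.inr j))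
      * toda c z (.inr j) u) = ∑ j, e j * (z * resolventLeft c u z j.succ j.succ
      - z * resolventRight c u z j.castSucc j.castSucc) := by
    refine Finset.sum_congr rfl fun i _ => ?_
    simp only [toda, bidiagRow, bidiagCol, Sum.elim_inr, he]
    ring
  rw [t1, t2, s1, s2, s3]
  ring

/-- Both traces are read off from tr(QBᵗ) = tr(BᵗQ), after division by z, which is nonzero because
it is not real. -/
lemma trace_resolventRight (hz : z.im ≠ 0) :
    (resolventRight c u z).trace = (resolventLeft c u z).trace := by
  have hz0 : z ≠ 0 := fun h => hz (by simp [h])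
  have h1 := congrArg Matrix.trace (one_add_mul_resolventLeft (c := c) (u := u) hz)
  have h2 := congrArg Matrix.trace (one_add_mul_resolventRight (c := c) (u := u) hz)
  rw [Matrix.trace_smul, Matrix.trace_mul_comm, ← Matrix.trace_smul, ← h2, Matrix.trace_add,
    Matrix.trace_add, Matrix.trace_smul, Matrix.trace_smul] at h1
  exact (mul_left_cancel₀ hz0 (add_left_cancel h1)).symm

/-- The parameters of the `χ` distributions of the entries. -/
noncomputable def laguerreParam (β ρ : ℝ) (k : BidiagIdx n) : ℝ :=
  k.elim (fun i : Fin (n + 1) => ρ - β * (i : ℕ)) (fun j : Fin n => β * ((n : ℝ) - (j : ℕ)))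

/-- The leading parameter ρ multiplies a difference of equal traces and drops out. The remaining
weights are linear in the index, so a summation by parts leaves one trace and a boundary term at the
corner. This is the point where the precise χ parameters matter. -/
lemma sum_laguerreParam_mul_toda (β ρ : ℝ) (hz : z.im ≠ 0) :
    ∑ k, (laguerreParam β ρ k : ℂ) * toda c z k u
      = β * ((resolventLeft c u z).trace - (n + 1) * resolventLeft c u z 0 0) := by
  have ht := trace_resolventRight (c := c) (u := u) hz
  set X := resolventLeft c u z with hX
  set Y := resolventRight c u z with hY
  -- The weight n − i vanishes at i = n, so the sum extends to all indices. In the next identity the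
  -- shift i = j + 1 turns the weight into n + 1 − i, and the missing index 0 produces the corner
  -- entry.
  have e1 : ∑ j : Fin n, ((n : ℂ) - (j : ℕ)) * Y j.castSucc j.castSucc
      = ∑ i : Fin (n + 1), ((n : ℂ) - (i : ℕ)) * Y i i := by
    rw [Fin.sum_univ_castSucc (f := fun i : Fin (n + 1) => ((n : ℂ) - (i : ℕ)) * Y i i)]
    simp
  have e2 : ∑ j : Fin n, ((n : ℂ) - (j : ℕ)) * X j.succ j.succ
      = ∑ i : Fin (n + 1), ((n : ℂ) + 1 - (i : ℕ)) * X i i - (n + 1) * X 0 0 := by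
    rw [Fin.sum_univ_succ (f := fun i : Fin (n + 1) => ((n : ℂ) + 1 - (i : ℕ)) * X i i)]
    simp
  rw [Fintype.sum_sum_type]
  have t1 : ∑ i : Fin (n + 1), (laguerreParam β ρ (.inl i : BidiagIdx n) : ℂ) * toda c z (.inl i) u
      = ρ * (Y.trace - X.trace) - β * ∑ i : Fin (n + 1), ((i : ℕ) : ℂ) * Y i i
        + β * ∑ i : Fin (n + 1), ((i : ℕ) : ℂ) * X i i := by
    simp only [Matrix.trace, Matrix.diag_apply, ← Finset.sum_sub_distrib, Finset.mul_sum,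
      ← Finset.sum_add_distrib]
    refine Finset.sum_congr rfl fun i _ => ?_
    simp only [toda, laguerreParam, bidiagRow, bidiagCol, Sum.elim_inl, id, ← hX, ← hY]
    push_cast
    ring
  have t2 : ∑ j : Fin n, (laguerreParam β ρ (.inr j : BidiagIdx n) : ℂ) * toda c z (.inr j) u
      = β * ∑ j : Fin n, ((n : ℂ) - (j : ℕ)) * X j.succ j.succ
        - β * ∑ j : Fin n, ((n : ℂ) - (j : ℕ)) * Y j.castSucc j.castSucc := by
    simp only [← Finset.sum_sub_distrib, Finset.mul_sum]
    refine Finset.sum_congr rfl fun i _ => ?_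
    simp only [toda, laguerreParam, bidiagRow, bidiagCol, Sum.elim_inr, ← hX, ← hY]
    push_cast
    ring
  have e3 : ∑ i : Fin (n + 1), ((n : ℂ) - (i : ℕ)) * Y i i
      = n * Y.trace - ∑ i : Fin (n + 1), ((i : ℕ) : ℂ) * Y i i := by
    simp only [Matrix.trace, Matrix.diag_apply, Finset.mul_sum, sub_mul, Finset.sum_sub_distrib]
  have e4 : ∑ i : Fin (n + 1), ((n : ℂ) + 1 - (i : ℕ)) * X i i
      = (n + 1) * X.trace - ∑ i : Fin (n + 1), ((i : ℕ) : ℂ) * X i i := by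
    simp only [Matrix.trace, Matrix.diag_apply, Finset.mul_sum, sub_mul, Finset.sum_sub_distrib]
  rw [t1, t2, e1, e2, e3, e4, ht]
  ring

end bidiagonal

/-! ### Lax form of the Toda field -/

section toda

variable {n : ℕ} {c : ℝ} {u : BidiagIdx n → ℝ} {z : ℂ}

/-- The diagonal of a matrix plus twice its strict upper triangular part. -/
def upperPart (X : Matrix (Fin (n + 1)) (Fin (n + 1)) ℂ) : Matrix (Fin (n + 1)) (Fin (n + 1)) ℂ :=
  Matrix.of fun i j => if i < j then 2 * X i j else if i = j then X i j else 0

lemma upperPart_add_transpose {X : Matrix (Fin (n + 1)) (Fin (n + 1)) ℂ} (hX : Xᵀ = X) :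
    upperPart X + (upperPart X)ᵀ = (2 : ℂ) • X := by
  ext i j
  have := congrFun (congrFun hX i) j
  rw [Matrix.transpose_apply] at this
  simp only [upperPart, Matrix.add_apply, Matrix.of_apply, Matrix.transpose_apply, Matrix.smul_apply,
    smul_eq_mul]
  rcases lt_trichotomy i j with h | h | h
  · simp [h, h.not_gt, h.ne']
  · subst h; simp [two_mul]
  · simp [h, h.not_gt, h.ne', this]

/-- The velocity of the bidiagonal matrix along the Toda vector field. -/
noncomputable def todaVelocity (c : ℝ) (z : ℂ) (u : BidiagIdx n → ℝ) :
    Matrix (Fin (n + 1)) (Fin (n + 1)) ℂ :=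
  ∑ k, (u k * toda c z k u) • Matrix.single (bidiagRow k) (bidiagCol k) (1 : ℂ)

lemma todaVelocity_row_col (k : BidiagIdx n) :
    todaVelocity c z u (bidiagRow k) (bidiagCol k) = u k * toda c z k u := by
  rw [todaVelocity, sum_smul_single_apply, Fintype.sum_eq_single k, if_pos ⟨rfl, rfl⟩]
  rintro l hl
  rw [if_neg]
  exact fun h => hl (bidiagIdx_ext h.1 h.2)

lemma todaVelocity_eq_zero {i j : Fin (n + 1)} (h1 : i ≠ j)
    (h2 : (i : ℕ) ≠ j + 1) : todaVelocity c z u i j = 0 := by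
  rw [todaVelocity, sum_smul_single_apply]
  refine Finset.sum_eq_zero fun k _ => if_neg ?_
  rintro ⟨rfl, rfl⟩
  rcases k with k | k <;> simp [bidiagRow, bidiagCol] at h1 h2

lemma todaVelocity_self (i : Fin (n + 1)) : todaVelocity c z u i i
    = bidiag u i i * (resolventRight c u z i i - resolventLeft c u z i i) := by
  have h1 := todaVelocity_row_col (c := c) (z := z) (u := u) (.inl i)
  have h2 := bidiag_row_col u (.inl i)
  simp only [bidiagRow, bidiagCol, Sum.elim_inl, id, toda, one_mul] at h1 h2
  rw [h1, h2]

lemma todaVelocity_succ {i j : Fin (n + 1)} (h : (i : ℕ) = j + 1) : todaVelocity c z u i j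
    = bidiag u i j * (resolventLeft c u z i i - resolventRight c u z j j) := by
  have h1 := todaVelocity_row_col (c := c) (z := z) (u := u) (.inr ⟨j, by omega⟩)
  have h2 := bidiag_row_col u (.inr ⟨j, by omega⟩)
  simp only [bidiagRow, bidiagCol, Sum.elim_inr, toda] at h1 h2
  have e1 : (⟨j, by omega⟩ : Fin n).succ = i := Fin.ext (by simp [h])
  have e2 : (⟨j, by omega⟩ : Fin n).castSucc = j := Fin.ext (by simp)
  rw [e1, e2] at h1 h2
  rw [h1, h2]
  ring

/-- By the intertwining relation, twice the resolvents contribute equal amounts on both sides, so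
the upper parts may be traded for minus their transposes. -/
lemma todaVelocity_aux (hz : z.im ≠ 0) :
    upperPart (resolventLeft c u z) * bidiag u - bidiag u * upperPart (resolventRight c u z)
      = bidiag u * (upperPart (resolventRight c u z))ᵀ
        - (upperPart (resolventLeft c u z))ᵀ * bidiag u := by
  have h1 := upperPart_add_transpose (transpose_resolventLeft c u z)
  have h2 := upperPart_add_transpose (transpose_resolventRight c u z)
  rw [sub_eq_sub_iff_add_eq_add, ← Matrix.add_mul, ← Matrix.mul_add, h1, add_comm _ (upperPart _), h2,
    Matrix.smul_mul, Matrix.mul_smul, resolventLeft_mul_bidiag hz]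

/-- Upper triangular factors times a lower bidiagonal matrix give nothing below the first
subdiagonal. By `todaVelocity_aux` the same matrix is built from lower triangular factors, so
nothing is above the diagonal. It is therefore bidiagonal; the subdiagonal is read from the first
form and the diagonal from the second, each with one surviving product per factor. -/
lemma todaVelocity_eq (hz : z.im ≠ 0) : todaVelocity c z u
    = upperPart (resolventLeft c u z) * bidiag u - bidiag u * upperPart (resolventRight c u z) := by
  have hB : ∀ {i j : Fin (n + 1)}, bidiag u i j ≠ 0 → i = j ∨ (i : ℕ) = j + 1 := by
    intro i j h
    by_contra! h'
    exact h (bidiag_eq_zero u h'.1 h'.2)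
  have hU : ∀ {X : Matrix (Fin (n + 1)) (Fin (n + 1)) ℂ} {i j : Fin (n + 1)}, upperPart X i j ≠ 0 →
      (i : ℕ) ≤ j := by
    intro X i j h
    by_contra! h'
    apply h
    rw [upperPart, Matrix.of_apply, if_neg (by rw [Fin.lt_def]; omega), if_neg]
    rintro rfl
    omega
  have hUd : ∀ {X : Matrix (Fin (n + 1)) (Fin (n + 1)) ℂ} (i : Fin (n + 1)), upperPart X i i = X i i := by
    intro X i
    simp [upperPart]
  ext i j
  rcases lt_or_ge (j : ℕ) i with hij | hij
  · rw [Matrix.sub_apply, Matrix.mul_apply, Matrix.mul_apply]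
    by_cases h : (i : ℕ) = j + 1
    · rw [todaVelocity_succ h, Fintype.sum_eq_single i, Fintype.sum_eq_single j, hUd, hUd]
      · ring
      · intro k hk
        by_contra h0
        have h1 := hB (left_ne_zero_of_mul h0)
        have h2 := hU (right_ne_zero_of_mul h0)
        rcases h1 with h1 | h1
        · subst h1; omega
        · exact hk (Fin.ext (by omega))
      · intro k hk
        by_contra h0
        have h1 := hB (right_ne_zero_of_mul h0)
        have h2 := hU (left_ne_zero_of_mul h0)
        rcases h1 with h1 | h1
        · subst h1; omega
        · exact hk (Fin.ext (by omega))
    · rw [todaVelocity_eq_zero (by rintro rfl; omega) h, Finset.sum_eq_zero, Finset.sum_eq_zero,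
        sub_zero]
      · intro k _
        by_contra h0
        have h1 := hB (left_ne_zero_of_mul h0)
        have h2 := hU (right_ne_zero_of_mul h0)
        rcases h1 with h1 | h1
        · subst h1; omega
        · omega
      · intro k _
        by_contra h0
        have h1 := hB (right_ne_zero_of_mul h0)
        have h2 := hU (left_ne_zero_of_mul h0)
        rcases h1 with h1 | h1
        · subst h1; omega
        · omega
  · rw [todaVelocity_aux hz, Matrix.sub_apply, Matrix.mul_apply, Matrix.mul_apply]
    simp only [Matrix.transpose_apply]
    by_cases h : i = j
    · subst h
      rw [todaVelocity_self, Fintype.sum_eq_single i, Fintype.sum_eq_single i, hUd, hUd]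
      · ring
      · intro k hk
        by_contra h0
        have h1 := hB (right_ne_zero_of_mul h0)
        have h2 := hU (left_ne_zero_of_mul h0)
        rcases h1 with h1 | h1
        · exact hk h1
        · omega
      · intro k hk
        by_contra h0
        have h1 := hB (left_ne_zero_of_mul h0)
        have h2 := hU (right_ne_zero_of_mul h0)
        rcases h1 with h1 | h1
        · exact hk h1.symm
        · omega
    · have hlt : (i : ℕ) < j := lt_of_le_of_ne hij (fun h' => h (Fin.ext h'))
      rw [todaVelocity_eq_zero h (by omega), Finset.sum_eq_zero, Finset.sum_eq_zero,
        sub_zero]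
      · intro k _
        by_contra h0
        have h1 := hB (right_ne_zero_of_mul h0)
        have h2 := hU (left_ne_zero_of_mul h0)
        rcases h1 with h1 | h1
        · subst h1; omega
        · omega
      · intro k _
        by_contra h0
        have h1 := hB (left_ne_zero_of_mul h0)
        have h2 := hU (right_ne_zero_of_mul h0)
        rcases h1 with h1 | h1
        · subst h1; omega
        · omega

/-- The Toda vector field preserves the trace of `B Bᵗ`. -/
lemma sum_sq_mul_toda (hz : z.im ≠ 0) : ∑ k, (u k : ℂ) ^ 2 * toda c z k u = 0 := by
  set UL := upperPart (resolventLeft c u z) with hUL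
  set UR := upperPart (resolventRight c u z) with hUR
  have h1 : ∑ k, (u k : ℂ) ^ 2 * toda c z k u = (todaVelocity c z u * (bidiag u)ᵀ).trace := by
    rw [todaVelocity, Finset.sum_mul, Matrix.trace_sum]
    refine Finset.sum_congr rfl fun k _ => ?_
    rw [Matrix.smul_mul, Matrix.trace_smul, Matrix.trace_single_mul, Matrix.transpose_apply,
      bidiag_row_col]
    simp only [smul_eq_mul, one_mul]
    ring
  -- The two forms of the velocity give opposite values for one and the same trace.
  have h2 : (todaVelocity c z u * (bidiag u)ᵀ).trace
      = (UL * (bidiag u * (bidiag u)ᵀ)).trace - (bidiag u * UR * (bidiag u)ᵀ).trace := by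
    rw [todaVelocity_eq hz, Matrix.sub_mul, Matrix.trace_sub, Matrix.mul_assoc UL]
  have h3 : (todaVelocity c z u * (bidiag u)ᵀ).trace
      = (bidiag u * UR * (bidiag u)ᵀ).trace - (UL * (bidiag u * (bidiag u)ᵀ)).trace := by
    rw [todaVelocity_eq hz, todaVelocity_aux hz, Matrix.sub_mul, Matrix.trace_sub]
    congr 1
    · rw [← Matrix.trace_transpose (bidiag u * UR * (bidiag u)ᵀ)]
      simp only [Matrix.transpose_mul, Matrix.transpose_transpose, Matrix.mul_assoc, hUR]
    · rw [← Matrix.trace_transpose (UL * _), Matrix.trace_mul_comm]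
      simp only [Matrix.transpose_mul, Matrix.transpose_transpose, Matrix.mul_assoc, hUL]
      rw [Matrix.trace_mul_comm, Matrix.mul_assoc, Matrix.trace_mul_comm, Matrix.mul_assoc]
  rw [h1]
  have : (todaVelocity c z u * (bidiag u)ᵀ).trace + (todaVelocity c z u * (bidiag u)ᵀ).trace = 0 := by
    nth_rw 1 [h2]
    rw [h3]
    ring
  exact add_self_eq_zero.1 this

/-- The derivative of the resolvent of `c B Bᵗ` in the direction `E` of `B`. -/
noncomputable def resolventDeriv (c : ℝ) (u : BidiagIdx n → ℝ) (w : ℂ)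
    (E : Matrix (Fin (n + 1)) (Fin (n + 1)) ℂ) : Matrix (Fin (n + 1)) (Fin (n + 1)) ℂ :=
  -((c : ℂ) • (resolventLeft c u w * (E * (bidiag u)ᵀ + bidiag u * Eᵀ) * resolventLeft c u w))

lemma resolventDeriv_smul (a : ℂ) (w : ℂ) (E : Matrix (Fin (n + 1)) (Fin (n + 1)) ℂ) :
    resolventDeriv c u w (a • E) = a • resolventDeriv c u w E := by
  simp only [resolventDeriv, Matrix.smul_mul, Matrix.transpose_smul, Matrix.mul_smul, ← smul_add,
    smul_neg, smul_comm a]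

lemma resolventDeriv_add (w : ℂ) (E F : Matrix (Fin (n + 1)) (Fin (n + 1)) ℂ) :
    resolventDeriv c u w (E + F) = resolventDeriv c u w E + resolventDeriv c u w F := by
  simp only [resolventDeriv, Matrix.add_mul, Matrix.mul_add, Matrix.transpose_add, smul_add, neg_add]
  abel

lemma resolventDeriv_sum {ι : Type*} (s : Finset ι) (w : ℂ)
    (E : ι → Matrix (Fin (n + 1)) (Fin (n + 1)) ℂ) :
    resolventDeriv c u w (∑ k ∈ s, E k) = ∑ k ∈ s, resolventDeriv c u w (E k) := by
  classical
  induction s using Finset.induction_on with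
  | empty => simp [resolventDeriv]
  | insert a s ha ih => rw [Finset.sum_insert ha, Finset.sum_insert ha, resolventDeriv_add, ih]

/-- Lax form of the Toda vector field. -/
lemma resolventDeriv_todaVelocity (hz : z.im ≠ 0) {w : ℂ} (hw : w.im ≠ 0) :
    resolventDeriv c u w (todaVelocity c z u)
      = upperPart (resolventLeft c u z) * resolventLeft c u w
        - resolventLeft c u w * upperPart (resolventLeft c u z) := by
  set UL := upperPart (resolventLeft c u z) with hUL
  have h1 : todaVelocity c z u * (bidiag u)ᵀ + bidiag u * (todaVelocity c z u)ᵀ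
      = UL * (bidiag u * (bidiag u)ᵀ) - (bidiag u * (bidiag u)ᵀ) * UL := by
    nth_rw 2 [todaVelocity_eq hz]
    rw [todaVelocity_aux hz, todaVelocity_eq hz]
    simp only [Matrix.transpose_sub, Matrix.transpose_mul, Matrix.transpose_transpose,
      Matrix.sub_mul, Matrix.mul_sub, Matrix.mul_assoc, hUL]
    abel
  have h2 := mul_resolventMatrix (isHermitian_left c u) hw
  have h3 := resolventMatrix_mul (isHermitian_left c u) hw
  rw [← resolventLeft] at h2 h3
  rw [resolventDeriv, h1]
  set R := resolventLeft c u w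
  set S := bidiag u * (bidiag u)ᵀ
  -- Replacing R(cS) and (cS)R by 1 + wR turns the sandwiched commutator into a commutator with R;
  -- the terms in w cancel.
  have e : -((c : ℂ) • (R * (UL * S - S * UL) * R)) = (R * ((c : ℂ) • S)) * UL * R
      - R * UL * (((c : ℂ) • S) * R) := by
    simp only [Matrix.mul_sub, Matrix.sub_mul, Matrix.smul_mul, Matrix.mul_smul, smul_sub,
      Matrix.mul_assoc]
    abel
  rw [e, h2, h3]
  simp only [Matrix.mul_add, Matrix.add_mul, Matrix.mul_one, Matrix.one_mul, Matrix.smul_mul,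
    Matrix.mul_smul]
  abel

lemma sum_toda_mul_resolventDeriv (hz : z.im ≠ 0) {w : ℂ} (hw : w.im ≠ 0) :
    ∑ k, (u k * toda c z k u) • resolventDeriv c u w (Matrix.single (bidiagRow k) (bidiagCol k) 1)
      = upperPart (resolventLeft c u z) * resolventLeft c u w
        - resolventLeft c u w * upperPart (resolventLeft c u z) := by
  rw [← resolventDeriv_todaVelocity hz hw, todaVelocity, resolventDeriv_sum]
  exact Finset.sum_congr rfl fun k _ => (resolventDeriv_smul _ _ _).symm

/-- Below the diagonal, column 0 of the upper part vanishes, so the corner entry is 2 ∑ X_0k(z)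
X_k0(w) over k ≥ 1. For w equal to z or its conjugate the two factors have the same modulus, and the
Ward identity at z bounds the sum. -/
lemma norm_upperPart_commutator_le (hz : 0 < z.im) {w : ℂ} (hw : w = z ∨ w = conj z) :
    ‖(upperPart (resolventLeft c u z) * resolventLeft c u w
        - resolventLeft c u w * upperPart (resolventLeft c u z)) 0 0‖
      ≤ 2 * ((resolventLeft c u z 0 0).im / z.im) := by
  have hnorm : ∀ k, ‖resolventLeft c u w k 0‖ = ‖resolventLeft c u z 0 k‖ := by
    intro k
    rcases hw with rfl | rfl
    · rw [resolventLeft_comm]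
    · rw [resolventLeft, ← conj_resolventMatrix (isHermitian_left c u) hz.ne', RCLike.norm_conj]
      rfl
  have e : (upperPart (resolventLeft c u z) * resolventLeft c u w
        - resolventLeft c u w * upperPart (resolventLeft c u z)) 0 0
      = 2 * ∑ k : Fin n, resolventLeft c u z 0 k.succ * resolventLeft c u w k.succ 0 := by
    rw [Matrix.sub_apply, Matrix.mul_apply, Matrix.mul_apply, Fin.sum_univ_succ, Fin.sum_univ_succ,
      Finset.mul_sum]
    have : ∀ k : Fin n, upperPart (resolventLeft c u z) k.succ 0 = 0 := by
      intro k
      simp [upperPart]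
    have h2 : ∀ k : Fin n, upperPart (resolventLeft c u z) 0 k.succ
        = 2 * resolventLeft c u z 0 k.succ := by
      intro k
      simp [upperPart]
    simp only [this, h2, mul_zero, Finset.sum_const_zero, add_zero, mul_assoc]
    ring
  have hw1 := sum_norm_sq_resolventMatrix (isHermitian_left c u) hz.ne' 0
  rw [← resolventLeft] at hw1
  rw [e, norm_mul, Complex.norm_ofNat, ← hw1, mul_div_cancel_left₀ _ hz.ne', Fin.sum_univ_succ]
  gcongr
  calc _ ≤ ∑ k : Fin n, ‖resolventLeft c u z 0 k.succ‖ ^ 2 := by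
        refine norm_sum_le_of_le _ fun k _ => ?_
        rw [norm_mul, hnorm, sq]
    _ ≤ _ := le_add_of_nonneg_left (by positivity)

end toda

/-! ### Derivatives and continuity in the matrix entries -/

section deriv

lemma isUnit_sub_smul_one {m : Type*} [Fintype m] [DecidableEq m] {H : Matrix m m ℂ}
    (hH : H.IsHermitian) {w : ℂ} (hw : w.im ≠ 0) : IsUnit (H - w • (1 : Matrix m m ℂ)) :=
  IsUnit.of_mul_eq_one _ (sub_mul_resolventMatrix hH hw)

section

attribute [local instance] Matrix.linftyOpNormedRing Matrix.linftyOpNormedAlgebra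

/-- The operator norm chosen here only serves to make the matrices a normed algebra, in which
inversion is differentiable; the conclusion concerns single entries. -/
lemma hasDerivAt_resolventMatrix_sq_line {m : Type*} [Fintype m] [DecidableEq m]
    (c : ℂ) (B E : Matrix m m ℂ) {w : ℂ} (s : ℝ)
    (h : IsUnit (c • (B * Bᵀ) - w • (1 : Matrix m m ℂ))) (i j : m) :
    HasDerivAt (fun t : ℝ => resolventMatrix
      (c • ((B + ((t - s : ℝ) : ℂ) • E) * (B + ((t - s : ℝ) : ℂ) • E)ᵀ)) w i j)
      ((-(c • (resolventMatrix (c • (B * Bᵀ)) w * (E * Bᵀ + B * Eᵀ)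
        * resolventMatrix (c • (B * Bᵀ)) w)) : Matrix m m ℂ) i j) s := by
  have hl : HasDerivAt (fun t : ℝ => ((t - s : ℝ) : ℂ)) 1 s :=
    (((hasDerivAt_id s).sub_const s).ofReal_comp)
  have h1 : HasDerivAt (fun t : ℝ => B + ((t - s : ℝ) : ℂ) • E) E s := by
    have := (hl.smul_const E).const_add B
    rwa [one_smul] at this
  have h2 : HasDerivAt (fun t : ℝ => (B + ((t - s : ℝ) : ℂ) • E)ᵀ) Eᵀ s := by
    have := (hl.smul_const Eᵀ).const_add Bᵀ
    rw [one_smul] at this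
    simp only [Matrix.transpose_add, Matrix.transpose_smul]
    exact this
  have h3 := ((h1.mul h2).const_smul c).sub_const (w • (1 : Matrix m m ℂ))
  simp only [sub_self, Complex.ofReal_zero, zero_smul, add_zero] at h3
  obtain ⟨U, hU⟩ := h
  have h4 := hasFDerivAt_ringInverse (𝕜 := ℝ) U
  have h5 : HasDerivAt (fun t : ℝ => Ring.inverse (c • ((B + ((t - s : ℝ) : ℂ) • E) *
      (B + ((t - s : ℝ) : ℂ) • E)ᵀ) - w • (1 : Matrix m m ℂ)))
      (-((ContinuousLinearMap.mulLeftRight ℝ (Matrix m m ℂ) ↑U⁻¹) ↑U⁻¹)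
        (c • (E * Bᵀ + B * Eᵀ))) s := by
    refine HasFDerivAt.comp_hasDerivAt_of_eq s h4 h3 ?_
    rw [hU]; simp
  have hUi : ((U⁻¹ : (Matrix m m ℂ)ˣ) : Matrix m m ℂ) = resolventMatrix (c • (B * Bᵀ)) w := by
    rw [resolventMatrix, ← hU, Matrix.coe_units_inv]
  have h6 := ((Matrix.entryLinearMap ℝ ℂ i j).toContinuousLinearMap.hasFDerivAt).comp_hasDerivAt s h5
  rw [hUi] at h6
  simp only [← Matrix.nonsing_inv_eq_ringInverse] at h6
  rw [← Matrix.smul_mul, ← Matrix.mul_smul]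
  exact h6

end

variable {n : ℕ} {c : ℝ} {u : BidiagIdx n → ℝ} {w : ℂ}

lemma hasDerivAt_resolventLeft (hw : w.im ≠ 0) (k : BidiagIdx n) (i j : Fin (n + 1)) :
    HasDerivAt (fun t => resolventLeft c (Function.update u k t) w i j)
      (resolventDeriv c u w (Matrix.single (bidiagRow k) (bidiagCol k) 1) i j) (u k) := by
  simp only [resolventLeft, bidiag_update]
  exact hasDerivAt_resolventMatrix_sq_line _ _ _ _ (isUnit_sub_smul_one (isHermitian_left c u) hw) i j

/-- The derivative of the resolvent of `c Bᵗ B` in the direction `E` of `B`. -/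
noncomputable def resolventRightDeriv (c : ℝ) (u : BidiagIdx n → ℝ) (w : ℂ)
    (E : Matrix (Fin (n + 1)) (Fin (n + 1)) ℂ) : Matrix (Fin (n + 1)) (Fin (n + 1)) ℂ :=
  -((c : ℂ) • (resolventRight c u w * (Eᵀ * bidiag u + (bidiag u)ᵀ * E) * resolventRight c u w))

lemma hasDerivAt_resolventRight (hw : w.im ≠ 0) (k : BidiagIdx n) (i j : Fin (n + 1)) :
    HasDerivAt (fun t => resolventRight c (Function.update u k t) w i j)
      (resolventRightDeriv c u w (Matrix.single (bidiagRow k) (bidiagCol k) 1) i j)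
      (u k) := by
  have := hasDerivAt_resolventMatrix_sq_line (c : ℂ) (bidiag u)ᵀ
    (Matrix.single (bidiagRow k) (bidiagCol k) 1)ᵀ (w := w) (u k)
    (by simpa using isUnit_sub_smul_one (isHermitian_right c u) hw) i j
  simpa only [resolventRight, resolventRightDeriv, bidiag_update, Matrix.transpose_add, Matrix.transpose_smul,
    Matrix.transpose_transpose] using this

/-- Each component of the Toda vector field has logarithmic derivative `-2` times the flux. -/
lemma hasDerivAt_toda (hw : w.im ≠ 0) (k : BidiagIdx n) :
    HasDerivAt (fun t => toda c w k (Function.update u k t))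
      (-2 * (c * (resolventLeft c u w * bidiag u) (bidiagRow k) (bidiagCol k)) * toda c w k u)
      (u k) := by
  have h1 := hasDerivAt_resolventLeft (c := c) (u := u) hw k (bidiagRow k) (bidiagRow k)
  have h2 := hasDerivAt_resolventRight (c := c) (u := u) hw k (bidiagCol k) (bidiagCol k)
  have key : ∀ (A X : Matrix (Fin (n + 1)) (Fin (n + 1)) ℂ) (a b : Fin (n + 1)),
      (X * Matrix.single a b (1 : ℂ) * A) a a = X a a * A b a := by
    intro A X a b
    rw [Matrix.mul_assoc, Matrix.mul_apply, Fintype.sum_eq_single a]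
    · rw [Matrix.single_mul_apply_same, one_mul]
    · intro x hx
      rw [Matrix.single_mul_apply_of_ne _ _ _ _ _ hx, mul_zero]
  -- Both diagonal entries have the same logarithmic derivative, −2c times the entry of Q at the
  -- coordinate, hence so has their difference.
  have e1 : resolventDeriv c u w (Matrix.single (bidiagRow k) (bidiagCol k) 1) (bidiagRow k)
      (bidiagRow k) = -2 * (c * (resolventLeft c u w * bidiag u) (bidiagRow k) (bidiagCol k))
        * resolventLeft c u w (bidiagRow k) (bidiagRow k) := by
    have t : (resolventLeft c u w * (bidiag u * (Matrix.single (bidiagRow k) (bidiagCol k) (1 : ℂ))ᵀ)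
        * resolventLeft c u w) = (resolventLeft c u w * Matrix.single (bidiagRow k) (bidiagCol k) 1
          * ((bidiag u)ᵀ * resolventLeft c u w))ᵀ := by
      simp only [Matrix.transpose_mul, Matrix.transpose_transpose, transpose_resolventLeft,
        Matrix.mul_assoc]
    have t2 : ((bidiag u)ᵀ * resolventLeft c u w) = (resolventLeft c u w * bidiag u)ᵀ := by
      rw [Matrix.transpose_mul, transpose_resolventLeft]
    rw [resolventDeriv, Matrix.mul_add, Matrix.add_mul, t, ← Matrix.mul_assoc (resolventLeft c u w),
      Matrix.mul_assoc _ (bidiag u)ᵀ, Matrix.neg_apply, Matrix.smul_apply, Matrix.add_apply,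
      Matrix.transpose_apply, key, t2, Matrix.transpose_apply, smul_eq_mul]
    ring
  have e2 : resolventRightDeriv c u w (Matrix.single (bidiagRow k) (bidiagCol k) 1) (bidiagCol k)
      (bidiagCol k)
      = -2 * (c * (resolventLeft c u w * bidiag u) (bidiagRow k) (bidiagCol k))
        * resolventRight c u w (bidiagCol k) (bidiagCol k) := by
    have t : (resolventRight c u w * ((bidiag u)ᵀ * Matrix.single (bidiagRow k) (bidiagCol k) (1 : ℂ))
        * resolventRight c u w) = (resolventRight c u w * Matrix.single (bidiagCol k) (bidiagRow k) 1
          * (bidiag u * resolventRight c u w))ᵀ := by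
      simp only [Matrix.transpose_mul, Matrix.transpose_single, transpose_resolventRight,
        Matrix.mul_assoc]
    rw [resolventRightDeriv, Matrix.mul_add, Matrix.add_mul, t, Matrix.transpose_single,
      ← Matrix.mul_assoc (resolventRight c u w), Matrix.mul_assoc _ (bidiag u), Matrix.neg_apply, Matrix.smul_apply,
      Matrix.add_apply, Matrix.transpose_apply, key, ← resolventLeft_mul_bidiag hw, smul_eq_mul]
    ring
  rw [e1] at h1
  rw [e2] at h2
  have h3 := (h2.sub h1).const_mul ((k.elim (fun _ => 1) (fun _ => -1) : ℂ))
  refine h3.congr_deriv ?_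
  simp only [toda]
  ring

lemma continuous_bidiag : Continuous (bidiag : (BidiagIdx n → ℝ) → _) := by
  unfold bidiag
  fun_prop

lemma continuous_resolventMatrix {α m : Type*} [TopologicalSpace α] [Fintype m] [DecidableEq m]
    {H : α → Matrix m m ℂ} (hc : Continuous H) (hH : ∀ a, (H a).IsHermitian) (hw : w.im ≠ 0) :
    Continuous fun a => resolventMatrix (H a) w := by
  have hc' : Continuous fun a => H a - w • (1 : Matrix m m ℂ) := hc.sub continuous_const
  simp only [resolventMatrix, Matrix.inv_def, Ring.inverse_eq_inv']
  refine Continuous.smul (hc'.matrix_det.inv₀ fun a => ?_) hc'.matrix_adjugate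
  exact ((Matrix.isUnit_iff_isUnit_det _).1 (isUnit_sub_smul_one (hH a) hw)).ne_zero

lemma continuous_resolventLeft (hw : w.im ≠ 0) :
    Continuous fun u : BidiagIdx n → ℝ => resolventLeft c u w :=
  continuous_resolventMatrix (Continuous.const_smul (g := fun u => bidiag u * (bidiag u)ᵀ)
    (continuous_bidiag.matrix_mul continuous_bidiag.matrix_transpose) (c : ℂ)) (isHermitian_left c) hw

lemma continuous_resolventRight (hw : w.im ≠ 0) :
    Continuous fun u : BidiagIdx n → ℝ => resolventRight c u w :=
  continuous_resolventMatrix (Continuous.const_smul (g := fun u => (bidiag u)ᵀ * bidiag u)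
    (continuous_bidiag.matrix_transpose.matrix_mul continuous_bidiag) (c : ℂ)) (isHermitian_right c) hw

lemma continuous_toda (hw : w.im ≠ 0) (k : BidiagIdx n) : Continuous (toda c w k) :=
  continuous_const.mul (((continuous_resolventRight hw).matrix_elem _ _).sub
    ((continuous_resolventLeft hw).matrix_elem _ _))

lemma continuous_resolventDeriv (hw : w.im ≠ 0) (E : Matrix (Fin (n + 1)) (Fin (n + 1)) ℂ) :
    Continuous fun u : BidiagIdx n → ℝ => resolventDeriv c u w E := by
  have h1 := continuous_resolventLeft (c := c) (n := n) hw
  have h2 := continuous_bidiag (n := n)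
  have h3 := h2.matrix_transpose
  unfold resolventDeriv
  fun_prop

end deriv

/-! ### The χ distribution: exponential moments and integration by parts -/

section chi

/-- The density of the `χ` distribution on `(0, ∞)`. -/
noncomputable def chiDensity (r x : ℝ) : ℝ :=
  2 ^ (1 - r / 2) / Real.Gamma (r / 2) * x ^ (r - 1) * Real.exp (-x ^ 2 / 2)

variable {r : ℝ}

lemma chiDensity_nonneg (hr : 0 < r) {x : ℝ} (hx : 0 < x) : 0 ≤ chiDensity r x := by
  have := Real.Gamma_pos_of_pos (half_pos hr)
  unfold chiDensity
  positivity

lemma measurable_chiDensity : Measurable (chiDensity r) := by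
  unfold chiDensity
  fun_prop

lemma chiMeasure_eq : chiMeasure r =
    (volume.restrict (Set.Ioi 0)).withDensity fun x => ENNReal.ofReal (chiDensity r x) := by
  rw [← withDensity_indicator measurableSet_Ioi, chiMeasure]
  congr 1
  funext x
  by_cases hx : 0 < x
  · simp [hx, chiDensity]
  · simp [hx]

lemma integral_chiMeasure {E : Type*} [NormedAddCommGroup E] [NormedSpace ℝ E] (hr : 0 < r)
    (f : ℝ → E) : ∫ x, f x ∂(chiMeasure r) = ∫ x in Set.Ioi 0, chiDensity r x • f x := by
  rw [chiMeasure_eq, integral_withDensity_eq_integral_toReal_smul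
    (measurable_chiDensity.ennreal_ofReal) (by simp)]
  refine setIntegral_congr_fun measurableSet_Ioi fun x hx => ?_
  simp only [ENNReal.toReal_ofReal (chiDensity_nonneg hr hx)]

lemma integrable_chiMeasure_iff {E : Type*} [NormedAddCommGroup E] [NormedSpace ℝ E] (hr : 0 < r)
    (f : ℝ → E) : Integrable f (chiMeasure r)
      ↔ IntegrableOn (fun x => chiDensity r x • f x) (Set.Ioi 0) := by
  rw [chiMeasure_eq, integrable_withDensity_iff_integrable_smul'
    (measurable_chiDensity.ennreal_ofReal) (by simp)]
  refine integrableOn_congr_fun (fun x hx => ?_) measurableSet_Ioi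
  simp only [ENNReal.toReal_ofReal (chiDensity_nonneg hr hx)]

lemma chiDensity_mul_exp (s : ℝ) {x : ℝ} : chiDensity r x * Real.exp (s * x ^ 2 / 2)
    = 2 ^ (1 - r / 2) / Real.Gamma (r / 2)
      * (x ^ (r - 1) * Real.exp (-((1 - s) / 2) * x ^ (2 : ℝ))) := by
  rw [chiDensity, mul_assoc _ (Real.exp _), ← Real.exp_add, Real.rpow_two, mul_assoc]
  congr 3
  ring

/-- The moment generating function of the square of a `χ` variable. -/
lemma integral_exp_sq_chiMeasure (hr : 0 < r) {s : ℝ} (hs : s < 1) :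
    ∫ x, Real.exp (s * x ^ 2 / 2) ∂(chiMeasure r) = (1 - s) ^ (-(r / 2)) := by
  have hb : 0 < (1 - s) / 2 := by linarith
  have hG := (Real.Gamma_pos_of_pos (half_pos hr)).ne'
  rw [integral_chiMeasure hr]
  simp only [smul_eq_mul, chiDensity_mul_exp]
  rw [integral_const_mul, integral_rpow_mul_exp_neg_mul_rpow (by norm_num) (by linarith) hb]
  rw [show (r - 1 + 1) / 2 = r / 2 by ring, show -(r - 1 + 1) / 2 = -(r / 2) by ring,
    Real.div_rpow (by linarith) (by norm_num), show 1 - r / 2 = 1 + -(r / 2) by ring,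
    Real.rpow_add (by norm_num)]
  have h2 : (2 : ℝ) ^ (-(r / 2)) ≠ 0 := (Real.rpow_pos_of_pos (by norm_num) _).ne'
  rw [Real.rpow_one]
  field_simp

lemma integrable_exp_sq_chiMeasure (hr : 0 < r) {s : ℝ} (hs : s < 1) :
    Integrable (fun x => Real.exp (s * x ^ 2 / 2)) (chiMeasure r) := by
  -- A function that is not integrable has integral 0 by convention, whereas the value just computed
  -- is positive.
  refine not_imp_comm.1 integral_undef ?_
  rw [integral_exp_sq_chiMeasure hr hs]
  exact (Real.rpow_pos_of_pos (by linarith) _).ne'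

lemma isProbabilityMeasure_chiMeasure (hr : 0 < r) : IsProbabilityMeasure (chiMeasure r) := by
  have h1 := integral_exp_sq_chiMeasure hr zero_lt_one
  have h2 := integrable_exp_sq_chiMeasure hr zero_lt_one
  simp only [zero_mul, zero_div, Real.exp_zero, sub_zero, Real.one_rpow] at h1 h2
  have hf : IsFiniteMeasure (chiMeasure r) := by
    rw [integrable_const_iff] at h2
    exact h2.resolve_left one_ne_zero
  rw [integral_const, smul_eq_mul, mul_one] at h1
  exact ⟨by rw [← ENNReal.toReal_eq_one_iff]; exact h1⟩

lemma integrable_sq_chiMeasure (hr : 0 < r) : Integrable (fun x : ℝ => x ^ 2) (chiMeasure r) := by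
  refine ((integrable_exp_sq_chiMeasure hr (s := 1 / 2) (by norm_num)).const_mul 4).mono'
    (by fun_prop) (Filter.Eventually.of_forall fun x => ?_)
  have := Real.add_one_le_exp (1 / 2 * x ^ 2 / 2)
  rw [Real.norm_of_nonneg (sq_nonneg x)]
  linarith

/-- Up to the normalization the function is x times the χ density, so the weight r − x² is the one
of the integration by parts formula. -/
lemma hasDerivAt_rpow_mul_exp {x : ℝ} (hx : 0 < x) :
    HasDerivAt (fun x : ℝ => x ^ r * Real.exp (-x ^ 2 / 2))
      (x ^ (r - 1) * Real.exp (-x ^ 2 / 2) * (r - x ^ 2)) x := by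
  have h1 := Real.hasDerivAt_rpow_const (p := r) (Or.inl hx.ne')
  have h2 : HasDerivAt (fun x : ℝ => Real.exp (-x ^ 2 / 2)) (Real.exp (-x ^ 2 / 2) * (-x)) x := by
    have := (((hasDerivAt_pow 2 x).neg).div_const 2).exp
    refine this.congr_deriv ?_
    simp only [Pi.neg_apply]
    push_cast
    ring
  refine (h1.mul h2).congr_deriv ?_
  have : x ^ r = x ^ (r - 1) * x := by
    rw [← Real.rpow_add_one hx.ne', sub_add_cancel]
  rw [this]
  ring

/-- Integration by parts for the `χ` distribution. -/
lemma integral_stein_chiMeasure (hr : 0 < r) {f f' : ℝ → ℂ} {C : ℝ}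
    (hf : ∀ x, HasDerivAt f (f' x) x) (hb : ∀ x, ‖f x‖ ≤ C)
    (hint : Integrable (fun x : ℝ => (x : ℂ) * f' x + (r - (x : ℂ) ^ 2) * f x) (chiMeasure r)) :
    ∫ x, ((x : ℂ) * f' x + (r - (x : ℂ) ^ 2) * f x) ∂(chiMeasure r) = 0 := by
  set K := (2 : ℝ) ^ (1 - r / 2) / Real.Gamma (r / 2) with hK
  have hfc : Continuous f := continuous_iff_continuousAt.2 fun x => (hf x).continuousAt
  rw [integral_chiMeasure hr]
  rw [integrable_chiMeasure_iff hr] at hint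
  -- The integrand is the derivative of x · density · f, which vanishes at 0 because r > 0 and at
  -- infinity because f is bounded.
  have hd : ∀ x ∈ Set.Ioi (0 : ℝ), HasDerivAt
      (fun x : ℝ => (K * (x ^ r * Real.exp (-x ^ 2 / 2))) • f x)
      (chiDensity r x • ((x : ℂ) * f' x + (r - (x : ℂ) ^ 2) * f x)) x := by
    intro x hx
    refine (((hasDerivAt_rpow_mul_exp (r := r) hx).const_mul K).smul (hf x)).congr_deriv ?_
    have : x ^ r = x ^ (r - 1) * x := by
      rw [← Real.rpow_add_one (ne_of_gt hx), sub_add_cancel]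
    rw [this, chiDensity, ← hK]
    simp only [Complex.real_smul]
    push_cast
    ring
  have hcont : Continuous (fun x : ℝ => (K * (x ^ r * Real.exp (-x ^ 2 / 2))) • f x) := by
    refine Continuous.smul (continuous_const.mul ((Real.continuous_rpow_const hr.le).mul ?_)) hfc
    fun_prop
  have hlim : Filter.Tendsto (fun x : ℝ => (K * (x ^ r * Real.exp (-x ^ 2 / 2))) • f x)
      Filter.atTop (nhds 0) := by
    have h1 : Filter.Tendsto (fun x : ℝ => x ^ r * Real.exp (-x ^ 2 / 2)) Filter.atTop (nhds 0) := by
      have := (rpow_mul_exp_neg_mul_sq_isLittleO_exp_neg (b := 1 / 2) (by norm_num) r).trans_tendsto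
        (Real.tendsto_exp_atBot.comp (Filter.tendsto_id.const_mul_atTop_of_neg (by norm_num)))
      refine this.congr fun x => ?_
      congr 2
      ring
    rw [tendsto_zero_iff_norm_tendsto_zero]
    refine squeeze_zero (fun _ => norm_nonneg _) (fun x => ?_)
      (g := fun x => |K| * |x ^ r * Real.exp (-x ^ 2 / 2)| * C) ?_
    · rw [norm_smul, norm_mul]
      exact mul_le_mul_of_nonneg_left (hb x) (by positivity)
    · have := ((h1.abs).const_mul |K|).mul_const C
      simpa using this
  rw [integral_Ioi_of_hasDerivAt_of_tendsto hcont.continuousWithinAt hd hint hlim]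
  simp [Real.zero_rpow hr.ne']

end chi

/-! ### Integration by parts for products of χ distributions -/

section pi

variable {ι : Type*} [Fintype ι] [DecidableEq ι]

/-- Resampling one coordinate preserves a product measure. -/
lemma measurePreserving_update {μ : ι → Measure ℝ} [∀ i, IsProbabilityMeasure (μ i)] (i : ι) :
    MeasurePreserving (fun p : (ι → ℝ) × ℝ => Function.update p.1 i p.2)
      ((Measure.pi μ).prod (μ i)) (Measure.pi μ) := by
  have hm : Measurable (fun p : (ι → ℝ) × ℝ => Function.update p.1 i p.2) := by
    refine measurable_pi_iff.2 fun j => ?_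
    by_cases h : j = i
    · subst h; simpa using measurable_snd
    · simp only [Function.update_of_ne h]; fun_prop
  refine ⟨hm, (Measure.pi_eq fun s hs => ?_).symm⟩
  rw [Measure.map_apply hm (MeasurableSet.univ_pi hs)]
  have : (fun p : (ι → ℝ) × ℝ => Function.update p.1 i p.2) ⁻¹' (Set.univ.pi s)
      = (Set.univ.pi (Function.update s i Set.univ)) ×ˢ (s i) := by
    ext ⟨x, t⟩
    simp only [Set.mem_preimage, Set.mem_pi, Set.mem_univ, true_imp_iff, Set.mem_prod]
    constructor
    · intro h
      refine ⟨fun j => ?_, by simpa using h i⟩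
      by_cases hj : j = i
      · subst hj; simp
      · have := h j
        rwa [Function.update_of_ne hj] at this ⊢
    · rintro ⟨h, ht⟩ j
      by_cases hj : j = i
      · subst hj; simpa using ht
      · have := h j
        rwa [Function.update_of_ne hj] at this ⊢
  rw [this, Measure.prod_prod, Measure.pi_pi, ← Finset.prod_erase_mul _ _ (Finset.mem_univ i),
    ← Finset.prod_erase_mul _ (fun i => μ i (s i)) (Finset.mem_univ i), Function.update_self,
    measure_univ, mul_one]
  congr 1
  refine Finset.prod_congr rfl fun j hj => ?_
  rw [Function.update_of_ne (Finset.ne_of_mem_erase hj)]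

/-- Integration by parts in one coordinate for a product of `χ` distributions. -/
lemma integral_stein_pi_chiMeasure {r : ι → ℝ} (hr : ∀ i, 0 < r i) {F F' : (ι → ℝ) → ℂ} {C C' : ℝ}
    (i : ι) (hF : ∀ u, HasDerivAt (fun t => F (Function.update u i t)) (F' u) (u i))
    (hFm : Continuous F) (hFm' : Continuous F') (hb : ∀ u, ‖F u‖ ≤ C)
    (hb' : ∀ u, ‖(u i : ℂ) * F' u‖ ≤ C' * (1 + ∑ j, u j ^ 2)) :
    Integrable (fun u => (u i : ℂ) * F' u) (Measure.pi fun i => chiMeasure (r i)) ∧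
    Integrable (fun u => (r i - (u i : ℂ) ^ 2) * F u) (Measure.pi fun i => chiMeasure (r i)) ∧
    ∫ u, ((u i : ℂ) * F' u + (r i - (u i : ℂ) ^ 2) * F u) ∂(Measure.pi fun i => chiMeasure (r i))
      = 0 := by
  have hprob : ∀ i, IsProbabilityMeasure (chiMeasure (r i)) := fun i =>
    isProbabilityMeasure_chiMeasure (hr i)
  set μ := Measure.pi fun i => chiMeasure (r i) with hμ
  have hsq : ∀ j, Integrable (fun u : ι → ℝ => u j ^ 2) μ := fun j =>
    (measurePreserving_eval (fun i => chiMeasure (r i)) j).integrable_comp_of_integrable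
      (integrable_sq_chiMeasure (hr j))
  have hsum : Integrable (fun u : ι → ℝ => 1 + ∑ j, u j ^ 2) μ :=
    (integrable_const _).add (integrable_finsetSum _ fun j _ => hsq j)
  have hC : 0 ≤ C := (norm_nonneg _).trans (hb 0)
  have i1 : Integrable (fun u => (u i : ℂ) * F' u) μ := by
    refine (hsum.const_mul C').mono' ?_ (Filter.Eventually.of_forall hb')
    exact (by fun_prop : Continuous fun u : ι → ℝ => (u i : ℂ) * F' u).aestronglyMeasurable
  have i2 : Integrable (fun u => (r i - (u i : ℂ) ^ 2) * F u) μ := by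
    refine (((integrable_const |r i|).add (hsq i)).mul_const C).mono' ?_
      (Filter.Eventually.of_forall fun u => ?_)
    · exact (by fun_prop : Continuous fun u : ι → ℝ =>
        ((r i : ℂ) - (u i : ℂ) ^ 2) * F u).aestronglyMeasurable
    · rw [norm_mul]
      refine mul_le_mul ((norm_sub_le _ _).trans_eq ?_) (hb u) (norm_nonneg _)
        (add_nonneg (abs_nonneg _) (sq_nonneg _))
      simp
  refine ⟨i1, i2, ?_⟩
  -- Since resampling coordinate i preserves the law, Fubini leaves an inner integral over a fresh χ
  -- variable, to which the one-dimensional formula applies.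
  have mp := measurePreserving_update (μ := fun i => chiMeasure (r i)) i
  have i3 := i1.add i2
  have i4 : Integrable (fun p : (ι → ℝ) × ℝ =>
      ((Function.update p.1 i p.2) i : ℂ) * F' (Function.update p.1 i p.2)
        + (r i - ((Function.update p.1 i p.2) i : ℂ) ^ 2) * F (Function.update p.1 i p.2))
      ((Measure.pi fun i => chiMeasure (r i)).prod (chiMeasure (r i))) :=
    mp.integrable_comp_of_integrable i3
  have hfc : Continuous fun u : ι → ℝ => (u i : ℂ) * F' u + (r i - (u i : ℂ) ^ 2) * F u := by
    fun_prop
  rw [hμ, ← mp.map_eq, integral_map mp.measurable.aemeasurable hfc.aestronglyMeasurable,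
    integral_prod _ i4]
  have hae := i4.prod_right_ae
  have : ∀ᵐ u ∂μ, ∫ t, (((Function.update u i t) i : ℂ) * F' (Function.update u i t)
      + (r i - ((Function.update u i t) i : ℂ) ^ 2) * F (Function.update u i t)) ∂(chiMeasure (r i))
      = 0 := by
    filter_upwards [hae] with u hu
    simp only [Function.update_self] at hu
    simp only [Function.update_self]
    refine integral_stein_chiMeasure (hr i) (C := C) (fun t => ?_) (fun t => hb _) hu
    have := hF (Function.update u i t)
    simpa only [Function.update_idem, Function.update_self] using this
  rw [integral_congr_ae this, integral_zero]

end pi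

/-! ### The gap between the corner entry and the normalized trace -/

section gap

variable {n : ℕ} {c : ℝ} {u : BidiagIdx n → ℝ} {z w : ℂ}

lemma norm_bidiag_le (u : BidiagIdx n → ℝ) (i j : Fin (n + 1)) : ‖bidiag u i j‖ ≤ ∑ k, |u k| := by
  rw [bidiag, sum_smul_single_apply]
  refine norm_sum_le_of_le _ fun k _ => ?_
  split_ifs <;> simp

/-- This bound and the ones derived from it are crude in n and η; they only provide the domination
needed for integrability. -/
lemma abs_mul_norm_resolventLeft_mul_bidiag_le (hw : w.im ≠ 0) (k : BidiagIdx n)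
    (i j : Fin (n + 1)) : |u k| * ‖(resolventLeft c u w * bidiag u) i j‖
      ≤ (n + 1) * |w.im|⁻¹ * Fintype.card (BidiagIdx n) * (1 + ∑ k, u k ^ 2) := by
  have h1 : ‖(resolventLeft c u w * bidiag u) i j‖ ≤ (n + 1) * |w.im|⁻¹ * ∑ k, |u k| := by
    rw [Matrix.mul_apply]
    calc _ ≤ ∑ _k : Fin (n + 1), |w.im|⁻¹ * ∑ k, |u k| := by
          refine norm_sum_le_of_le _ fun l _ => ?_
          rw [norm_mul]
          exact mul_le_mul (norm_resolventMatrix_apply_le (isHermitian_left c u) hw i l)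
            (norm_bidiag_le u l j) (norm_nonneg _) (by positivity)
      _ = _ := by simp; ring
  have h2 : |u k| ≤ ∑ k, |u k| :=
    Finset.single_le_sum (f := fun k => |u k|) (fun _ _ => abs_nonneg _) (Finset.mem_univ k)
  have h3 : (∑ k, |u k|) ^ 2 ≤ Fintype.card (BidiagIdx n) * ∑ k, u k ^ 2 := by
    have := sq_sum_le_card_mul_sum_sq (s := Finset.univ) (f := fun k => |u k|)
    simpa only [sq_abs, Finset.card_univ] using this
  calc _ ≤ (∑ k, |u k|) * ((n + 1) * |w.im|⁻¹ * ∑ k, |u k|) := by gcongr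
    _ = (n + 1) * |w.im|⁻¹ * (∑ k, |u k|) ^ 2 := by ring
    _ ≤ (n + 1) * |w.im|⁻¹ * (Fintype.card (BidiagIdx n) * ∑ k, u k ^ 2) := by gcongr
    _ ≤ (n + 1) * |w.im|⁻¹ * (Fintype.card (BidiagIdx n) * (1 + ∑ k, u k ^ 2)) := by
        gcongr; linarith
    _ = _ := by ring

/-- The derivative of the resolvent in the direction of a coordinate. -/
noncomputable abbrev resolventPartial (c : ℝ) (u : BidiagIdx n → ℝ) (w : ℂ) (k : BidiagIdx n) :
    Matrix (Fin (n + 1)) (Fin (n + 1)) ℂ :=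
  resolventDeriv c u w (Matrix.single (bidiagRow k) (bidiagCol k) 1)

lemma resolventPartial_apply (k : BidiagIdx n) (i j : Fin (n + 1)) :
    resolventPartial c u w k i j = -(c * (resolventLeft c u w i (bidiagRow k)
      * (resolventLeft c u w * bidiag u) j (bidiagCol k)
      + (resolventLeft c u w * bidiag u) i (bidiagCol k) * resolventLeft c u w (bidiagRow k) j)) := by
  have key : ∀ (A X : Matrix (Fin (n + 1)) (Fin (n + 1)) ℂ) (a b : Fin (n + 1)),
      (X * Matrix.single a b (1 : ℂ) * A) i j = X i a * A b j := by
    intro A X a b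
    rw [Matrix.mul_assoc, Matrix.mul_apply, Fintype.sum_eq_single a]
    · rw [Matrix.single_mul_apply_same, one_mul]
    · intro x hx
      rw [Matrix.single_mul_apply_of_ne _ _ _ _ _ hx, mul_zero]
  have t2 : ((bidiag u)ᵀ * resolventLeft c u w) = (resolventLeft c u w * bidiag u)ᵀ := by
    rw [Matrix.transpose_mul, transpose_resolventLeft]
  rw [resolventPartial, resolventDeriv, Matrix.mul_add, Matrix.add_mul, ← Matrix.mul_assoc,
    Matrix.mul_assoc _ (bidiag u)ᵀ, t2, Matrix.transpose_single, ← Matrix.mul_assoc _ (bidiag u),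
    Matrix.neg_apply, Matrix.smul_apply, Matrix.add_apply, key, key, Matrix.transpose_apply,
    smul_eq_mul]

lemma norm_mul_resolventPartial_le (hw : w.im ≠ 0) (k : BidiagIdx n) (i j : Fin (n + 1)) :
    |u k| * ‖resolventPartial c u w k i j‖
      ≤ 2 * |c| * |w.im|⁻¹ * ((n + 1) * |w.im|⁻¹ * Fintype.card (BidiagIdx n))
        * (1 + ∑ k, u k ^ 2) := by
  set K : ℝ := (n + 1) * |w.im|⁻¹ * Fintype.card (BidiagIdx n) * (1 + ∑ k, u k ^ 2) with hK
  have h1 := abs_mul_norm_resolventLeft_mul_bidiag_le (c := c) (u := u) hw k j (bidiagCol k)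
  have h2 := abs_mul_norm_resolventLeft_mul_bidiag_le (c := c) (u := u) hw k i (bidiagCol k)
  have h3 : ∀ i j, ‖resolventLeft c u w i j‖ ≤ |w.im|⁻¹ :=
    norm_resolventMatrix_apply_le (isHermitian_left c u) hw
  rw [← hK] at h1 h2
  have hK0 : 0 ≤ K := le_trans (by positivity) h1
  rw [resolventPartial_apply, norm_neg, norm_mul, Complex.norm_real, Real.norm_eq_abs]
  calc _ ≤ |u k| * (|c| * (|w.im|⁻¹ * ‖(resolventLeft c u w * bidiag u) j (bidiagCol k)‖
        + ‖(resolventLeft c u w * bidiag u) i (bidiagCol k)‖ * |w.im|⁻¹)) := by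
        gcongr
        refine (norm_add_le _ _).trans ?_
        rw [norm_mul, norm_mul]
        gcongr <;> exact h3 _ _
    _ = |c| * |w.im|⁻¹ * (|u k| * ‖(resolventLeft c u w * bidiag u) j (bidiagCol k)‖
        + |u k| * ‖(resolventLeft c u w * bidiag u) i (bidiagCol k)‖) := by ring
    _ ≤ |c| * |w.im|⁻¹ * (K + K) := by gcongr
    _ = _ := by rw [hK]; ring

/-- The difference between the first entry and the normalized trace of the resolvent. -/
noncomputable def stieltjesGap (c : ℝ) (w : ℂ) (u : BidiagIdx n → ℝ) : ℂ :=
  resolventLeft c u w 0 0 - ((n : ℂ) + 1)⁻¹ * (resolventLeft c u w).trace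

/-- The partial derivatives of `stieltjesGap`. -/
noncomputable def stieltjesGapPartial (c : ℝ) (w : ℂ) (k : BidiagIdx n) (u : BidiagIdx n → ℝ) : ℂ :=
  resolventPartial c u w k 0 0 - ((n : ℂ) + 1)⁻¹ * (resolventPartial c u w k).trace

lemma hasDerivAt_stieltjesGap (hw : w.im ≠ 0) (k : BidiagIdx n) :
    HasDerivAt (fun t => stieltjesGap c w (Function.update u k t)) (stieltjesGapPartial c w k u)
      (u k) := by
  have h1 := hasDerivAt_resolventLeft (c := c) (u := u) hw k 0 0
  have h2 : HasDerivAt (fun t => ∑ i, resolventLeft c (Function.update u k t) w i i)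
      (∑ i, resolventPartial c u w k i i) (u k) :=
    HasDerivAt.fun_sum fun i _ => hasDerivAt_resolventLeft hw k i i
  have h3 := h1.sub (h2.const_mul ((n : ℂ) + 1)⁻¹)
  simp only [stieltjesGap, stieltjesGapPartial, Matrix.trace, Matrix.diag_apply]
  exact h3

lemma continuous_stieltjesGap (hw : w.im ≠ 0) :
    Continuous (stieltjesGap c w : (BidiagIdx n → ℝ) → ℂ) :=
  ((continuous_resolventLeft hw).matrix_elem 0 0).sub
    (continuous_const.mul (continuous_resolventLeft hw).matrix_trace)

lemma continuous_stieltjesGapPartial (hw : w.im ≠ 0) (k : BidiagIdx n) :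
    Continuous (stieltjesGapPartial c w k) :=
  ((continuous_resolventDeriv hw _).matrix_elem 0 0).sub
    (continuous_const.mul (continuous_resolventDeriv hw _).matrix_trace)

lemma norm_inv_natCast_add_one (n : ℕ) : ‖((n : ℂ) + 1)⁻¹‖ = ((n : ℝ) + 1)⁻¹ := by
  rw [norm_inv]
  congr 1
  exact_mod_cast Complex.norm_natCast (n + 1)

lemma norm_stieltjesGap_le (hw : w.im ≠ 0) : ‖stieltjesGap c w u‖ ≤ 2 * |w.im|⁻¹ := by
  have h1 := norm_resolventMatrix_apply_le (isHermitian_left c u) hw 0 0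
  have h2 := norm_trace_resolventMatrix_le (isHermitian_left c u) hw
  refine (norm_sub_le _ _).trans ?_
  rw [norm_mul, norm_inv_natCast_add_one, two_mul]
  refine add_le_add h1 ?_
  calc _ ≤ ((n : ℝ) + 1)⁻¹ * (Fintype.card (Fin (n + 1)) * |w.im|⁻¹) := by gcongr; exact h2
    _ = |w.im|⁻¹ := by
        rw [Fintype.card_fin]; push_cast
        field_simp

lemma norm_mul_stieltjesGapPartial_le (hw : w.im ≠ 0) (k : BidiagIdx n) :
    |u k| * ‖stieltjesGapPartial c w k u‖
      ≤ 2 * (2 * |c| * |w.im|⁻¹ * ((n + 1) * |w.im|⁻¹ * Fintype.card (BidiagIdx n)))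
        * (1 + ∑ k, u k ^ 2) := by
  have h1 := fun i => norm_mul_resolventPartial_le (c := c) (u := u) hw k i i
  set K := 2 * |c| * |w.im|⁻¹ * ((n + 1) * |w.im|⁻¹ * Fintype.card (BidiagIdx n))
        * (1 + ∑ k, u k ^ 2) with hK
  have h2 : |u k| * ‖(resolventPartial c u w k).trace‖ ≤ (n + 1) * K := by
    calc _ ≤ |u k| * ∑ i, ‖resolventPartial c u w k i i‖ := by
          gcongr; exact norm_sum_le _ _
      _ = ∑ i, |u k| * ‖resolventPartial c u w k i i‖ := Finset.mul_sum _ _ _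
      _ ≤ ∑ _i : Fin (n + 1), K := Finset.sum_le_sum fun i _ => h1 i
      _ = _ := by simp
  calc _ ≤ |u k| * (‖resolventPartial c u w k 0 0‖
        + ((n : ℝ) + 1)⁻¹ * ‖(resolventPartial c u w k).trace‖) := by
        gcongr
        refine (norm_sub_le _ _).trans_eq ?_
        rw [norm_mul, norm_inv_natCast_add_one]
    _ = |u k| * ‖resolventPartial c u w k 0 0‖
        + ((n : ℝ) + 1)⁻¹ * (|u k| * ‖(resolventPartial c u w k).trace‖) := by ring
    _ ≤ K + ((n : ℝ) + 1)⁻¹ * ((n + 1) * K) := by gcongr; exact h1 0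
    _ = _ := by rw [inv_mul_cancel_left₀ (by positivity), hK]; ring

lemma conj_stieltjesGap (hw : w.im ≠ 0) : conj (stieltjesGap c w u) = stieltjesGap c (conj w) u := by
  simp only [stieltjesGap, Matrix.trace, Matrix.diag_apply, map_sub, map_mul, map_sum, resolventLeft,
    conj_resolventMatrix (isHermitian_left c u) hw]
  simp

/-- The Toda vector field moves `stieltjesGap` slowly. -/
lemma norm_sum_toda_mul_stieltjesGapPartial_le (hz : 0 < z.im) (hw : w = z ∨ w = conj z) :
    ‖∑ k, u k * toda c z k u * stieltjesGapPartial c w k u‖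
      ≤ 2 * ((resolventLeft c u z 0 0).im / z.im) := by
  have hwi : w.im ≠ 0 := by
    rcases hw with rfl | rfl
    · exact hz.ne'
    · simpa using hz.ne'
  have h1 := sum_toda_mul_resolventDeriv (c := c) (u := u) hz.ne' hwi
  have h2 : ∑ k, u k * toda c z k u * stieltjesGapPartial c w k u
      = (upperPart (resolventLeft c u z) * resolventLeft c u w
        - resolventLeft c u w * upperPart (resolventLeft c u z)) 0 0
        - ((n : ℂ) + 1)⁻¹ * (upperPart (resolventLeft c u z) * resolventLeft c u w
        - resolventLeft c u w * upperPart (resolventLeft c u z)).trace := by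
    rw [← h1, Matrix.trace_sum, Matrix.sum_apply, Finset.mul_sum, ← Finset.sum_sub_distrib]
    refine Finset.sum_congr rfl fun k _ => ?_
    rw [Matrix.smul_apply, Matrix.trace_smul, stieltjesGapPartial, smul_eq_mul, smul_eq_mul]
    ring
  -- A commutator has trace zero, so the flow preserves the trace of the resolvent and only the
  -- corner entry moves.
  rw [h2, Matrix.trace_sub, Matrix.trace_mul_comm, sub_self, mul_zero, sub_zero]
  exact norm_upperPart_commutator_le hz hw

lemma norm_toda_le (hz : z.im ≠ 0) (k : BidiagIdx n) : ‖toda c z k u‖ ≤ 2 * |z.im|⁻¹ := by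
  have h1 := norm_resolventMatrix_apply_le (isHermitian_left c u) hz (bidiagRow k) (bidiagRow k)
  have h2 := norm_resolventMatrix_apply_le (isHermitian_right c u) hz (bidiagCol k) (bidiagCol k)
  rw [toda, norm_mul]
  have : ‖(k.elim (fun _ => 1) (fun _ => -1) : ℂ)‖ = 1 := by
    rcases k with k | k <;> simp
  rw [this, one_mul, two_mul]
  exact (norm_sub_le _ _).trans (add_le_add h2 h1)

/-- This is the domination hypothesis of `integral_stein_pi_chiMeasure` for the derivative of a Toda
component times a test function. -/
lemma sum_sq_norm_aux (k : BidiagIdx n) (hz : z.im ≠ 0) {G G' : ℂ} {A A' : ℝ} (hG : ‖G‖ ≤ A)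
    (hG' : |u k| * ‖G'‖ ≤ A' * (1 + ∑ k, u k ^ 2)) :
    ‖(u k : ℂ) * (-2 * (c * (resolventLeft c u z * bidiag u) (bidiagRow k) (bidiagCol k))
        * toda c z k u * G + toda c z k u * G')‖
      ≤ (2 * |z.im|⁻¹ * (2 * |c| * ((n + 1) * |z.im|⁻¹ * Fintype.card (BidiagIdx n)) * A + A'))
        * (1 + ∑ k, u k ^ 2) := by
  have h1 := abs_mul_norm_resolventLeft_mul_bidiag_le (c := c) (u := u) hz k (bidiagRow k)
    (bidiagCol k)
  have h2 := norm_toda_le (c := c) (u := u) hz k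
  set K := (n + 1) * |z.im|⁻¹ * Fintype.card (BidiagIdx n)
  set Q := (resolventLeft c u z * bidiag u) (bidiagRow k) (bidiagCol k)
  set S := 1 + ∑ k, u k ^ 2
  have hA : 0 ≤ A := (norm_nonneg _).trans hG
  have e : (u k : ℂ) * (-2 * (c * Q) * toda c z k u * G + toda c z k u * G')
      = toda c z k u * (-2 * c * (u k * Q) * G + u k * G') := by ring
  rw [e, norm_mul]
  have h3 : ‖-2 * (c : ℂ) * (u k * Q) * G + u k * G'‖ ≤ 2 * |c| * (K * S) * A + A' * S := by
    refine (norm_add_le _ _).trans ?_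
    simp only [norm_mul, norm_neg, Complex.norm_real, Real.norm_eq_abs, Complex.norm_ofNat]
    have : 0 ≤ K * S := le_trans (by positivity) h1
    gcongr
  calc _ ≤ 2 * |z.im|⁻¹ * (2 * |c| * (K * S) * A + A' * S) := by gcongr
    _ = _ := by ring

lemma hasDerivAt_pow_mul_pow {f g : ℝ → ℂ} {f' g' : ℂ} {s : ℝ} (hf : HasDerivAt f f' s)
    (hg : HasDerivAt g g' s) (k : ℕ) :
    HasDerivAt (fun t => f t ^ k * g t ^ (k + 1))
      (k * f s ^ (k - 1) * g s ^ (k + 1) * f' + (k + 1) * f s ^ k * g s ^ k * g') s := by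
  refine ((hf.fun_pow k).mul (hg.fun_pow (k + 1))).congr_deriv ?_
  simp only [Nat.add_sub_cancel]
  push_cast
  ring

end gap

/-! ### Integration by parts along the Toda field and moments of the gap -/

section moment

variable {n : ℕ} {c β ρ : ℝ} {z : ℂ}

/-- Integration by parts along the Toda vector field. -/
lemma integral_toda_eq (hpar : ∀ k : BidiagIdx n, 0 < laguerreParam β ρ k) (hz : z.im ≠ 0)
    {G : (BidiagIdx n → ℝ) → ℂ} {G' : BidiagIdx n → (BidiagIdx n → ℝ) → ℂ} {A A' : ℝ}
    (hGd : ∀ i u, HasDerivAt (fun t => G (Function.update u i t)) (G' i u) (u i))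
    (hGc : Continuous G) (hGc' : ∀ i, Continuous (G' i)) (hGb : ∀ u, ‖G u‖ ≤ A)
    (hGb' : ∀ i u, |u i| * ‖G' i u‖ ≤ A' * (1 + ∑ k, u k ^ 2)) :
    ∫ u, ((∑ i, u i * toda c z i u * G' i u) - β * (n + 1) * (stieltjesGap c z u * G u))
      ∂(Measure.pi fun i : BidiagIdx n => chiMeasure (laguerreParam β ρ i)) = 0 := by
  have stein := fun i => integral_stein_pi_chiMeasure hpar
    (F := fun u => toda c z i u * G u)
    (F' := fun u => -2 * (c * (resolventLeft c u z * bidiag u) (bidiagRow i) (bidiagCol i))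
      * toda c z i u * G u + toda c z i u * G' i u) i
    (C := 2 * |z.im|⁻¹ * A)
    (C' := 2 * |z.im|⁻¹ * (2 * |c| * ((n + 1) * |z.im|⁻¹ * Fintype.card (BidiagIdx n))
      * A + A'))
    (fun u => by
      have h3 := (hasDerivAt_toda (c := c) (u := u) hz i).mul (hGd i u)
      simp only [Function.update_eq_self] at h3
      exact h3)
    ((continuous_toda hz i).mul hGc)
    (by
      have h1 := continuous_toda (c := c) hz i
      have h2 : Continuous fun u => (resolventLeft c u z * bidiag u) (bidiagRow i) (bidiagCol i) :=
        ((continuous_resolventLeft hz).matrix_mul continuous_bidiag).matrix_elem _ _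
      exact (((continuous_const.mul (continuous_const.mul h2)).mul h1).mul hGc).add
        (h1.mul (hGc' i)))
    (fun u => by
      rw [norm_mul]
      exact mul_le_mul (norm_toda_le hz i) (hGb u) (norm_nonneg _) (by positivity))
    (fun u => sum_sq_norm_aux i hz (hGb u) (hGb' i u))
  have hint := fun i => (stein i).1.add (stein i).2.1
  have hsum := integral_finsetSum Finset.univ fun i _ => hint i
  refine Eq.trans (integral_congr_ae (Filter.Eventually.of_forall fun u => ?_))
    (hsum.trans (Finset.sum_eq_zero fun i _ => (stein i).2.2))
  -- Divergence, Gaussian term and χ parameters: the first two sums vanish, and the third equals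
  -- −β(n + 1) times the gap.
  have s1 := sum_toda_flux (c := c) (u := u) hz
  have s2 := sum_sq_mul_toda (c := c) (u := u) hz
  have s3 := sum_laguerreParam_mul_toda (c := c) (u := u) β ρ hz
  have s4 : β * ((resolventLeft c u z).trace - (n + 1) * resolventLeft c u z 0 0)
      = -(β * (n + 1) * stieltjesGap c z u) := by
    have : ((n : ℂ) + 1) ≠ 0 := by exact_mod_cast Nat.succ_ne_zero n
    simp only [stieltjesGap]
    field_simp
    ring
  rw [s4] at s3
  have e : ∑ i, ((u i : ℂ) * (-2 * (c * (resolventLeft c u z * bidiag u) (bidiagRow i) (bidiagCol i))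
      * toda c z i u * G u + toda c z i u * G' i u)
      + (laguerreParam β ρ i - (u i : ℂ) ^ 2) * (toda c z i u * G u))
      = (-2 * G u) * ∑ i, (c * u i * (resolventLeft c u z * bidiag u) (bidiagRow i) (bidiagCol i))
          * toda c z i u
        + G u * ∑ i, (laguerreParam β ρ i : ℂ) * toda c z i u
        - G u * ∑ i, (u i : ℂ) ^ 2 * toda c z i u + ∑ i, u i * toda c z i u * G' i u := by
    simp only [Finset.mul_sum, ← Finset.sum_add_distrib, ← Finset.sum_sub_distrib]
    exact Finset.sum_congr rfl fun i _ => by ring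
  refine Eq.trans ?_ e.symm
  rw [s1, s2, s3]
  ring

lemma norm_stieltjesGap_conj (hz : z.im ≠ 0) (u : BidiagIdx n → ℝ) :
    ‖stieltjesGap c (conj z) u‖ = ‖stieltjesGap c z u‖ := by
  rw [← conj_stieltjesGap hz, RCLike.norm_conj]

lemma norm_natCast_add_one (k : ℕ) : ‖(k : ℂ) + 1‖ = k + 1 := by
  exact_mod_cast Complex.norm_natCast (k + 1)

lemma natCast_mul_pow_pred (k : ℕ) (a : ℝ) :
    (k : ℝ) * a ^ (k - 1) * a ^ (k + 1) = k * a ^ (2 * k) := by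
  rcases k with _ | k
  · simp
  · rw [mul_assoc, ← pow_add]; congr 2; simp; ring

/-- The test function used for the moments of `stieltjesGap`. -/
noncomputable def gapTest (c : ℝ) (z : ℂ) (k : ℕ) (u : BidiagIdx n → ℝ) : ℂ :=
  stieltjesGap c z u ^ k * stieltjesGap c (conj z) u ^ (k + 1)

/-- The derivative of `gapTest` given the derivatives of its factors. -/
noncomputable def gapTestDeriv (c : ℝ) (z : ℂ) (k : ℕ) (u : BidiagIdx n → ℝ) (a b : ℂ) : ℂ :=
  k * stieltjesGap c z u ^ (k - 1) * stieltjesGap c (conj z) u ^ (k + 1) * a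
    + (k + 1) * stieltjesGap c z u ^ k * stieltjesGap c (conj z) u ^ k * b

lemma norm_gapTestDeriv_le (hz : z.im ≠ 0) (k : ℕ) (u : BidiagIdx n → ℝ) {a b : ℂ} :
    ‖gapTestDeriv c z k u a b‖
      ≤ k * ‖stieltjesGap c z u‖ ^ (2 * k) * ‖a‖ + (k + 1) * ‖stieltjesGap c z u‖ ^ (2 * k) * ‖b‖ := by
  refine (norm_add_le _ _).trans_eq ?_
  simp only [norm_mul, norm_pow, Complex.norm_natCast, norm_natCast_add_one,
    norm_stieltjesGap_conj hz, natCast_mul_pow_pred]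
  rw [mul_assoc ((k : ℝ) + 1), ← pow_add, two_mul]

lemma gapTestDeriv_sum (k : ℕ) (u : BidiagIdx n → ℝ) (f a b : BidiagIdx n → ℂ) :
    ∑ i, f i * gapTestDeriv c z k u (a i) (b i)
      = gapTestDeriv c z k u (∑ i, f i * a i) (∑ i, f i * b i) := by
  simp only [gapTestDeriv, Finset.mul_sum, ← Finset.sum_add_distrib]
  exact Finset.sum_congr rfl fun i _ => by ring

lemma stieltjesGap_mul_gapTest (hz : z.im ≠ 0) (k : ℕ) (u : BidiagIdx n → ℝ) :
    stieltjesGap c z u * gapTest c z k u = ((‖stieltjesGap c z u‖ ^ (2 * k + 2) : ℝ) : ℂ) := by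
  have : stieltjesGap c z u * gapTest c z k u
      = (stieltjesGap c z u * conj (stieltjesGap c z u)) ^ (k + 1) := by
    rw [gapTest, conj_stieltjesGap hz, mul_pow]; ring
  rw [this, Complex.mul_conj, Complex.normSq_eq_norm_sq]
  push_cast
  ring

lemma integrable_pi_of_bound {r : BidiagIdx n → ℝ} (hr : ∀ k, 0 < r k) {E : Type*}
    [NormedAddCommGroup E] [SecondCountableTopology E] {f : (BidiagIdx n → ℝ) → E} {C : ℝ}
    (hf : Continuous f) (hb : ∀ u, ‖f u‖ ≤ C) :
    Integrable f (Measure.pi fun i : BidiagIdx n => chiMeasure (r i)) := by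
  have hprob : ∀ i : BidiagIdx n, IsProbabilityMeasure (chiMeasure (r i)) :=
    fun i => isProbabilityMeasure_chiMeasure (hr i)
  exact Integrable.of_bound hf.aestronglyMeasurable _ (Filter.Eventually.of_forall hb)

/-- The exponents of `gapTest` are chosen so that its product with the gap is an even power of the
modulus. Its conjugate factor is the gap at the conjugate point, so its derivatives are resolvent
expressions too. -/
lemma integral_gapTest (hpar : ∀ k : BidiagIdx n, 0 < laguerreParam β ρ k) (hz : z.im ≠ 0) (k : ℕ) :
    ∫ u, (gapTestDeriv c z k u (∑ i, u i * toda c z i u * stieltjesGapPartial c z i u)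
          (∑ i, u i * toda c z i u * stieltjesGapPartial c (conj z) i u)
        - β * (n + 1) * ((‖stieltjesGap c z u‖ ^ (2 * k + 2) : ℝ) : ℂ))
      ∂(Measure.pi fun i : BidiagIdx n => chiMeasure (laguerreParam β ρ i)) = 0 := by
  have hz' : (conj z).im ≠ 0 := by simpa using hz
  have hWc := continuous_stieltjesGap (c := c) (n := n) hz
  have hVc := continuous_stieltjesGap (c := c) (n := n) hz'
  set M := 2 * |z.im|⁻¹ with hM
  have hWb : ∀ u : BidiagIdx n → ℝ, ‖stieltjesGap c z u‖ ≤ M := fun u => norm_stieltjesGap_le hz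
  set D := 2 * (2 * |c| * |z.im|⁻¹ * ((n + 1) * |z.im|⁻¹ * Fintype.card (BidiagIdx n))) with hD
  have h := integral_toda_eq (c := c) hpar hz (G := gapTest c z k)
    (G' := fun i u => gapTestDeriv c z k u (stieltjesGapPartial c z i u)
      (stieltjesGapPartial c (conj z) i u))
    (A := M ^ k * M ^ (k + 1))
    (A' := k * M ^ (2 * k) * D + (k + 1) * M ^ (2 * k) * D)
    (fun i u => by
      have h2 := hasDerivAt_pow_mul_pow (hasDerivAt_stieltjesGap (c := c) (u := u) hz i)
        (hasDerivAt_stieltjesGap (c := c) (u := u) hz' i) k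
      simp only [Function.update_eq_self] at h2
      exact h2)
    ((hWc.pow _).mul (hVc.pow _))
    (fun i => by
      have h1 := continuous_stieltjesGapPartial (c := c) hz i
      have h2 := continuous_stieltjesGapPartial (c := c) hz' i
      exact (((continuous_const.mul (hWc.pow _)).mul (hVc.pow _)).mul h1).add
        (((continuous_const.mul (hWc.pow _)).mul (hVc.pow _)).mul h2))
    (fun u => by
      rw [gapTest, norm_mul, norm_pow, norm_pow, norm_stieltjesGap_conj hz]
      have := hWb u
      gcongr)
    (fun i u => by
      have h1 := norm_mul_stieltjesGapPartial_le (c := c) (u := u) hz i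
      have h2 := norm_mul_stieltjesGapPartial_le (c := c) (u := u) hz' i
      have habs : |(conj z).im| = |z.im| := by simp
      rw [habs] at h2
      rw [← hD] at h1 h2
      have h3 := hWb u
      set a := stieltjesGapPartial c z i u
      set b := stieltjesGapPartial c (conj z) i u
      calc _ ≤ |u i| * (k * M ^ (2 * k) * ‖a‖ + (k + 1) * M ^ (2 * k) * ‖b‖) := by
            refine mul_le_mul_of_nonneg_left ((norm_gapTestDeriv_le hz k u).trans ?_) (abs_nonneg _)
            gcongr
        _ = k * M ^ (2 * k) * (|u i| * ‖a‖) + (k + 1) * M ^ (2 * k) * (|u i| * ‖b‖) := by ring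
        _ ≤ k * M ^ (2 * k) * (D * (1 + ∑ j, u j ^ 2))
            + (k + 1) * M ^ (2 * k) * (D * (1 + ∑ j, u j ^ 2)) := by gcongr
        _ = _ := by ring)
  simpa only [gapTestDeriv_sum, stieltjesGap_mul_gapTest hz] using h

/-- Moments of `stieltjesGap` under the law of the entries of the `β`-Laguerre ensemble. -/
lemma integral_norm_stieltjesGap_pow_le (hβ : 0 < β)
    (hpar : ∀ k : BidiagIdx n, 0 < laguerreParam β ρ k) (hz : 0 < z.im) (k : ℕ) :
    β * (n + 1) * ∫ u, ‖stieltjesGap c z u‖ ^ (2 * k + 2)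
        ∂(Measure.pi fun i : BidiagIdx n => chiMeasure (laguerreParam β ρ i))
      ≤ (2 * k + 1) * 2 / z.im * ∫ u, (resolventLeft c u z 0 0).im * ‖stieltjesGap c z u‖ ^ (2 * k)
        ∂(Measure.pi fun i : BidiagIdx n => chiMeasure (laguerreParam β ρ i)) := by
  have hz' : (conj z).im ≠ 0 := by simpa using hz.ne'
  have hkey := integral_gapTest (c := c) hpar hz.ne' k
  have hWc := continuous_stieltjesGap (c := c) (n := n) hz.ne'
  have hVc := continuous_stieltjesGap (c := c) (n := n) hz'
  have hWb : ∀ u : BidiagIdx n → ℝ, ‖stieltjesGap c z u‖ ≤ 2 * |z.im|⁻¹ := fun u =>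
    norm_stieltjesGap_le hz.ne'
  have hIm : ∀ u : BidiagIdx n → ℝ, 0 ≤ (resolventLeft c u z 0 0).im := fun u =>
    im_resolventMatrix_nonneg (isHermitian_left c u) hz 0
  have hRi : Integrable (fun u => (resolventLeft c u z 0 0).im * ‖stieltjesGap c z u‖ ^ (2 * k))
      (Measure.pi fun i : BidiagIdx n => chiMeasure (laguerreParam β ρ i)) := by
    refine integrable_pi_of_bound hpar (C := |z.im|⁻¹ * (2 * |z.im|⁻¹) ^ (2 * k))
      ((Complex.continuous_im.comp ((continuous_resolventLeft hz.ne').matrix_elem 0 0)).mul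
        (hWc.norm.pow _)) fun u => ?_
    rw [norm_mul, norm_pow, norm_norm]
    have h1 := hWb u
    have h2 : ‖(resolventLeft c u z 0 0).im‖ ≤ |z.im|⁻¹ := (Complex.abs_im_le_norm _).trans
      (norm_resolventMatrix_apply_le (isHermitian_left c u) hz.ne' 0 0)
    gcongr
  have hWi : Integrable (fun u => β * (n + 1) * ((‖stieltjesGap c z u‖ ^ (2 * k + 2) : ℝ) : ℂ))
      (Measure.pi fun i : BidiagIdx n => chiMeasure (laguerreParam β ρ i)) := by
    refine Integrable.const_mul (Integrable.ofReal (integrable_pi_of_bound hpar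
      (C := (2 * |z.im|⁻¹) ^ (2 * k + 2)) (hWc.norm.pow _) fun u => ?_)) _
    have h1 := hWb u
    change ‖‖stieltjesGap c z u‖ ^ (2 * k + 2)‖ ≤ _
    rw [norm_pow, norm_norm]
    gcongr
  set E := fun u : BidiagIdx n → ℝ => gapTestDeriv c z k u
    (∑ i, u i * toda c z i u * stieltjesGapPartial c z i u)
    (∑ i, u i * toda c z i u * stieltjesGapPartial c (conj z) i u) with hE
  have hEc : Continuous E := by
    have h : ∀ w : ℂ, w.im ≠ 0 → Continuous fun u : BidiagIdx n → ℝ =>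
        ∑ i, u i * toda c z i u * stieltjesGapPartial c w i u := fun w hw =>
      continuous_finsetSum _ fun i _ => ((Complex.continuous_ofReal.comp (continuous_apply i)).mul
        (continuous_toda hz.ne' i)).mul (continuous_stieltjesGapPartial hw i)
    exact (((continuous_const.mul (hWc.pow _)).mul (hVc.pow _)).mul (h z hz.ne')).add
        (((continuous_const.mul (hWc.pow _)).mul (hVc.pow _)).mul (h _ hz'))
  -- The product rule gives k + (k + 1) terms, each moved by at most 2 Im X₁₁ / η.
  have hEb : ∀ u, ‖E u‖ ≤ (2 * k + 1) * 2 / z.im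
      * ((resolventLeft c u z 0 0).im * ‖stieltjesGap c z u‖ ^ (2 * k)) := by
    intro u
    have h1 := norm_sum_toda_mul_stieltjesGapPartial_le (c := c) (u := u) hz (Or.inl rfl)
    have h2 := norm_sum_toda_mul_stieltjesGapPartial_le (c := c) (u := u) hz (Or.inr rfl)
    refine (norm_gapTestDeriv_le hz.ne' k u).trans ?_
    set I := (resolventLeft c u z 0 0).im
    set a := ‖stieltjesGap c z u‖
    calc _ ≤ k * a ^ (2 * k) * (2 * (I / z.im)) + (k + 1) * a ^ (2 * k) * (2 * (I / z.im)) := by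
          gcongr
      _ = _ := by ring
  have hEi : Integrable E (Measure.pi fun i : BidiagIdx n => chiMeasure (laguerreParam β ρ i)) :=
    (hRi.const_mul _).mono' hEc.aestronglyMeasurable (Filter.Eventually.of_forall hEb)
  rw [integral_sub hEi hWi, sub_eq_zero, integral_const_mul, integral_complex_ofReal] at hkey
  rw [← integral_const_mul ((2 * (k : ℝ) + 1) * 2 / z.im)]
  refine le_trans (le_of_eq ?_) (norm_integral_le_of_norm_le (hRi.const_mul _)
    (Filter.Eventually.of_forall hEb))
  rw [hkey, norm_mul, norm_mul, Complex.norm_real, Complex.norm_real, norm_natCast_add_one,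
    Real.norm_of_nonneg hβ.le, Real.norm_of_nonneg (integral_nonneg fun u => by positivity)]

end moment

/-! ### Trigonometric integrals with the Poisson kernel -/

section poisson

lemma one_sub_mul_ne_zero {t s : ℂ} (ht : ‖t‖ < 1) (hs : ‖s‖ = 1) : 1 - t * s ≠ 0 := by
  intro h
  have h1 : t * s = 1 := (sub_eq_zero.1 h).symm
  have := congrArg norm h1
  rw [norm_mul, hs, mul_one, norm_one] at this
  exact ht.ne this

lemma continuous_inv_one_sub_exp {t : ℂ} (ht : ‖t‖ < 1) (a : ℝ) :
    Continuous fun θ : ℝ => (1 - t * Complex.exp ((a * θ : ℝ) * Complex.I))⁻¹ :=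
  Continuous.inv₀ (by fun_prop) fun θ =>
    one_sub_mul_ne_zero ht (Complex.norm_exp_ofReal_mul_I _)

/-- On the unit circle dζ = iζ dθ, so this is the Cauchy integral of 1 / (ζ − t), divided by i. -/
lemma integral_inv_one_sub_exp {t : ℂ} (ht : ‖t‖ < 1) :
    ∫ θ in (0 : ℝ)..2 * Real.pi, (1 - t * Complex.exp (((-1 : ℝ) * θ : ℝ) * Complex.I))⁻¹
      = 2 * Real.pi := by
  have h := circleIntegral.integral_sub_inv_of_mem_ball (c := 0) (w := t) (R := 1) (by simpa using ht)
  rw [circleIntegral] at h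
  have e : ∀ θ : ℝ, deriv (circleMap 0 1) θ • (circleMap 0 1 θ - t)⁻¹
      = Complex.I * (1 - t * Complex.exp (((-1 : ℝ) * θ : ℝ) * Complex.I))⁻¹ := by
    intro θ
    have h0 : Complex.exp (θ * Complex.I) ≠ 0 := Complex.exp_ne_zero _
    have h1 := one_sub_mul_ne_zero ht (Complex.norm_exp_ofReal_mul_I (-1 * θ))
    have h2 : Complex.exp (((-1 * θ : ℝ) : ℂ) * Complex.I) = (Complex.exp (θ * Complex.I))⁻¹ := by
      rw [← Complex.exp_neg]; push_cast; congr 1; ring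
    rw [h2] at h1 ⊢
    rw [deriv_circleMap, circleMap, smul_eq_mul]
    simp only [Complex.ofReal_one, one_mul, zero_add]
    have h3 : Complex.exp (θ * Complex.I) - t
        = Complex.exp (θ * Complex.I) * (1 - t * (Complex.exp (θ * Complex.I))⁻¹) := by
      field_simp
    rw [h3, mul_inv]
    field_simp
  simp only [e] at h
  rw [intervalIntegral.integral_const_mul] at h
  have hI := Complex.I_ne_zero
  apply mul_left_cancel₀ hI
  rw [h]; ring

/-- The Poisson kernel has integral `π` over `[0, π]`. -/
lemma integral_poisson {t : ℂ} (ht : ‖t‖ < 1) :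
    ∫ θ in (0 : ℝ)..Real.pi, (1 - t ^ 2) * (1 - 2 * t * Real.cos θ + t ^ 2)⁻¹ = (Real.pi : ℂ) := by
  have c1 := continuous_inv_one_sub_exp ht (-1)
  have c2 := continuous_inv_one_sub_exp ht 1
  have h := integral_inv_one_sub_exp ht
  rw [← intervalIntegral.integral_add_adjacent_intervals (b := Real.pi) (c1.intervalIntegrable _ _)
    (c1.intervalIntegrable _ _)] at h
  have h2 : ∫ θ in Real.pi..2 * Real.pi, (1 - t * Complex.exp (((-1 : ℝ) * θ : ℝ) * Complex.I))⁻¹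
      = ∫ θ in (0 : ℝ)..Real.pi, (1 - t * Complex.exp (((1 : ℝ) * θ : ℝ) * Complex.I))⁻¹ := by
    have := intervalIntegral.integral_comp_sub_left (a := 0) (b := Real.pi)
      (fun θ : ℝ => (1 - t * Complex.exp (((-1 : ℝ) * θ : ℝ) * Complex.I))⁻¹) (2 * Real.pi)
    rw [show 2 * Real.pi - Real.pi = Real.pi by ring, sub_zero] at this
    rw [← this]
    refine intervalIntegral.integral_congr fun θ _ => ?_
    have : Complex.exp (((-1 * (2 * Real.pi - θ) : ℝ) : ℂ) * Complex.I)
        = Complex.exp (((1 * θ : ℝ) : ℂ) * Complex.I) := by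
      rw [show (((-1 * (2 * Real.pi - θ) : ℝ) : ℂ) * Complex.I)
        = ((1 * θ : ℝ) : ℂ) * Complex.I - 2 * Real.pi * Complex.I by push_cast; ring]
      exact Complex.exp_periodic.sub_eq _
    simp only [this]
  rw [h2, ← intervalIntegral.integral_add (c1.intervalIntegrable _ _) (c2.intervalIntegrable _ _)] at h
  -- The Poisson kernel is the sum of the two geometric kernels minus 1; the reflection θ ↦ 2π − θ
  -- has just exchanged them.
  have e : ∀ θ : ℝ, (1 - t ^ 2) * (1 - 2 * t * Real.cos θ + t ^ 2)⁻¹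
      = (1 - t * Complex.exp (((-1 : ℝ) * θ : ℝ) * Complex.I))⁻¹
        + (1 - t * Complex.exp (((1 : ℝ) * θ : ℝ) * Complex.I))⁻¹ - 1 := by
    intro θ
    have n1 := one_sub_mul_ne_zero ht (Complex.norm_exp_ofReal_mul_I (-1 * θ))
    have n2 := one_sub_mul_ne_zero ht (Complex.norm_exp_ofReal_mul_I (1 * θ))
    have hm : Complex.exp (((-1 * θ : ℝ) : ℂ) * Complex.I) * Complex.exp (((1 * θ : ℝ) : ℂ) * Complex.I)
        = 1 := by
      rw [← Complex.exp_add, ← Complex.exp_zero]; congr 1; push_cast; ring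
    have hs : Complex.exp (((-1 * θ : ℝ) : ℂ) * Complex.I) + Complex.exp (((1 * θ : ℝ) : ℂ) * Complex.I)
        = 2 * (Real.cos θ : ℂ) := by
      rw [Complex.ofReal_cos, Complex.two_cos, add_comm]; push_cast
      congr 2 <;> ring
    set p := Complex.exp (((-1 * θ : ℝ) : ℂ) * Complex.I)
    set q := Complex.exp (((1 * θ : ℝ) : ℂ) * Complex.I)
    have hD : 1 - 2 * t * Real.cos θ + t ^ 2 = (1 - t * p) * (1 - t * q) := by
      linear_combination t * hs - t ^ 2 * hm
    rw [hD]
    field_simp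
    linear_combination t ^ 2 * hm
  have c3 : IntervalIntegrable (fun θ : ℝ => (1 - t * Complex.exp (((-1 : ℝ) * θ : ℝ) * Complex.I))⁻¹
      + (1 - t * Complex.exp (((1 : ℝ) * θ : ℝ) * Complex.I))⁻¹) volume 0 Real.pi :=
    (c1.add c2).intervalIntegrable _ _
  simp only [e]
  rw [intervalIntegral.integral_sub c3 intervalIntegrable_const, h]
  simp
  ring

lemma poisson_denom_ne_zero {t : ℂ} (ht : ‖t‖ < 1) (θ : ℝ) :
    1 - 2 * t * Real.cos θ + t ^ 2 ≠ 0 := by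
  have n1 := one_sub_mul_ne_zero ht (Complex.norm_exp_ofReal_mul_I (-θ))
  have n2 := one_sub_mul_ne_zero ht (Complex.norm_exp_ofReal_mul_I θ)
  have hm : Complex.exp (((-θ : ℝ) : ℂ) * Complex.I) * Complex.exp ((θ : ℂ) * Complex.I) = 1 := by
    rw [← Complex.exp_add, ← Complex.exp_zero]; congr 1; push_cast; ring
  have hs : Complex.exp (((-θ : ℝ) : ℂ) * Complex.I) + Complex.exp ((θ : ℂ) * Complex.I)
      = 2 * (Real.cos θ : ℂ) := by
    rw [Complex.ofReal_cos, Complex.two_cos, add_comm]; push_cast; rfl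
  have hD : 1 - 2 * t * Real.cos θ + t ^ 2 = (1 - t * Complex.exp (((-θ : ℝ) : ℂ) * Complex.I))
      * (1 - t * Complex.exp ((θ : ℂ) * Complex.I)) := by
    linear_combination t * hs - t ^ 2 * hm
  rw [hD]
  exact mul_ne_zero n1 n2

/-- Since 4t² sin²θ = −(1 − t²)² + (1 + t² + 2t cos θ)(1 − 2t cos θ + t²), the quotient is a Poisson
kernel plus a trigonometric polynomial. -/
lemma integral_sin_sq_div {t : ℂ} (ht : ‖t‖ < 1) (ht0 : t ≠ 0) :
    ∫ θ in (0 : ℝ)..Real.pi, (Real.sin θ : ℂ) ^ 2 * (1 - 2 * t * Real.cos θ + t ^ 2)⁻¹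
      = (Real.pi : ℂ) / 2 := by
  have hP := integral_poisson ht
  have cD : Continuous fun θ : ℝ => (1 - 2 * t * Real.cos θ + t ^ 2)⁻¹ :=
    Continuous.inv₀ (by fun_prop) (poisson_denom_ne_zero ht)
  have e : ∀ θ : ℝ, (Real.sin θ : ℂ) ^ 2 * (1 - 2 * t * Real.cos θ + t ^ 2)⁻¹
      = (4 * t ^ 2)⁻¹ * ((-(1 - t ^ 2)) * ((1 - t ^ 2) * (1 - 2 * t * Real.cos θ + t ^ 2)⁻¹)
        + (1 + t ^ 2 + (2 * t) * Real.cos θ)) := by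
    intro θ
    have hne := poisson_denom_ne_zero ht θ
    have hsc : (Real.sin θ : ℂ) ^ 2 + (Real.cos θ : ℂ) ^ 2 = 1 := by
      exact_mod_cast Real.sin_sq_add_cos_sq θ
    set C := (Real.cos θ : ℂ)
    set S := (Real.sin θ : ℂ)
    have key : 4 * t ^ 2 * S ^ 2 = -(1 - t ^ 2) ^ 2 + (1 + t ^ 2 + 2 * t * C) * (1 - 2 * t * C + t ^ 2) := by
      linear_combination 4 * t ^ 2 * hsc
    generalize 1 - 2 * t * C + t ^ 2 = D at hne key
    field_simp
    linear_combination key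
  have hcos : ∫ θ in (0 : ℝ)..Real.pi, (Real.cos θ : ℂ) = 0 := by
    rw [intervalIntegral.integral_ofReal]; simp
  simp only [e]
  rw [intervalIntegral.integral_const_mul, intervalIntegral.integral_add, intervalIntegral.integral_const_mul, hP, intervalIntegral.integral_add, intervalIntegral.integral_const_mul, hcos]
  · simp only [intervalIntegral.integral_const, sub_zero, Complex.real_smul]
    field_simp
    ring
  · exact intervalIntegrable_const
  · exact Continuous.intervalIntegrable (by fun_prop) _ _
  · exact Continuous.intervalIntegrable (by fun_prop) _ _
  · exact Continuous.intervalIntegrable (by fun_prop) _ _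

end poisson

/-! ### The Marchenko–Pastur law: angular form and explicit Stieltjes transform -/

section mp

variable {d : ℝ}

/-- The parametrization of the support of the Marchenko-Pastur law by an angle. -/
noncomputable def mpAngle (d θ : ℝ) : ℝ := 1 + d + 2 * Real.sqrt d * Real.cos θ

/-- The point equals (√d + cos θ)² + sin²θ. Hence sin²θ divided by it stays at most 1, even for d =
1, where the lower edge is 0. -/
lemma mpAngle_pos (hd : 0 < d) {θ : ℝ} (hθ : θ ∈ Set.Ioo 0 Real.pi) :
    0 < mpAngle d θ ∧ Real.sin θ ^ 2 ≤ mpAngle d θ := by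
  have h1 := Real.sin_pos_of_pos_of_lt_pi hθ.1 hθ.2
  have h2 := Real.sin_sq_add_cos_sq θ
  have h3 := Real.sq_sqrt hd.le
  have h4 : mpAngle d θ = (Real.sqrt d + Real.cos θ) ^ 2 + Real.sin θ ^ 2 := by
    unfold mpAngle; nlinarith
  constructor
  · rw [h4]; positivity
  · rw [h4]; nlinarith [sq_nonneg (Real.sqrt d + Real.cos θ)]

lemma image_mpAngle (hd : 0 < d) :
    mpAngle d '' Set.Ioo 0 Real.pi = Set.Ioo (mpLower d) (mpUpper d) := by
  have hs := Real.sqrt_pos.2 hd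
  have h3 := Real.sq_sqrt hd.le
  have hc : mpAngle d = (fun x => 1 + d + 2 * Real.sqrt d * x) ∘ Real.cos := rfl
  have hcos : Real.cos '' Set.Ioo 0 Real.pi = Set.Ioo (-1) 1 := by
    ext x
    constructor
    · rintro ⟨θ, hθ, rfl⟩
      have h1 := Real.sin_pos_of_pos_of_lt_pi hθ.1 hθ.2
      have h2 := Real.sin_sq_add_cos_sq θ
      constructor <;> nlinarith
    · intro hx
      refine ⟨Real.arccos x, ⟨Real.arccos_pos.2 hx.2, ?_⟩, Real.cos_arccos hx.1.le hx.2.le⟩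
      exact lt_of_le_of_ne (Real.arccos_le_pi x) fun h => hx.1.not_ge (Real.arccos_eq_pi.1 h)
  rw [hc, Set.image_comp, hcos]
  ext x
  simp only [mpLower, mpUpper, Set.mem_image, Set.mem_Ioo]
  constructor
  · rintro ⟨y, hy, rfl⟩
    constructor <;> nlinarith
  · intro hx
    refine ⟨(x - 1 - d) / (2 * Real.sqrt d), ⟨?_, ?_⟩, by field_simp; ring⟩
    · rw [lt_div_iff₀ (by positivity)]; nlinarith
    · rw [div_lt_iff₀ (by positivity)]; nlinarith

/-- Integrals against the Marchenko-Pastur density in the angular parametrization. -/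
lemma integral_mul_mpDensity (hd : 0 < d) (g : ℝ → ℂ) :
    ∫ x : ℝ, g x * (mpDensity d x : ℂ)
      = ∫ θ in Set.Ioo 0 Real.pi,
        ((2 / Real.pi * (Real.sin θ ^ 2 / mpAngle d θ) : ℝ) : ℂ) * g (mpAngle d θ) := by
  have hs := Real.sqrt_pos.2 hd
  have h3 := Real.sq_sqrt hd.le
  set f := fun x : ℝ => g x * ((1 / (2 * d * Real.pi * x)
    * Real.sqrt ((mpUpper d - x) * (x - mpLower d)) : ℝ) : ℂ) with hf
  have e1 : (fun x : ℝ => g x * (mpDensity d x : ℂ))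
      = (Set.Icc (mpLower d) (mpUpper d)).indicator f := by
    funext x
    by_cases hx : x ∈ Set.Icc (mpLower d) (mpUpper d)
    · simp only [mpDensity, Set.indicator_of_mem hx, hf]
    · simp [mpDensity, Set.indicator_of_notMem hx]
  rw [e1, integral_indicator measurableSet_Icc, integral_Icc_eq_integral_Ioo, ← image_mpAngle hd,
    integral_image_eq_integral_abs_deriv_smul (f' := fun θ => 2 * Real.sqrt d * (-Real.sin θ))
      measurableSet_Ioo]
  · refine setIntegral_congr_fun measurableSet_Ioo fun θ hθ => ?_
    have h1 := Real.sin_pos_of_pos_of_lt_pi hθ.1 hθ.2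
    have h2 := Real.sin_sq_add_cos_sq θ
    have hx := (mpAngle_pos hd hθ).1
    have e2 : (mpUpper d - mpAngle d θ) * (mpAngle d θ - mpLower d)
        = (2 * Real.sqrt d * Real.sin θ) ^ 2 := by
      have hA : mpAngle d θ = 1 + Real.sqrt d ^ 2 + 2 * Real.sqrt d * Real.cos θ := by rw [h3]; rfl
      rw [hA, mpUpper, mpLower, mul_pow, eq_sub_of_add_eq h2]
      ring
    have e3 : |2 * Real.sqrt d * (-Real.sin θ)| = 2 * Real.sqrt d * Real.sin θ := by
      rw [mul_neg, abs_neg, abs_of_pos (by positivity)]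
    simp only [hf, e2, e3]
    rw [Real.sqrt_sq (by positivity), Complex.real_smul, mul_left_comm, mul_comm, ← Complex.ofReal_mul]
    congr 2
    have hpi := Real.pi_pos
    have : (2 * Real.sqrt d * Real.sin θ) * (1 / (2 * d * Real.pi * mpAngle d θ)
        * (2 * Real.sqrt d * Real.sin θ)) = (2 * (Real.sqrt d ^ 2) * Real.sin θ ^ 2) / (d * Real.pi * mpAngle d θ) := by
      field_simp
    rw [this, h3]
    field_simp
  · intro θ _
    unfold mpAngle
    exact (((Real.hasDerivAt_cos θ).const_mul _).const_add _).hasDerivWithinAt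
  · intro a ha b hb hab
    have : Real.cos a = Real.cos b := by
      unfold mpAngle at hab
      have := add_left_cancel hab
      exact mul_left_cancel₀ (by positivity) this
    exact Real.injOn_cos ⟨ha.1.le, ha.2.le⟩ ⟨hb.1.le, hb.2.le⟩ this

lemma mpStieltjes_eq (hd : 0 < d) (z : ℂ) : mpStieltjes d z = ∫ θ in Set.Ioo 0 Real.pi,
    ((2 / Real.pi * (Real.sin θ ^ 2 / mpAngle d θ) : ℝ) : ℂ) * (1 / ((mpAngle d θ : ℂ) - z)) :=
  integral_mul_mpDensity hd _

lemma norm_mp_kernel_le (hd : 0 < d) {θ : ℝ} (hθ : θ ∈ Set.Ioo 0 Real.pi) {a : ℂ} {A : ℝ}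
    (ha : ‖a‖ ≤ A) :
    ‖((2 / Real.pi * (Real.sin θ ^ 2 / mpAngle d θ) : ℝ) : ℂ) * a‖ ≤ 2 / Real.pi * A := by
  obtain ⟨h1, h2⟩ := mpAngle_pos hd hθ
  have hpi := Real.pi_pos
  rw [norm_mul, Complex.norm_real, Real.norm_of_nonneg (by positivity)]
  have h3 : Real.sin θ ^ 2 / mpAngle d θ ≤ 1 := (div_le_one h1).2 h2
  have h4 : 0 ≤ Real.sin θ ^ 2 / mpAngle d θ := by positivity
  calc _ ≤ 2 / Real.pi * 1 * A := by gcongr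
    _ = _ := by ring

lemma norm_setIntegral_Ioo_pi_le {f : ℝ → ℂ} {A : ℝ} (hA : ∀ θ ∈ Set.Ioo 0 Real.pi, ‖f θ‖ ≤ 2 / Real.pi * A) :
    ‖∫ θ in Set.Ioo 0 Real.pi, f θ‖ ≤ 2 * A := by
  refine (norm_setIntegral_le_of_norm_le_const (by simp) hA).trans_eq ?_
  have hpi := Real.pi_pos
  rw [Real.volume_real_Ioo_of_le hpi.le]
  field_simp
  ring

lemma norm_one_div_ofReal_sub_le (x : ℝ) {z : ℂ} (hz : z.im ≠ 0) : ‖1 / ((x : ℂ) - z)‖ ≤ |z.im|⁻¹ := by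
  rw [one_div, norm_inv]
  have := abs_pos.2 hz
  gcongr
  exact abs_im_le_norm_ofReal_sub x z

/-- The constant 2 comes from bounding sin²θ / x by 1, which avoids knowing that the density has
mass 1. -/
lemma norm_mpStieltjes_le (hd : 0 < d) {z : ℂ} (hz : z.im ≠ 0) :
    ‖mpStieltjes d z‖ ≤ 2 * |z.im|⁻¹ := by
  rw [mpStieltjes_eq hd]
  exact norm_setIntegral_Ioo_pi_le fun θ hθ =>
    norm_mp_kernel_le hd hθ (norm_one_div_ofReal_sub_le _ hz)

lemma integrable_mp_kernel (hd : 0 < d) {g : ℝ → ℂ} {A : ℝ} (hg : Measurable g)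
    (hA : ∀ θ, ‖g θ‖ ≤ A) : IntegrableOn (fun θ =>
      ((2 / Real.pi * (Real.sin θ ^ 2 / mpAngle d θ) : ℝ) : ℂ) * g θ) (Set.Ioo 0 Real.pi) := by
  refine Measure.integrableOn_of_bounded (M := 2 / Real.pi * A) (by simp) ?_ ?_
  · unfold mpAngle
    exact Measurable.aestronglyMeasurable (by fun_prop)
  · exact (ae_restrict_iff' measurableSet_Ioo).2
      (Filter.Eventually.of_forall fun θ hθ => norm_mp_kernel_le hd hθ (hA θ))

lemma measurable_one_div_mpAngle_sub (z : ℂ) :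
    Measurable fun θ : ℝ => 1 / ((mpAngle d θ : ℂ) - z) := by
  unfold mpAngle
  fun_prop

lemma norm_mpStieltjes_sub_le (hd : 0 < d) {z w : ℂ} (hz : z.im ≠ 0) (hw : w.im ≠ 0) :
    ‖mpStieltjes d z - mpStieltjes d w‖ ≤ 2 * (‖z - w‖ * (|z.im|⁻¹ * |w.im|⁻¹)) := by
  rw [mpStieltjes_eq hd, mpStieltjes_eq hd, ← integral_sub]
  · refine norm_setIntegral_Ioo_pi_le fun θ hθ => ?_
    rw [← mul_sub]
    refine norm_mp_kernel_le hd hθ ?_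
    have hne : ∀ {z : ℂ}, z.im ≠ 0 → (mpAngle d θ : ℂ) - z ≠ 0 := fun {z} hz h => by
      have := abs_im_le_norm_ofReal_sub (mpAngle d θ) z
      rw [h, norm_zero] at this
      exact hz (abs_nonpos_iff.1 this)
    rw [show 1 / ((mpAngle d θ : ℂ) - z) - 1 / ((mpAngle d θ : ℂ) - w)
      = (z - w) * ((1 / ((mpAngle d θ : ℂ) - z)) * (1 / ((mpAngle d θ : ℂ) - w))) by
        have := hne hz; have := hne hw; field_simp; ring, norm_mul, norm_mul]
    gcongr
    · exact norm_one_div_ofReal_sub_le _ hz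
    · exact norm_one_div_ofReal_sub_le _ hw
  · exact integrable_mp_kernel hd (measurable_one_div_mpAngle_sub z)
      fun θ => norm_one_div_ofReal_sub_le _ hz
  · exact integrable_mp_kernel hd (measurable_one_div_mpAngle_sub w)
      fun θ => norm_one_div_ofReal_sub_le _ hw

/-- The two solutions have product 1, so the smaller one has modulus at most 1. Modulus 1 would make
t + t⁻¹ = 2 Re t real. -/
lemma exists_joukowski {ζ : ℂ} (hζ : ζ.im ≠ 0) : ∃ t : ℂ, t ≠ 0 ∧ ‖t‖ < 1 ∧ t + t⁻¹ = ζ := by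
  obtain ⟨s, hs⟩ := IsAlgClosed.exists_pow_nat_eq (ζ ^ 2 - 4) (n := 2) (by norm_num)
  have hprod : ((ζ + s) / 2) * ((ζ - s) / 2) = 1 := by linear_combination -(1 / 4) * hs
  have key : ∀ a b : ℂ, a * b = 1 → a + b = ζ → ‖a‖ ≤ ‖b‖ → ∃ t : ℂ, t ≠ 0 ∧ ‖t‖ < 1 ∧ t + t⁻¹ = ζ := by
    intro a b hab hsum hle
    have ha : a ≠ 0 := left_ne_zero_of_mul_eq_one hab
    have hb : b = a⁻¹ := eq_inv_of_mul_eq_one_right hab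
    refine ⟨a, ha, ?_, by rw [← hb, hsum]⟩
    have hn : ‖a‖ * ‖b‖ = 1 := by rw [← norm_mul, hab, norm_one]
    refine lt_of_le_of_ne (by nlinarith [norm_nonneg a, norm_nonneg b]) fun h1 => hζ ?_
    rw [← hsum, hb, Complex.inv_def, Complex.normSq_eq_norm_sq, h1]
    simp
  rcases le_total ‖(ζ + s) / 2‖ ‖(ζ - s) / 2‖ with h | h
  · exact key _ _ hprod (by ring) h
  · exact key _ _ (by rw [mul_comm, hprod]) (by ring) h

/-- The total mass is 1. For d < 1 the point is 1 − 2t cos θ + t² with t = −√d, so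
`integral_sin_sq_div` applies. For d = 1 this t lies on the unit circle, and the quotient simplifies
to (1 − cos θ)/2. -/
lemma integral_sin_sq_div_mpAngle (hd : 0 < d) (hd1 : d ≤ 1) :
    ∫ θ in Set.Ioo 0 Real.pi, ((2 / Real.pi * (Real.sin θ ^ 2 / mpAngle d θ) : ℝ) : ℂ) = 1 := by
  have hs := Real.sqrt_pos.2 hd
  have h3 := Real.sq_sqrt hd.le
  have hpi := Real.pi_pos
  have hpi' : (Real.pi : ℂ) ≠ 0 := by exact_mod_cast hpi.ne'
  rcases hd1.lt_or_eq with hlt | rfl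
  · have ht : ‖((-Real.sqrt d : ℝ) : ℂ)‖ < 1 := by
      rw [Complex.norm_real, norm_neg, Real.norm_of_nonneg hs.le]
      exact (Real.sqrt_lt' one_pos).2 (by simpa using hlt)
    have h := integral_sin_sq_div ht (by simpa using hs.ne')
    rw [intervalIntegral.integral_of_le hpi.le, integral_Ioc_eq_integral_Ioo] at h
    have e : ∀ θ : ℝ, ((2 / Real.pi * (Real.sin θ ^ 2 / mpAngle d θ) : ℝ) : ℂ)
        = (2 / Real.pi) * ((Real.sin θ : ℂ) ^ 2 * (1 - 2 * ((-Real.sqrt d : ℝ) : ℂ) * Real.cos θ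
          + ((-Real.sqrt d : ℝ) : ℂ) ^ 2)⁻¹) := by
      intro θ
      rw [← Complex.ofReal_pow (-Real.sqrt d), neg_sq, h3]
      push_cast [mpAngle]
      rw [div_eq_mul_inv ((Complex.sin θ) ^ 2)]
      congr 3
      ring
    simp only [e]
    rw [integral_const_mul, h]
    field_simp
  · have e : Set.EqOn (fun θ : ℝ => ((2 / Real.pi * (Real.sin θ ^ 2 / mpAngle 1 θ) : ℝ) : ℂ))
        (fun θ : ℝ => ((1 / Real.pi * (1 - Real.cos θ) : ℝ) : ℂ)) (Set.Ioo 0 Real.pi) := by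
      intro θ hθ
      have hx := (mpAngle_pos hd hθ).1
      have h2 := Real.sin_sq_add_cos_sq θ
      have h4 : mpAngle 1 θ = 2 * (1 + Real.cos θ) := by simp [mpAngle]; ring
      have h5 : (1 : ℝ) + Real.cos θ ≠ 0 := by intro h; rw [h4, h] at hx; simp at hx
      simp only
      congr 1
      rw [h4, eq_sub_of_add_eq h2]
      field_simp
      ring
    rw [setIntegral_congr_fun measurableSet_Ioo e, ← integral_Ioc_eq_integral_Ioo,
      ← intervalIntegral.integral_of_le hpi.le, intervalIntegral.integral_ofReal,
      intervalIntegral.integral_const_mul, intervalIntegral.integral_sub (by simp)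
        (Real.continuous_cos.intervalIntegrable _ _)]
    simp [hpi.ne']

/-- Explicit form of the Stieltjes transform of the Marchenko-Pastur law. -/
lemma exists_mpStieltjes_eq (hd : 0 < d) (hd1 : d ≤ 1) {z : ℂ} (hz : z.im ≠ 0) :
    ∃ t : ℂ, t ≠ 0 ∧ ‖t‖ < 1 ∧ Real.sqrt d * (t + t⁻¹) = z - 1 - d ∧
      1 + z * mpStieltjes d z = -t / Real.sqrt d := by
  have hs := Real.sqrt_pos.2 hd
  have hs' : (Real.sqrt d : ℂ) ≠ 0 := by exact_mod_cast hs.ne'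
  have hpi := Real.pi_pos
  have hpi' : (Real.pi : ℂ) ≠ 0 := by exact_mod_cast hpi.ne'
  have hz0 : z ≠ 0 := fun h => hz (by simp [h])
  obtain ⟨t, ht0, ht1, ht⟩ := exists_joukowski (ζ := (z - 1 - d) / Real.sqrt d) (by
    rw [Complex.div_ofReal_im]
    simpa [hs.ne'] using hz)
  have ht' : Real.sqrt d * (t + t⁻¹) = z - 1 - d := by rw [ht]; field_simp
  refine ⟨t, ht0, ht1, ht', ?_⟩
  have h := integral_sin_sq_div ht1 ht0
  rw [intervalIntegral.integral_of_le hpi.le, integral_Ioc_eq_integral_Ioo] at h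
  have h1 := integral_sin_sq_div_mpAngle hd hd1
  -- Adding the mass to z times the transform replaces 1/(x − z) by x/(x − z), which cancels the
  -- factor 1/x of the density; x − z is then −(√d/t) times the Poisson denominator.
  have e : Set.EqOn (fun θ : ℝ => z * (((2 / Real.pi * (Real.sin θ ^ 2 / mpAngle d θ) : ℝ) : ℂ)
        * (1 / ((mpAngle d θ : ℂ) - z))) + ((2 / Real.pi * (Real.sin θ ^ 2 / mpAngle d θ) : ℝ) : ℂ))
      (fun θ : ℝ => (-(t / Real.sqrt d) * (2 / Real.pi)) *
        ((Real.sin θ : ℂ) ^ 2 * (1 - 2 * t * Real.cos θ + t ^ 2)⁻¹)) (Set.Ioo 0 Real.pi) := by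
    intro θ hθ
    have hx := (mpAngle_pos hd hθ).1
    have hx' : (mpAngle d θ : ℂ) ≠ 0 := by exact_mod_cast hx.ne'
    have hxz : (mpAngle d θ : ℂ) - z ≠ 0 := fun h => by
      have := abs_im_le_norm_ofReal_sub (mpAngle d θ) z
      rw [h, norm_zero] at this
      exact hz (abs_nonpos_iff.1 this)
    have hD := poisson_denom_ne_zero ht1 θ
    have hrel : (mpAngle d θ : ℂ) - z = -(Real.sqrt d / t) * (1 - 2 * t * Real.cos θ + t ^ 2) := by
      have : z = Real.sqrt d * (t + t⁻¹) + 1 + d := by rw [ht']; ring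
      rw [this, mpAngle]
      push_cast
      field_simp
      ring
    have e1 : (1 - 2 * t * Real.cos θ + t ^ 2)⁻¹ = -(Real.sqrt d / t) * ((mpAngle d θ : ℂ) - z)⁻¹ := by
      rw [hrel]
      field_simp
    simp only [e1]
    push_cast
    field_simp
    ring
  have hI := setIntegral_congr_fun (μ := volume) measurableSet_Ioo e
  rw [integral_const_mul, h, integral_add, integral_const_mul, ← mpStieltjes_eq hd, h1] at hI
  · rw [add_comm, hI]
    field_simp
  · exact (integrable_mp_kernel hd (measurable_one_div_mpAngle_sub z)
      fun θ => norm_one_div_ofReal_sub_le _ hz).const_mul z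
  · have := integrable_mp_kernel hd (g := fun _ => 1) measurable_const (A := 1) (by simp)
    simpa [IntegrableOn] using this

end mp

/-! ### Deleting the first row and column of the bidiagonal matrix -/

section tail

variable {n : ℕ} {c : ℝ} {z : ℂ}

/-- The coordinates of a bidiagonal matrix with its first row and column removed. -/
def bidiagTail (u : BidiagIdx (n + 1) → ℝ) : BidiagIdx n → ℝ := fun k => u (Sum.map Fin.succ Fin.succ k)

lemma bidiag_inl (u : BidiagIdx n → ℝ) (i : Fin (n + 1)) : bidiag u i i = u (.inl i) :=
  bidiag_row_col u (.inl i)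

lemma bidiag_inr (u : BidiagIdx n → ℝ) (j : Fin n) : bidiag u j.succ j.castSucc = u (.inr j) :=
  bidiag_row_col u (.inr j)

lemma bidiag_tail (u : BidiagIdx (n + 1) → ℝ) :
    bidiag (bidiagTail u) = (bidiag u).submatrix Fin.succ Fin.succ := by
  ext i j
  rw [Matrix.submatrix_apply]
  by_cases h1 : i = j
  · subst h1
    rw [bidiag_inl, bidiag_inl]; rfl
  · by_cases h2 : (i : ℕ) = j + 1
    · obtain ⟨k, rfl⟩ : ∃ k : Fin n, j = k.castSucc := ⟨⟨j, by omega⟩, Fin.ext (by simp)⟩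
      obtain rfl : i = k.succ := Fin.ext (by simpa using h2)
      rw [bidiag_inr]
      exact (bidiag_inr u k.succ).symm
    · rw [bidiag_eq_zero _ h1 h2, bidiag_eq_zero]
      · simpa using h1
      · simpa using h2

/-- Row 0 of B is supported in column 0, so it does not contribute to the other entries of BᵗB. This
fails for BBᵗ, whose minor keeps the square of the first subdiagonal entry. -/
lemma right_tail (u : BidiagIdx (n + 1) → ℝ) :
    ((c : ℂ) • ((bidiag u)ᵀ * bidiag u)).submatrix Fin.succ Fin.succ
      = (c : ℂ) • ((bidiag (bidiagTail u))ᵀ * bidiag (bidiagTail u)) := by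
  ext i j
  rw [bidiag_tail, Matrix.submatrix_apply, Matrix.smul_apply, Matrix.smul_apply, Matrix.mul_apply,
    Matrix.mul_apply, Fin.sum_univ_succ, Matrix.transpose_apply,
    bidiag_eq_zero u (i := 0) (j := i.succ) (Fin.succ_ne_zero i).symm (by simp), zero_mul, zero_add]
  rfl

lemma norm_trace_resolventLeft_sub_tail_le (u : BidiagIdx (n + 1) → ℝ) (hz : z.im ≠ 0) :
    ‖(resolventLeft c u z).trace - (resolventLeft c (bidiagTail u) z).trace‖ ≤ |z.im|⁻¹ := by
  have h := norm_trace_resolventMatrix_sub_minor_le (isHermitian_right c u) hz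
  rw [right_tail] at h
  rwa [← trace_resolventRight hz, ← trace_resolventRight hz]

/-- Row 0 of B has a single entry. This transfers the corner of X to that of Y, where the Schur
complement sees the tail. -/
lemma one_add_mul_resolventLeft_zero (u : BidiagIdx n → ℝ) (hz : z.im ≠ 0) :
    1 + z * resolventLeft c u z 0 0 = c * u (.inl 0) ^ 2 * resolventRight c u z 0 0 := by
  have h := congrFun (congrFun (one_add_mul_resolventLeft (c := c) (u := u) hz) 0) 0
  rw [resolventLeft_mul_bidiag hz, Matrix.smul_apply, Matrix.mul_apply] at h
  simp only [Matrix.transpose_apply, Matrix.add_apply, Matrix.one_apply_eq, Matrix.smul_apply,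
    smul_eq_mul] at h
  rw [h, sum_bidiag_zero (fun k => (bidiag u * resolventRight c u z) 0 k), Matrix.mul_apply]
  simp only [mul_comm (bidiag u 0 _)]
  rw [sum_bidiag_zero (fun k => resolventRight c u z k 0)]
  ring

/-- Self-consistent relation between the resolvents of a bidiagonal matrix and of its tail. -/
lemma resolventLeft_tail_relation (u : BidiagIdx (n + 1) → ℝ) (hz : z.im ≠ 0) :
    (1 + z * resolventLeft c u z 0 0) * (c * u (.inl 0) ^ 2 + c * u (.inr 0) ^ 2 - z
      - c * u (.inr 0) ^ 2 * (1 + z * resolventLeft c (bidiagTail u) z 0 0))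
      = c * u (.inl 0) ^ 2 := by
  have h := schur_resolventMatrix (isHermitian_right c u) hz
  rw [right_tail] at h
  have h00 : ((c : ℂ) • ((bidiag u)ᵀ * bidiag u)) 0 0 = c * (u (.inl 0) ^ 2 + u (.inr 0) ^ 2) := by
    rw [Matrix.smul_apply, Matrix.mul_apply]
    simp only [Matrix.transpose_apply]
    have := sum_bidiag_castSucc (u := u) (fun k => bidiag u k 0) 0
    rw [Fin.castSucc_zero] at this
    rw [this, bidiag_inl, show bidiag u (Fin.succ 0) 0 = u (.inr 0) from bidiag_inr u 0, smul_eq_mul]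
    ring
  -- Off the diagonal, row 0 of BᵗB has one possibly nonzero entry, so the Schur sum has one term.
  -- Its tail factor is converted back by `one_add_mul_resolventLeft_zero`.
  have h0k : ∀ k : Fin (n + 1), ((c : ℂ) • ((bidiag u)ᵀ * bidiag u)) 0 k.succ
      = if k = 0 then (c : ℂ) * ((u (.inr 0) : ℂ) * (u (.inl 1) : ℂ)) else 0 := by
    intro k
    rw [Matrix.smul_apply, Matrix.mul_apply]
    simp only [Matrix.transpose_apply]
    have := sum_bidiag_castSucc (u := u) (fun l => bidiag u l k.succ) 0
    rw [Fin.castSucc_zero] at this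
    rw [this, bidiag_eq_zero u (i := 0) (j := k.succ) (Fin.succ_ne_zero k).symm (by simp), mul_zero,
      zero_add]
    split_ifs with hk
    · subst hk
      rw [bidiag_inl]; rfl
    · rw [bidiag_eq_zero u (i := Fin.succ 0) (j := k.succ) (fun h => hk (Fin.succ_inj.1 h).symm)
        (by simp only [Fin.val_succ, Fin.val_zero]; omega), mul_zero, smul_zero]
  have hk0 : ∀ k : Fin (n + 1), ((c : ℂ) • ((bidiag u)ᵀ * bidiag u)) k.succ 0
      = if k = 0 then (c : ℂ) * ((u (.inr 0) : ℂ) * (u (.inl 1) : ℂ)) else 0 := by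
    intro k
    rw [← h0k k]
    have : ((c : ℂ) • ((bidiag u)ᵀ * bidiag u))ᵀ = (c : ℂ) • ((bidiag u)ᵀ * bidiag u) := by
      simp [Matrix.transpose_mul]
    exact congrFun (congrFun this 0) k.succ
  simp only [h00, h0k, hk0, mul_ite, ite_mul, mul_zero, zero_mul, Finset.sum_ite_eq',
    Finset.mem_univ, if_true] at h
  have e1 := one_add_mul_resolventLeft_zero (c := c) u hz
  have e2 := one_add_mul_resolventLeft_zero (c := c) (bidiagTail u) hz
  have e3 : bidiagTail u (.inl 0) = u (.inl 1) := rfl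
  rw [e3] at e2
  rw [e2, e1]
  have h' : resolventRight c u z 0 0 * (c * (u (.inl 0) ^ 2 + u (.inr 0) ^ 2) - z
      - c * (u (.inr 0) * u (.inl 1)) * resolventRight c (bidiagTail u) z 0 0
        * (c * (u (.inr 0) * u (.inl 1)))) = 1 := h
  linear_combination c * u (.inl 0) ^ 2 * h'

/-- This sign selects the correct root of the limiting quadratic equation in `mp_stability`. -/
lemma im_one_add_mul_resolventLeft_nonneg (hc : 0 ≤ c) (u : BidiagIdx n → ℝ) (hz : 0 < z.im) :
    0 ≤ (1 + z * resolventLeft c u z 0 0).im := by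
  rw [one_add_mul_resolventLeft_zero u hz.ne']
  have h := im_resolventMatrix_nonneg (isHermitian_right c u) hz 0
  have : (c * (u (.inl 0) : ℂ) ^ 2) = ((c * u (.inl 0) ^ 2 : ℝ) : ℂ) := by push_cast; ring
  rw [this, Complex.im_ofReal_mul]
  exact mul_nonneg (by positivity) h

end tail

/-! ### Stability of the self-consistent equation in the bulk -/

section stability

variable {d κ : ℝ}

lemma mpLower_nonneg (d : ℝ) : 0 ≤ mpLower d := sq_nonneg _

lemma mpLower_eq (hd : 0 < d) : mpLower d = 1 + d - 2 * Real.sqrt d := by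
  have := Real.sq_sqrt hd.le
  unfold mpLower; nlinarith

lemma mpUpper_eq (hd : 0 < d) : mpUpper d = 1 + d + 2 * Real.sqrt d := by
  have := Real.sq_sqrt hd.le
  unfold mpUpper; nlinarith

/-- In the bulk the inverse of the Joukowski parameter stays away from the real axis. -/
lemma im_inv_joukowski_ge (hd : 0 < d) (hκ : 0 < κ) (hκd : κ ≤ 2 * Real.sqrt d) {z t : ℂ}
    (h1 : mpLower d + κ ≤ z.re) (h2 : z.re ≤ mpUpper d - κ) (hz : 0 < z.im) (ht0 : t ≠ 0)
    (ht1 : ‖t‖ < 1) (ht : Real.sqrt d * (t + t⁻¹) = z - 1 - d) :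
    Real.sqrt (1 - (1 - κ / (2 * Real.sqrt d)) ^ 2) ≤ (t⁻¹).im := by
  have hs := Real.sqrt_pos.2 hd
  rw [mpLower_eq hd] at h1
  rw [mpUpper_eq hd] at h2
  obtain ⟨v, rfl⟩ : ∃ v : ℂ, t = v⁻¹ := ⟨t⁻¹, (inv_inv t).symm⟩
  rw [inv_inv] at ht ⊢
  have hv0 : v ≠ 0 := by simpa using ht0
  have hN : 1 < Complex.normSq v := by
    rw [Complex.normSq_eq_norm_sq]
    rw [norm_inv, inv_lt_one₀ (norm_pos_iff.2 hv0)] at ht1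
    nlinarith
  have hre : Real.sqrt d * (v.re * (1 + (Complex.normSq v)⁻¹)) = z.re - 1 - d := by
    have := congrArg Complex.re ht
    simp only [Complex.re_ofReal_mul, Complex.add_re, Complex.inv_re, Complex.sub_re, Complex.one_re,
      Complex.ofReal_re] at this
    rw [← this]; ring
  have him : Real.sqrt d * (v.im * (1 - (Complex.normSq v)⁻¹)) = z.im := by
    have := congrArg Complex.im ht
    simp only [Complex.im_ofReal_mul, Complex.add_im, Complex.inv_im, Complex.sub_im, Complex.one_im,
      Complex.ofReal_im] at this
    rw [sub_zero, sub_zero] at this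
    rw [← this]; ring
  set N := Complex.normSq v with hNdef
  have hN' : N = v.re * v.re + v.im * v.im := Complex.normSq_apply v
  have hNi : N⁻¹ < 1 := inv_lt_one_of_one_lt₀ hN
  have hN0 : 0 < N := by linarith
  have hvim : 0 < v.im := by
    have h3 : 0 < v.im * (1 - N⁻¹) := by
      rw [← him] at hz
      exact (mul_pos_iff_of_pos_left hs).1 hz
    exact (mul_pos_iff_of_pos_right (by linarith)).1 h3
  set q := 1 - κ / (2 * Real.sqrt d) with hq
  have hqs : 2 * Real.sqrt d * q = 2 * Real.sqrt d - κ := by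
    rw [hq]; field_simp
  have hq0 : 0 ≤ q := by
    rw [hq, sub_nonneg, div_le_one (by positivity)]; exact hκd
  have h5 : |v.re * (1 + N⁻¹)| ≤ 2 * q := by
    rw [abs_le]
    constructor <;> nlinarith
  have h6 : v.re ^ 2 * (1 + N⁻¹) ^ 2 ≤ 4 * q ^ 2 := by
    have := sq_le_sq' (abs_le.1 h5).1 (abs_le.1 h5).2
    nlinarith
  -- With v = t⁻¹ and N = |v|² > 1, the bulk condition bounds |Re v|(1 + 1/N) by 2q, and N(1 + 1/N)²
  -- ≥ 4. Hence (Im v)² ≥ N(1 − q²) ≥ 1 − q².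
  have h7 : v.re ^ 2 ≤ N * q ^ 2 := by
    have h8 : 4 ≤ N * (1 + N⁻¹) ^ 2 := by
      have : N * (1 + N⁻¹) ^ 2 = 4 + (N - 1) ^ 2 * N⁻¹ := by field_simp; ring
      rw [this]
      have : 0 ≤ (N - 1) ^ 2 * N⁻¹ := by positivity
      linarith
    have h9 : v.re ^ 2 * 4 ≤ v.re ^ 2 * (N * (1 + N⁻¹) ^ 2) :=
      mul_le_mul_of_nonneg_left h8 (sq_nonneg _)
    have h10 : N * (v.re ^ 2 * (1 + N⁻¹) ^ 2) ≤ N * (4 * q ^ 2) :=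
      mul_le_mul_of_nonneg_left h6 hN0.le
    linarith
  rw [Real.sqrt_le_left hvim.le]
  have hq1 : q ≤ 1 := by rw [hq, sub_le_self_iff]; positivity
  have h11 : v.im ^ 2 = N - v.re ^ 2 := by rw [hN']; ring
  have h12 : 0 ≤ 1 - q ^ 2 := by nlinarith
  nlinarith

/-- For large w the quadratic term, whose coefficient is at least d/2, would dominate the rest. This
gives a bound on w independent of Im z. -/
lemma norm_le_of_quadratic {w z e : ℂ} {A Y d Z : ℝ} (hd : 0 < d) (hZ : ‖z‖ ≤ Z) (hA : |A| ≤ 2)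
    (hY : d / 2 ≤ Y) (hY' : Y ≤ 2) (he : ‖e‖ ≤ 1)
    (h : w * (A + Y - z - Y * (w + e)) = A) : ‖w‖ ≤ 1 + 2 * (8 + Z) / d := by
  by_contra! hlt
  have hZ0 : 0 ≤ Z := (norm_nonneg _).trans hZ
  have hw1 : 1 ≤ ‖w‖ := by
    have : 0 ≤ 2 * (8 + Z) / d := by positivity
    linarith
  have h1 : Y * w ^ 2 = (A + Y - z) * w - A - Y * w * e := by linear_combination -h
  have hY0 : 0 < Y := by linarith
  have h2 : Y * ‖w‖ ^ 2 ≤ (2 + 2 + Z) * ‖w‖ + 2 + 2 * ‖w‖ * 1 := by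
    have : ‖(Y : ℂ) * w ^ 2‖ = Y * ‖w‖ ^ 2 := by
      rw [norm_mul, norm_pow, Complex.norm_real, Real.norm_of_nonneg hY0.le]
    rw [← this, h1]
    refine (norm_sub_le _ _).trans (add_le_add ((norm_sub_le _ _).trans (add_le_add ?_ ?_)) ?_)
    · rw [norm_mul]
      refine mul_le_mul_of_nonneg_right ?_ (norm_nonneg _)
      refine (norm_sub_le _ _).trans (add_le_add ((norm_add_le _ _).trans (add_le_add ?_ ?_)) hZ)
      · rwa [Complex.norm_real]
      · rw [Complex.norm_real, Real.norm_of_nonneg hY0.le]; exact hY'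
    · rwa [Complex.norm_real]
    · rw [norm_mul, norm_mul, Complex.norm_real, Real.norm_of_nonneg hY0.le]
      gcongr
  have h3 : d / 2 * ‖w‖ ^ 2 ≤ (8 + Z) * ‖w‖ := by
    have : d / 2 * ‖w‖ ^ 2 ≤ Y * ‖w‖ ^ 2 := by gcongr
    nlinarith
  have h4 : d / 2 * ‖w‖ ≤ 8 + Z := by
    have : (d / 2 * ‖w‖) * ‖w‖ ≤ (8 + Z) * ‖w‖ := by rw [mul_assoc, ← sq]; exact h3
    exact le_of_mul_le_mul_right this (by linarith)
  have h5 : ‖w‖ ≤ 2 * (8 + Z) / d := by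
    rw [le_div_iff₀ hd]; linarith
  linarith

/-- Stability in the bulk of the self-consistent equation of the Marchenko-Pastur law. -/
lemma mp_stability (hd : 0 < d) (hd1 : d ≤ 1) (hκ : 0 < κ) (Z : ℝ) {c₀ : ℝ} (hc₀ : 0 < c₀) :
    ∃ ε : ℝ, 0 < ε ∧ ∀ z : ℂ, mpLower d + κ ≤ z.re → z.re ≤ mpUpper d - κ → 0 < z.im → ‖z‖ ≤ Z →
      ∀ (A Y : ℝ) (w w₁ : ℂ), |A - 1| ≤ ε → |Y - d| ≤ ε → ‖w₁ - w‖ ≤ ε → 0 ≤ w.im →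
      w * (A + Y - z - Y * w₁) = A → ‖w - (1 + z * mpStieltjes d z)‖ ≤ c₀ := by
  have hs := Real.sqrt_pos.2 hd
  have hs2 := Real.sq_sqrt hd.le
  -- The bulk interval has length 4√d − 2κ, so it is empty when κ > 2√d.
  by_cases hκd : κ ≤ 2 * Real.sqrt d
  swap
  · refine ⟨1, one_pos, fun z h1 h2 => ?_⟩
    rw [mpLower_eq hd] at h1
    rw [mpUpper_eq hd] at h2
    linarith
  by_cases hZ0 : 0 ≤ Z
  swap
  · exact ⟨1, one_pos, fun z _ _ _ hz => absurd ((norm_nonneg z).trans hz) hZ0⟩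
  set c₁ := Real.sqrt (1 - (1 - κ / (2 * Real.sqrt d)) ^ 2) with hc₁
  have hc₁0 : 0 < c₁ := by
    refine Real.sqrt_pos.2 ?_
    have h1 : 0 < κ / (2 * Real.sqrt d) := by positivity
    have h2 : κ / (2 * Real.sqrt d) ≤ 1 := (div_le_one (by positivity)).2 hκd
    nlinarith
  set L := 1 + 2 * (8 + Z) / d with hL
  have hL0 : 0 < L := by positivity
  set P := L ^ 2 + 4 * L + 1 with hP
  have hP0 : 0 < P := by positivity
  -- The first two bounds keep the coefficients in the range of `norm_le_of_quadratic`. The third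
  -- makes the total perturbation εP at most c₀ times d times the distance to the wrong root.
  set ε := min (min 1 (d / 2)) (c₀ * (d * (c₁ / Real.sqrt d)) / P) with hε
  have hε1 : ε ≤ 1 := (min_le_left _ _).trans (min_le_left _ _)
  have hε2 : ε ≤ d / 2 := (min_le_left _ _).trans (min_le_right _ _)
  have hε3 : ε * P ≤ c₀ * (d * (c₁ / Real.sqrt d)) := by
    rw [← le_div_iff₀ hP0]; exact min_le_right _ _
  have hε0 : 0 < ε := by positivity
  refine ⟨ε, hε0, fun z h1 h2 hz hzZ A Y w w₁ hA hY hw him heq => ?_⟩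
  obtain ⟨t, ht0, ht1, ht, hmp⟩ := exists_mpStieltjes_eq hd hd1 hz.ne'
  have hIm := im_inv_joukowski_ge hd hκ hκd h1 h2 hz ht0 ht1 ht
  rw [hmp]
  obtain ⟨e, rfl⟩ : ∃ e, w₁ = w + e := ⟨w₁ - w, by ring⟩
  rw [add_sub_cancel_left] at hw
  rw [abs_le] at hA hY
  have hwL : ‖w‖ ≤ L := norm_le_of_quadratic hd hzZ (abs_le.2 ⟨by linarith, by linarith⟩)
    (by linarith) (by linarith) (hw.trans hε1) heq
  have hY0 : 0 ≤ Y := by linarith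
  have hsC : (Real.sqrt d : ℂ) ≠ 0 := by exact_mod_cast hs.ne'
  have hdC : (d : ℂ) = (Real.sqrt d : ℂ) ^ 2 := by rw [← Complex.ofReal_pow, hs2]
  -- The limiting quadratic has roots −t/√d and −t⁻¹/√d; the first is the Marchenko–Pastur value.
  -- The right-hand side collects the perturbation.
  have hQ : d * ((w - -t / Real.sqrt d) * (w - -t⁻¹ / Real.sqrt d))
      = ((d - Y : ℝ) : ℂ) * w ^ 2 + ((A - 1 + (Y - d) : ℝ) : ℂ) * w + ((1 - A : ℝ) : ℂ) - Y * w * e := by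
    have e1 : d * ((w - -t / Real.sqrt d) * (w - -t⁻¹ / Real.sqrt d)) = d * w ^ 2 + (z - 1 - d) * w + 1 := by
      rw [← ht]
      rw [hdC]
      field_simp
      ring
    rw [e1]
    push_cast
    linear_combination -heq
  have hQn : ‖((d - Y : ℝ) : ℂ) * w ^ 2 + ((A - 1 + (Y - d) : ℝ) : ℂ) * w + ((1 - A : ℝ) : ℂ) - Y * w * e‖
      ≤ ε * P := by
    have b1 : ‖((d - Y : ℝ) : ℂ)‖ ≤ ε := by
      rw [Complex.norm_real, Real.norm_eq_abs, abs_le]; constructor <;> linarith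
    have b2 : ‖((A - 1 + (Y - d) : ℝ) : ℂ)‖ ≤ 2 * ε := by
      rw [Complex.norm_real, Real.norm_eq_abs, abs_le]; constructor <;> linarith
    have b3 : ‖((1 - A : ℝ) : ℂ)‖ ≤ ε := by
      rw [Complex.norm_real, Real.norm_eq_abs, abs_le]; constructor <;> linarith
    have b4 : ‖(Y : ℂ)‖ ≤ 2 := by
      rw [Complex.norm_real, Real.norm_of_nonneg hY0]; linarith
    calc _ ≤ ε * L ^ 2 + (2 * ε) * L + ε + 2 * L * ε := by
          refine (norm_sub_le _ _).trans (add_le_add ((norm_add_le _ _).trans (add_le_add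
            ((norm_add_le _ _).trans (add_le_add ?_ ?_)) b3)) ?_)
          · rw [norm_mul, norm_pow]; gcongr
          · rw [norm_mul]; gcongr
          · rw [norm_mul, norm_mul]; gcongr
      _ = ε * P := by rw [hP]; ring
  rw [← hQ, norm_mul, norm_mul, Complex.norm_real, Real.norm_of_nonneg hd.le] at hQn
  -- The imaginary part of w is nonnegative, while that of the wrong root is at most −c₁/√d.
  have hlow : c₁ / Real.sqrt d ≤ ‖w - -t⁻¹ / Real.sqrt d‖ := by
    refine le_trans ?_ ((le_abs_self _).trans (Complex.abs_im_le_norm _))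
    rw [Complex.sub_im, Complex.div_ofReal_im, Complex.neg_im, neg_div, sub_neg_eq_add]
    have : c₁ / Real.sqrt d ≤ (t⁻¹).im / Real.sqrt d := by gcongr
    linarith
  set a := ‖w - -t / Real.sqrt d‖
  have hpos : 0 < d * (c₁ / Real.sqrt d) := by positivity
  refine le_of_mul_le_mul_right ?_ hpos
  calc a * (d * (c₁ / Real.sqrt d)) = d * (a * (c₁ / Real.sqrt d)) := by ring
    _ ≤ d * (a * ‖w - -t⁻¹ / Real.sqrt d‖) := by gcongr
    _ ≤ ε * P := hQn
    _ ≤ _ := hε3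

/-- The explicit form gives |z s_MP| ≤ |t|/√d + 1 with |t| < 1, and |z| ≥ κ in the bulk; no bound on
Im z from below is needed. -/
lemma norm_mpStieltjes_le_of_bulk (hd : 0 < d) (hd1 : d ≤ 1) (hκ : 0 < κ) {z : ℂ}
    (h1 : mpLower d + κ ≤ z.re) (hz : 0 < z.im) :
    ‖mpStieltjes d z‖ ≤ (1 / Real.sqrt d + 1) / κ := by
  have hs := Real.sqrt_pos.2 hd
  obtain ⟨t, ht0, ht1, ht, hmp⟩ := exists_mpStieltjes_eq hd hd1 hz.ne'
  have hzn : κ ≤ ‖z‖ :=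
    (by linarith [mpLower_nonneg d] : κ ≤ z.re).trans ((le_abs_self _).trans (Complex.abs_re_le_norm z))
  rw [le_div_iff₀ hκ]
  calc ‖mpStieltjes d z‖ * κ ≤ ‖mpStieltjes d z‖ * ‖z‖ := by gcongr
    _ = ‖-t / Real.sqrt d - 1‖ := by rw [mul_comm, ← norm_mul]; congr 1; linear_combination hmp
    _ ≤ ‖t‖ / Real.sqrt d + 1 := by
        refine (norm_sub_le _ _).trans_eq ?_
        rw [norm_div, norm_neg, Complex.norm_real, Real.norm_of_nonneg hs.le, norm_one]
    _ ≤ _ := by gcongr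

end stability

/-! ### Concentration of squared χ variables -/

section concentration

/-- Positivity of the Chernoff exponent, from log(1 − s) ≥ −s/(1 − s) = −(s + s²/(1 − s)). -/
lemma log_bound_pos {ε s : ℝ} (hs1 : s < 1) (h : 0 < s * (ε - s / (1 - s))) :
    0 < s * (1 + ε) + Real.log (1 - s) := by
  have h1 : 0 < 1 - s := by linarith
  have h2 := Real.one_sub_inv_le_log_of_pos h1
  have h3 : 1 - (1 - s)⁻¹ = -(s + s * (s / (1 - s))) := by field_simp; ring
  nlinarith

/-- Chernoff bound for the square of a `χ` variable. -/
lemma chiMeasure_real_tail_le {r : ℝ} (hr : 0 < r) {ε s : ℝ} (hs1 : s < 1) :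
    (chiMeasure r).real {x | s * (1 + ε) * r ≤ s * x ^ 2}
      ≤ Real.exp (-((s * (1 + ε) + Real.log (1 - s)) / 2) * r) := by
  have := isProbabilityMeasure_chiMeasure hr
  have hm := mul_meas_ge_le_integral_of_nonneg (μ := chiMeasure r)
    (f := fun x => Real.exp (s * x ^ 2 / 2)) (Filter.Eventually.of_forall fun x => (Real.exp_pos _).le)
    (integrable_exp_sq_chiMeasure hr hs1) (Real.exp (s * (1 + ε) * r / 2))
  rw [integral_exp_sq_chiMeasure hr hs1, Real.rpow_def_of_pos (by linarith)] at hm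
  have e : {x : ℝ | Real.exp (s * (1 + ε) * r / 2) ≤ Real.exp (s * x ^ 2 / 2)}
      = {x | s * (1 + ε) * r ≤ s * x ^ 2} := by
    ext x
    simp only [Set.mem_ofPred_eq, Real.exp_le_exp]
    constructor <;> intro h <;> linarith
  rw [e, ← le_div_iff₀' (Real.exp_pos _), ← Real.exp_sub] at hm
  refine hm.trans_eq ?_
  congr 1
  ring

/-- The sign of s selects the tail in `chiMeasure_real_tail_le`: s = ε/(2(1 + ε)) for the upper one,
s = −ε/2 with −ε for the lower one. Neither exponent depends on r. -/
lemma exists_chiMeasure_concentration {ε : ℝ} (hε : 0 < ε) : ∃ θ : ℝ, 0 < θ ∧ ∀ r : ℝ, 0 < r →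
    (chiMeasure r).real {x | ε * r < |x ^ 2 - r|} ≤ 2 * Real.exp (-θ * r) := by
  have k1 : 0 < ε / (2 * (1 + ε)) * (1 + ε) + Real.log (1 - ε / (2 * (1 + ε))) := by
    have h0 : ε / (2 * (1 + ε)) < 1 := by rw [div_lt_one (by positivity)]; linarith
    refine log_bound_pos h0 (mul_pos (by positivity) ?_)
    have : ε / (2 * (1 + ε)) / (1 - ε / (2 * (1 + ε))) = ε / (2 + ε) := by
      have : (1 : ℝ) - ε / (2 * (1 + ε)) = (2 + ε) / (2 * (1 + ε)) := by field_simp; ring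
      rw [this]; field_simp
    rw [this, sub_pos, div_lt_iff₀ (by positivity)]
    nlinarith
  have k2 : 0 < (-(ε / 2)) * (1 + -ε) + Real.log (1 - -(ε / 2)) := by
    refine log_bound_pos (by linarith) ?_
    have : -(ε / 2) / (1 - -(ε / 2)) = -(ε / (2 + ε)) := by
      rw [show (1 : ℝ) - -(ε / 2) = (2 + ε) / 2 by ring]; field_simp
    rw [this]
    have h3 : ε / (2 + ε) < ε := by rw [div_lt_iff₀ (by positivity)]; nlinarith
    nlinarith
  set a := ε / (2 * (1 + ε)) * (1 + ε) + Real.log (1 - ε / (2 * (1 + ε)))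
  set b := (-(ε / 2)) * (1 + -ε) + Real.log (1 - -(ε / 2))
  refine ⟨min a b / 2, by positivity, fun r hr => ?_⟩
  have := isProbabilityMeasure_chiMeasure hr
  have h1 := chiMeasure_real_tail_le hr (ε := ε) (s := ε / (2 * (1 + ε)))
    (by rw [div_lt_one (by positivity)]; linarith)
  have h2 := chiMeasure_real_tail_le hr (ε := -ε) (s := -(ε / 2)) (by linarith)
  have hsub : {x : ℝ | ε * r < |x ^ 2 - r|}
      ⊆ {x | ε / (2 * (1 + ε)) * (1 + ε) * r ≤ ε / (2 * (1 + ε)) * x ^ 2}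
        ∪ {x | (-(ε / 2)) * (1 + -ε) * r ≤ (-(ε / 2)) * x ^ 2} := by
    intro x hx
    rcases lt_abs.1 (show ε * r < |x ^ 2 - r| from hx) with h | h
    · left
      rw [Set.mem_ofPred_eq, mul_assoc]
      exact mul_le_mul_of_nonneg_left (by linarith) (by positivity)
    · right
      rw [Set.mem_ofPred_eq]
      nlinarith
  refine (measureReal_mono hsub).trans ((measureReal_union_le _ _).trans ?_)
  refine (add_le_add (h1.trans ?_) (h2.trans ?_)).trans (two_mul _).ge
  · refine Real.exp_le_exp.2 ?_
    have : min a b / 2 ≤ a / 2 := by linarith [min_le_left a b]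
    nlinarith
  · refine Real.exp_le_exp.2 ?_
    have : min a b / 2 ≤ b / 2 := by linarith [min_le_right a b]
    exact mul_le_mul_of_nonneg_right (neg_le_neg this) hr.le

end concentration

/-! ### Moment recursion for the gap of a Laguerre family -/

section family

variable {n : ℕ} {Ω : Type*} [MeasurableSpace Ω] {μ : Measure Ω} {β ρ c : ℝ} {z : ℂ}

/-- Independent `χ` variables with the parameters of the `β`-Laguerre ensemble. -/
structure IsLaguerreFamily (μ : Measure Ω) (β ρ : ℝ) (u : BidiagIdx n → Ω → ℝ) : Prop where
  hasLaw : ∀ k, HasLaw (u k) (chiMeasure (laguerreParam β ρ k)) μ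
  indep : iIndepFun u μ

/-- Shifting every index by one lowers the leading diagonal parameter by β and keeps the form of the
subdiagonal ones. -/
lemma IsLaguerreFamily.tail {u : BidiagIdx (n + 1) → Ω → ℝ} (h : IsLaguerreFamily μ β ρ u) :
    IsLaguerreFamily μ β (ρ - β) (fun k : BidiagIdx n => u (Sum.map Fin.succ Fin.succ k)) := by
  refine ⟨fun k => ?_, h.indep.precomp (Sum.map_injective.2
    ⟨Fin.succ_injective _, Fin.succ_injective _⟩)⟩
  have := h.hasLaw (Sum.map Fin.succ Fin.succ k)
  convert this using 2
  rcases k with i | j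
  · simp only [laguerreParam, Sum.map_inl, Sum.elim_inl, Fin.val_succ]; push_cast; ring
  · simp only [laguerreParam, Sum.map_inr, Sum.elim_inr, Fin.val_succ]; push_cast; ring

lemma IsLaguerreFamily.map_eq {u : BidiagIdx n → Ω → ℝ} (h : IsLaguerreFamily μ β ρ u) :
    μ.map (fun ω k => u k ω) = Measure.pi fun k => chiMeasure (laguerreParam β ρ k) := by
  have := h.indep.isProbabilityMeasure
  rw [(iIndepFun_iff_map_fun_eq_pi_map fun k => (h.hasLaw k).aemeasurable).1 h.indep]
  congr 1
  funext k
  exact (h.hasLaw k).map_eq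

lemma IsLaguerreFamily.aemeasurable {u : BidiagIdx n → Ω → ℝ} (h : IsLaguerreFamily μ β ρ u) :
    AEMeasurable (fun ω k => u k ω) μ :=
  aemeasurable_pi_iff.2 fun k => (h.hasLaw k).aemeasurable

/-- This closes the moment inequality: Im X₁₁ is controlled by the gap itself and by the normalized
trace. -/
lemma im_resolventLeft_le_gap (c : ℝ) (u : BidiagIdx n → ℝ) (z : ℂ) : (resolventLeft c u z 0 0).im
    ≤ ‖stieltjesGap c z u‖ + ((n : ℝ) + 1)⁻¹ * (resolventLeft c u z).trace.im := by
  have h1 : resolventLeft c u z 0 0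
      = stieltjesGap c z u + ((((n : ℝ) + 1)⁻¹ : ℝ) : ℂ) * (resolventLeft c u z).trace := by
    rw [stieltjesGap]; push_cast; ring
  rw [h1, Complex.add_im, Complex.im_ofReal_mul]
  gcongr
  exact (le_abs_self _).trans (Complex.abs_im_le_norm _)

/-- One step of the moment recursion. -/
lemma IsLaguerreFamily.integral_gap_succ_le [IsProbabilityMeasure μ] {u : BidiagIdx n → Ω → ℝ}
    (h : IsLaguerreFamily μ β ρ u) (hβ : 0 < β) (hpar : ∀ k : BidiagIdx n, 0 < laguerreParam β ρ k)
    (hz : 0 < z.im) {T : Set Ω} (hT : MeasurableSet T) {s₀ : ℝ} (hs₀ : 0 ≤ s₀)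
    (hTs : ∀ ω ∉ T, ((n : ℝ) + 1)⁻¹ * (resolventLeft c (fun k => u k ω) z).trace.im ≤ s₀)
    (k : ℕ) {A : ℝ} (hA : (2 * k + 1) * 2 / (β * (n + 1) * z.im) ≤ A) :
    ∫ ω, ‖stieltjesGap c z fun i => u i ω‖ ^ (2 * (k + 1)) ∂μ
      ≤ (A ^ 2 + 2 * A * s₀) * ∫ ω, ‖stieltjesGap c z fun i => u i ω‖ ^ (2 * k) ∂μ
        + 2 * A * (z.im⁻¹ * (2 * z.im⁻¹) ^ (2 * k)) * μ.real T := by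
  have hA0 : 0 ≤ A := le_trans (by positivity) hA
  have hβn : 0 < β * (n + 1) := by positivity
  have habs : |z.im| = z.im := abs_of_pos hz
  have hgc := continuous_stieltjesGap (c := c) (n := n) hz.ne'
  have hic : Continuous fun v : BidiagIdx n → ℝ => (resolventLeft c v z 0 0).im :=
    Complex.continuous_im.comp ((continuous_resolventLeft hz.ne').matrix_elem 0 0)
  set W : Ω → ℝ := fun ω => ‖stieltjesGap c z fun i => u i ω‖ with hW
  have hWm : AEStronglyMeasurable W μ :=
    (hgc.norm.measurable.comp_aemeasurable h.aemeasurable).aestronglyMeasurable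
  have hWb : ∀ ω, W ω ≤ 2 * z.im⁻¹ := fun ω => by
    have := norm_stieltjesGap_le (c := c) (u := fun i => u i ω) hz.ne'
    rwa [habs] at this
  have hW0 : ∀ ω, 0 ≤ W ω := fun ω => norm_nonneg _
  have hWi : ∀ j : ℕ, Integrable (fun ω => W ω ^ j) μ := fun j => by
    refine Integrable.of_bound (C := (2 * z.im⁻¹) ^ j) (hWm.pow j)
      (Filter.Eventually.of_forall fun ω => ?_)
    have := hWb ω
    have := hW0 ω
    rw [norm_pow, Real.norm_of_nonneg (hW0 ω)]
    gcongr
  have hmain := integral_norm_stieltjesGap_pow_le (c := c) hβ hpar hz k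
  have hc1 : Continuous fun v => ‖stieltjesGap c z v‖ ^ (2 * k + 2) := hgc.norm.pow _
  have hc2 : Continuous fun v : BidiagIdx n → ℝ =>
      (resolventLeft c v z 0 0).im * ‖stieltjesGap c z v‖ ^ (2 * k) := hic.mul (hgc.norm.pow _)
  rw [← h.map_eq, integral_map h.aemeasurable hc1.aestronglyMeasurable,
    integral_map h.aemeasurable hc2.aestronglyMeasurable] at hmain
  have h1 : ∫ ω, W ω ^ (2 * k + 2) ∂μ
      ≤ A * ∫ ω, (resolventLeft c (fun i => u i ω) z 0 0).im * W ω ^ (2 * k) ∂μ := by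
    have hI0 : 0 ≤ ∫ ω, (resolventLeft c (fun i => u i ω) z 0 0).im * W ω ^ (2 * k) ∂μ :=
      integral_nonneg fun ω => mul_nonneg (im_resolventMatrix_nonneg (isHermitian_left c _) hz 0)
        (pow_nonneg (hW0 ω) _)
    rw [← le_div_iff₀' hβn] at hmain
    refine hmain.trans (le_trans (le_of_eq ?_) (mul_le_mul_of_nonneg_right hA hI0))
    simp only [hW]
    field_simp
  have h2 : ∫ ω, (resolventLeft c (fun i => u i ω) z 0 0).im * W ω ^ (2 * k) ∂μ
      ≤ ∫ ω, (W ω ^ (2 * k + 1) + s₀ * W ω ^ (2 * k)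
        + T.indicator (fun _ => z.im⁻¹ * (2 * z.im⁻¹) ^ (2 * k)) ω) ∂μ := by
    have hri : Integrable (fun ω => W ω ^ (2 * k + 1) + s₀ * W ω ^ (2 * k)
        + T.indicator (fun _ => z.im⁻¹ * (2 * z.im⁻¹) ^ (2 * k)) ω) μ :=
      ((hWi _).add ((hWi _).const_mul _)).add ((integrable_const _).indicator hT)
    have hIb : ∀ ω, (resolventLeft c (fun i => u i ω) z 0 0).im ≤ z.im⁻¹ := fun ω => by
      have := norm_resolventMatrix_apply_le (isHermitian_left c fun i => u i ω) hz.ne' 0 0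
      rw [habs] at this
      exact ((le_abs_self _).trans (Complex.abs_im_le_norm _)).trans this
    refine integral_mono_of_nonneg (Filter.Eventually.of_forall fun ω =>
      mul_nonneg (im_resolventMatrix_nonneg (isHermitian_left c _) hz 0) (pow_nonneg (hW0 ω) _)) hri
      (Filter.Eventually.of_forall fun ω => ?_)
    have hp := pow_nonneg (hW0 ω) (2 * k)
    have hWbω := hWb ω
    have hW0ω := hW0 ω
    by_cases hω : ω ∈ T
    · simp only [Set.indicator_of_mem hω]
      have : (resolventLeft c (fun i => u i ω) z 0 0).im * W ω ^ (2 * k)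
          ≤ z.im⁻¹ * (2 * z.im⁻¹) ^ (2 * k) := by
        have := hIb ω
        gcongr
      have : 0 ≤ W ω ^ (2 * k + 1) + s₀ * W ω ^ (2 * k) := by positivity
      linarith
    · simp only [Set.indicator_of_notMem hω, add_zero]
      have h3 := im_resolventLeft_le_gap c (fun i => u i ω) z
      have h4 : (resolventLeft c (fun i => u i ω) z 0 0).im ≤ W ω + s₀ := h3.trans (by
        gcongr; exact hTs ω hω)
      calc _ ≤ (W ω + s₀) * W ω ^ (2 * k) := by gcongr
        _ = _ := by ring
  have hI1 : Integrable (fun ω => W ω ^ (2 * k + 1) + s₀ * W ω ^ (2 * k)) μ :=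
    (hWi _).add ((hWi _).const_mul _)
  rw [integral_add hI1 ((integrable_const _).indicator hT),
    integral_add (hWi _) ((hWi _).const_mul _), integral_const_mul, integral_indicator_const _ hT,
    smul_eq_mul] at h2
  -- The odd moment is split by AW ≤ W²/2 + A²/2, and half of the left-hand moment is absorbed. This
  -- produces A² and the factors 2 in the statement.
  have h3 : A * ∫ ω, W ω ^ (2 * k + 1) ∂μ
      ≤ (1 / 2) * ∫ ω, W ω ^ (2 * k + 2) ∂μ + (1 / 2 * A ^ 2) * ∫ ω, W ω ^ (2 * k) ∂μ := by
    rw [← integral_const_mul, ← integral_const_mul, ← integral_const_mul,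
      ← integral_add ((hWi _).const_mul _) ((hWi _).const_mul _)]
    refine integral_mono ((hWi _).const_mul _) (((hWi _).const_mul _).add ((hWi _).const_mul _))
      fun ω => ?_
    have hp := pow_nonneg (hW0 ω) (2 * k)
    have : A * W ω ≤ 1 / 2 * W ω ^ 2 + 1 / 2 * A ^ 2 := by nlinarith [sq_nonneg (A - W ω)]
    calc A * W ω ^ (2 * k + 1) = (A * W ω) * W ω ^ (2 * k) := by ring
      _ ≤ (1 / 2 * W ω ^ 2 + 1 / 2 * A ^ 2) * W ω ^ (2 * k) := by gcongr
      _ = _ := by ring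
  have h4 := mul_le_mul_of_nonneg_left h2 hA0
  rw [show 2 * (k + 1) = 2 * k + 2 by ring]
  nlinarith

/-- Moment bound for `stieltjesGap`. -/
lemma IsLaguerreFamily.integral_gap_le [IsProbabilityMeasure μ] {u : BidiagIdx n → Ω → ℝ}
    (h : IsLaguerreFamily μ β ρ u) (hβ : 0 < β) (hpar : ∀ k : BidiagIdx n, 0 < laguerreParam β ρ k)
    (hz : 0 < z.im) {T : Set Ω} (hT : MeasurableSet T) {s₀ : ℝ} (hs₀ : 0 ≤ s₀)
    (hTs : ∀ ω ∉ T, ((n : ℝ) + 1)⁻¹ * (resolventLeft c (fun k => u k ω) z).trace.im ≤ s₀)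
    (K : ℕ) {A B : ℝ} (hA : (2 * K + 1) * 2 / (β * (n + 1) * z.im) ≤ A)
    (hq : A ^ 2 + 2 * A * s₀ ≤ 1) (hB : 2 * z.im⁻¹ ≤ B) (hB1 : 1 ≤ B) {k : ℕ} (hk : k ≤ K) :
    ∫ ω, ‖stieltjesGap c z fun i => u i ω‖ ^ (2 * k) ∂μ
      ≤ (A ^ 2 + 2 * A * s₀) ^ k + k * (2 * A * B ^ (2 * K + 1) * μ.real T) := by
  have hA0 : 0 ≤ A := le_trans (by positivity) hA
  induction k with
  | zero => simp
  | succ k ih =>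
    have ih' := ih (by omega)
    have hkK : (k : ℝ) ≤ K := by exact_mod_cast (by omega : k ≤ K)
    have step := h.integral_gap_succ_le (c := c) hβ hpar hz hT hs₀ hTs k (A := A)
      (le_trans (by gcongr) hA)
    set q := A ^ 2 + 2 * A * s₀ with hqd
    have hq0 : 0 ≤ q := by positivity
    have hτ : 0 ≤ μ.real T := measureReal_nonneg
    have hb : 2 * A * (z.im⁻¹ * (2 * z.im⁻¹) ^ (2 * k)) * μ.real T
        ≤ 2 * A * B ^ (2 * K + 1) * μ.real T := by
      have : z.im⁻¹ * (2 * z.im⁻¹) ^ (2 * k) ≤ B ^ (2 * K + 1) := by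
        calc _ ≤ B * B ^ (2 * k) := by
              have : 0 < z.im⁻¹ := by positivity
              gcongr
              linarith
          _ = B ^ (2 * k + 1) := by ring
          _ ≤ _ := pow_le_pow_right₀ hB1 (by omega)
      gcongr
    set b := 2 * A * B ^ (2 * K + 1) * μ.real T
    have hb0 : 0 ≤ b := le_trans (by positivity) hb
    calc _ ≤ q * (q ^ k + k * b) + b := by
          refine step.trans (add_le_add ?_ hb)
          gcongr
      _ = q ^ (k + 1) + (q * (k * b) + b) := by ring
      -- Because q ≤ 1, the errors from the exceptional set add up only linearly in k.
      _ ≤ q ^ (k + 1) + (1 * (k * b) + b) := by gcongr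
      _ = _ := by push_cast; ring

/-- Markov bound for `stieltjesGap`. -/
lemma IsLaguerreFamily.prob_gap_le [IsProbabilityMeasure μ] {u : BidiagIdx n → Ω → ℝ}
    (h : IsLaguerreFamily μ β ρ u) (hβ : 0 < β) (hpar : ∀ k : BidiagIdx n, 0 < laguerreParam β ρ k)
    (hz : 0 < z.im) {T : Set Ω} (hT : MeasurableSet T) {s₀ : ℝ} (hs₀ : 0 ≤ s₀)
    (hTs : ∀ ω ∉ T, ((n : ℝ) + 1)⁻¹ * (resolventLeft c (fun k => u k ω) z).trace.im ≤ s₀)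
    (K : ℕ) {A B : ℝ} (hA : (2 * K + 1) * 2 / (β * (n + 1) * z.im) ≤ A)
    (hq : A ^ 2 + 2 * A * s₀ ≤ 1) (hB : 2 * z.im⁻¹ ≤ B) (hB1 : 1 ≤ B) {ε : ℝ} (hε : 0 < ε) :
    μ.real {ω | ε ≤ ‖stieltjesGap c z fun i => u i ω‖}
      ≤ ((A ^ 2 + 2 * A * s₀) ^ K + K * (2 * A * B ^ (2 * K + 1) * μ.real T)) / ε ^ (2 * K) := by
  have h1 := h.integral_gap_le (c := c) hβ hpar hz hT hs₀ hTs K hA hq hB hB1 le_rfl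
  have hgc := continuous_stieltjesGap (c := c) (n := n) hz.ne'
  have hi : Integrable (fun ω => ‖stieltjesGap c z fun i => u i ω‖ ^ (2 * K)) μ := by
    refine Integrable.of_bound (C := (2 * |z.im|⁻¹) ^ (2 * K))
      (((hgc.norm.pow _).measurable.comp_aemeasurable h.aemeasurable).aestronglyMeasurable)
      (Filter.Eventually.of_forall fun ω => ?_)
    have := norm_stieltjesGap_le (c := c) (u := fun i => u i ω) hz.ne'
    rw [norm_pow, norm_norm]
    gcongr
  have hm := mul_meas_ge_le_integral_of_nonneg (Filter.Eventually.of_forall fun ω => by positivity) hi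
    (ε ^ (2 * K))
  rw [le_div_iff₀' (by positivity)]
  refine le_trans ?_ (hm.trans h1)
  exact mul_le_mul_of_nonneg_left (measureReal_mono fun ω hω => pow_le_pow_left₀ hε.le hω _)
    (by positivity)

end family

/-! ### Descending from the level of the known law to a smaller imaginary part -/

section scale

/-- A Markov bound for `stieltjesGap`, when the normalized trace is controlled at a point `z'` above
`z`. -/
lemma IsLaguerreFamily.prob_gap_le_of_scale {N : ℕ} {Ω : Type*} [MeasurableSpace Ω] {μ : Measure Ω}
    [IsProbabilityMeasure μ] {β ρ c : ℝ} {u : BidiagIdx N → Ω → ℝ} (h : IsLaguerreFamily μ β ρ u)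
    (hβ : 0 < β) (hpar : ∀ k : BidiagIdx N, 0 < laguerreParam β ρ k) {z z' : ℂ} (hz : 0 < z.im)
    (hzz : z.im ≤ z'.im) (hre : z.re = z'.re) {S : ℝ} (hS : 0 ≤ S) {m t : ℝ} (hm : 1 ≤ m)
    (hmN : m ≤ 2 * (N + 1)) (ht : t ≤ 1) (h1 : (m * z.im)⁻¹ ≤ t)
    (h2 : z'.im / (m * z.im ^ 2) ≤ 2 * t) (h3 : z.im⁻¹ ≤ m) (K : ℕ) {A : ℝ}
    (hA : A = 4 * (2 * K + 1) / β) (hAt : (A ^ 2 + 4 * A * S) * t ≤ 1) {ε : ℝ} (hε : 0 < ε) :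
    μ.real {ω | ε ≤ ‖stieltjesGap c z fun i => u i ω‖}
      ≤ (((A ^ 2 + 4 * A * S) * t) ^ K + K * (2 * A * (2 * m) ^ (2 * K + 1)
        * μ.real {ω | S < ((N : ℝ) + 1)⁻¹ * (resolventLeft c (fun k => u k ω) z').trace.im}))
        / ε ^ (2 * K) := by
  -- The entries are only almost everywhere measurable, so the exceptional set is replaced by a
  -- measurable hull of the same measure.
  set T := toMeasurable μ {ω | S < ((N : ℝ) + 1)⁻¹ * (resolventLeft c (fun k => u k ω) z').trace.im}
    with hTdef
  have hTm : μ.real T = μ.real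
      {ω | S < ((N : ℝ) + 1)⁻¹ * (resolventLeft c (fun k => u k ω) z').trace.im} := by
    rw [measureReal_def, measureReal_def, hTdef, measure_toMeasurable]
  have hTmeas : MeasurableSet T := measurableSet_toMeasurable μ _
  rw [← hTm]
  have hz' : 0 < z'.im := hz.trans_le hzz
  have hm0 : 0 < m := by linarith
  have hA0 : 0 < A := by rw [hA]; positivity
  have hp0 : 0 < (m * z.im)⁻¹ := by positivity
  have ht0 : 0 < t := hp0.trans_le h1
  have hp1 : (m * z.im)⁻¹ ≤ 1 := h1.trans ht
  have hq : (A * (m * z.im)⁻¹) ^ 2 + 2 * (A * (m * z.im)⁻¹) * (z'.im / z.im * S)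
      ≤ (A ^ 2 + 4 * A * S) * t := by
    have e1 : (A * (m * z.im)⁻¹) ^ 2 ≤ A ^ 2 * t := by
      rw [mul_pow]
      gcongr
      nlinarith
    have e2 : 2 * (A * (m * z.im)⁻¹) * (z'.im / z.im * S)
        = 2 * A * S * (z'.im / (m * z.im ^ 2)) := by field_simp
    have e3 : 2 * A * S * (z'.im / (m * z.im ^ 2)) ≤ 2 * A * S * (2 * t) := by gcongr
    linarith
  refine (h.prob_gap_le (c := c) hβ hpar hz hTmeas
    (s₀ := z'.im / z.im * S) (by positivity) (fun ω hω => ?_) K (A := A * (m * z.im)⁻¹)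
    (B := 2 * m) ?_ (hq.trans hAt) (by linarith) (by linarith) hε).trans ?_
  · have hω2 := not_lt.1 (show ¬ S < ((N : ℝ) + 1)⁻¹ * (resolventLeft c (fun k => u k ω) z').trace.im
      from fun h => hω (subset_toMeasurable μ _ h))
    -- The trace bound at z' is carried down to z at the cost of the factor Im z' / Im z.
    have hmono := im_mul_im_trace_resolventMatrix_mono (isHermitian_left c fun k => u k ω) hz hzz hre
    have : (resolventLeft c (fun k => u k ω) z).trace.im
        ≤ z'.im / z.im * (resolventLeft c (fun k => u k ω) z').trace.im := by
      rw [div_mul_eq_mul_div, le_div_iff₀' hz]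
      exact hmono
    calc _ ≤ ((N : ℝ) + 1)⁻¹ * (z'.im / z.im * (resolventLeft c (fun k => u k ω) z').trace.im) := by
          gcongr
      _ = z'.im / z.im * (((N : ℝ) + 1)⁻¹ * (resolventLeft c (fun k => u k ω) z').trace.im) := by
          ring
      _ ≤ _ := by gcongr
  · have : (2 * (K : ℝ) + 1) * 2 / (β * (N + 1) * z.im)
        = (4 * (2 * K + 1) / β) * (2 * (N + 1) * z.im)⁻¹ := by field_simp; ring
    rw [this, ← hA]
    gcongr
  · have hAp : A * (m * z.im)⁻¹ ≤ A := mul_le_of_le_one_right hA0.le hp1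
    gcongr

end scale

/-! ### Probabilities smaller than every power of the size -/

section asymptotic

/-- `p n z` is, uniformly in `z ∈ D n`, smaller than every negative power of `n + 2`. -/
def RapidlySmall (D : ℕ → Set ℂ) (p : ℕ → ℂ → ℝ) : Prop :=
  ∀ k : ℕ, ∃ C : ℝ, ∀ᶠ n : ℕ in Filter.atTop, ∀ z ∈ D n, p n z ≤ C / ((n : ℝ) + 2) ^ k

lemma RapidlySmall.add {D : ℕ → Set ℂ} {p q : ℕ → ℂ → ℝ} (hp : RapidlySmall D p)
    (hq : RapidlySmall D q) : RapidlySmall D fun n z => p n z + q n z := fun k => by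
  obtain ⟨C, hC⟩ := hp k
  obtain ⟨C', hC'⟩ := hq k
  refine ⟨C + C', ?_⟩
  filter_upwards [hC, hC'] with n h1 h2 z hz
  rw [add_div]
  exact add_le_add (h1 z hz) (h2 z hz)

lemma RapidlySmall.mono {D : ℕ → Set ℂ} {p q : ℕ → ℂ → ℝ} (hp : RapidlySmall D p)
    (h : ∀ᶠ n : ℕ in Filter.atTop, ∀ z ∈ D n, q n z ≤ p n z) : RapidlySmall D q := fun k => by
  obtain ⟨C, hC⟩ := hp k
  refine ⟨C, ?_⟩
  filter_upwards [hC, h] with n h1 h2 z hz using (h2 z hz).trans (h1 z hz)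

lemma RapidlySmall.mono_domain {D D' : ℕ → Set ℂ} {p : ℕ → ℂ → ℝ} (hp : RapidlySmall D p)
    (h : ∀ n, D' n ⊆ D n) : RapidlySmall D' p := fun k => by
  obtain ⟨C, hC⟩ := hp k
  refine ⟨C, ?_⟩
  filter_upwards [hC] with n h1 z hz using h1 z (h n hz)

lemma rapidlySmall_exp (D : ℕ → Set ℂ) {θ : ℝ} (hθ : 0 < θ) :
    RapidlySmall D fun n _ => 2 * Real.exp (-(θ * ((n : ℝ) + 2))) := fun k => by
  refine ⟨2 * (k.factorial / θ ^ k), Filter.Eventually.of_forall fun n z _ => ?_⟩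
  have h := Real.pow_div_factorial_le_exp (θ * ((n : ℝ) + 2)) (by positivity) k
  rw [mul_div_assoc]
  refine mul_le_mul_of_nonneg_left ?_ zero_le_two
  rw [Real.exp_neg, div_div, ← mul_pow, ← inv_div]
  exact inv_anti₀ (by positivity) h

lemma eventually_rpow_neg_le {δ : ℝ} (hδ : 0 < δ) {ε : ℝ} (hε : 0 < ε) :
    ∀ᶠ n : ℕ in Filter.atTop, ((n : ℝ) + 2) ^ (-δ) ≤ ε := by
  have h1 : Filter.Tendsto (fun n : ℕ => (n : ℝ) + 2) Filter.atTop Filter.atTop :=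
    Filter.tendsto_atTop_add_const_right _ _ tendsto_natCast_atTop_atTop
  exact ((tendsto_rpow_neg_atTop hδ).comp h1).eventually_le_const hε

variable {d κ a δ : ℝ}

/-- Consequences of `m ^ ((a - 1) / 2 + δ) < η`. -/
lemma scale_bounds (ha0 : -1 < a) (hδ : 0 < δ) {m η : ℝ} (hm : 1 ≤ m)
    (hη : m ^ ((a - 1) / 2 + δ) < η) :
    (m * η)⁻¹ ≤ m ^ (-δ) ∧ max η (2 * m ^ a) / (m * η ^ 2) ≤ 2 * m ^ (-δ) ∧ η⁻¹ ≤ m := by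
  have hm0 : 0 < m := by linarith
  have hp : 0 < m ^ ((a - 1) / 2 + δ) := Real.rpow_pos_of_pos hm0 _
  have hη0 : 0 < η := hp.trans hη
  have hinv : η⁻¹ ≤ m ^ (-((a - 1) / 2 + δ)) := by
    rw [Real.rpow_neg hm0.le]; exact inv_anti₀ hp hη.le
  have hmi : m⁻¹ = m ^ (-1 : ℝ) := by rw [Real.rpow_neg_one]
  have b1 : (m * η)⁻¹ ≤ m ^ (-δ) := by
    rw [mul_inv]
    calc m⁻¹ * η⁻¹ ≤ m ^ (-1 : ℝ) * m ^ (-((a - 1) / 2 + δ)) := by rw [hmi]; gcongr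
      _ = m ^ (-1 + -((a - 1) / 2 + δ)) := (Real.rpow_add hm0 _ _).symm
      _ ≤ _ := Real.rpow_le_rpow_of_exponent_le hm (by linarith)
  refine ⟨b1, ?_, ?_⟩
  · rw [div_le_iff₀ (by positivity), max_le_iff]
    constructor
    · have : (m * η)⁻¹ * (m * η ^ 2) = η := by field_simp
      calc η = (m * η)⁻¹ * (m * η ^ 2) := this.symm
        _ ≤ m ^ (-δ) * (m * η ^ 2) := by gcongr
        _ ≤ _ := by
          have : 0 ≤ m ^ (-δ) * (m * η ^ 2) := by positivity
          linarith
    -- This fixes the exponent (a − 1)/2: m times the square of the scale is m^(a+2δ), and a factor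
    -- m^(−δ) still leaves m^(a+δ) ≥ m^a.
    · have : m ^ a ≤ m ^ (-δ) * (m * η ^ 2) := by
        calc m ^ a ≤ m ^ (-δ + (1 + ((a - 1) / 2 + δ + ((a - 1) / 2 + δ)))) :=
              Real.rpow_le_rpow_of_exponent_le hm (by linarith)
          _ = m ^ (-δ) * (m * (m ^ ((a - 1) / 2 + δ)) ^ 2) := by
              rw [Real.rpow_add hm0, Real.rpow_add hm0, Real.rpow_add hm0, Real.rpow_one, sq]
          _ ≤ _ := by gcongr
      linarith
  · calc η⁻¹ ≤ _ := hinv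
      _ ≤ m ^ (1 : ℝ) := Real.rpow_le_rpow_of_exponent_le hm (by linarith)
      _ = m := Real.rpow_one m

/-- A bound on the normalized trace at level `m ^ a` makes `stieltjesGap` small at level
`m ^ ((a - 1) / 2 + δ)`. -/
lemma rapidlySmall_gap (ha0 : -1 < a) (hδ : 0 < δ) {β : ℝ} (hβ : 0 < β)
    {Ω : ℕ → Type*} [∀ n, MeasurableSpace (Ω n)] (P : ∀ n, Measure (Ω n))
    [∀ n, IsProbabilityMeasure (P n)] {N : ℕ → ℕ} (hN : ∀ n, n ≤ N n) {c ρ : ℕ → ℝ}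
    {u : ∀ n, BidiagIdx (N n) → Ω n → ℝ} (hu : ∀ n, IsLaguerreFamily (P n) β (ρ n) (u n))
    (hpar : ∀ n, ∀ k : BidiagIdx (N n), 0 < laguerreParam β (ρ n) k) {S : ℝ} (hS : 0 ≤ S)
    (hT : RapidlySmall (fun n => bulkDomain d κ a (n + 2)) fun n z => (P n).real
      {ω | S < ((N n : ℝ) + 1)⁻¹ * (resolventLeft (c n) (fun k => u n k ω) z).trace.im})
    {ε : ℝ} (hε : 0 < ε) :
    RapidlySmall (fun n => bulkDomain d κ ((a - 1) / 2 + δ) (n + 2)) fun n z => (P n).real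
      {ω | ε ≤ ‖stieltjesGap (c n) z fun k => u n k ω‖} := fun k => by
  -- With Kδ ≥ k, the K-th power of the gain m^(−δ) is at most m^(−k).
  obtain ⟨K, hK⟩ := exists_nat_ge ((k : ℝ) / δ)
  rw [div_le_iff₀ hδ] at hK
  set A := 4 * (2 * (K : ℝ) + 1) / β with hA
  have hA0 : 0 < A := by positivity
  have hQ : 0 < A ^ 2 + 4 * A * S := by positivity
  -- The extra 2K + 1 powers compensate the deterministic factor (2m)^(2K+1) on the exceptional set.
  obtain ⟨C, hC⟩ := hT (2 * K + 1 + k)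
  refine ⟨((A ^ 2 + 4 * A * S) ^ K + K * (2 * A * 2 ^ (2 * K + 1) * C)) / ε ^ (2 * K), ?_⟩
  filter_upwards [hC, eventually_rpow_neg_le hδ (inv_pos.2 hQ)] with n hn ht z hz
  obtain ⟨hz1, hz2, hz3⟩ := hz
  push_cast at hz3
  have hm : (1 : ℝ) ≤ (n : ℝ) + 2 := by
    have : (0 : ℝ) ≤ n := n.cast_nonneg
    linarith
  set m : ℝ := (n : ℝ) + 2 with hmdef
  have hm0 : 0 < m := by linarith
  obtain ⟨b1, b2, b3⟩ := scale_bounds ha0 hδ hm hz3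
  have hzp : 0 < z.im := (Real.rpow_pos_of_pos hm0 _).trans hz3
  have hma : 0 < m ^ a := Real.rpow_pos_of_pos hm0 _
  -- The maximum keeps z' above z, and the factor 2 gives the strict inequality that defines the
  -- domain at level m^a.
  have hz' : (⟨z.re, max z.im (2 * m ^ a)⟩ : ℂ) ∈ bulkDomain d κ a (n + 2) := by
    refine ⟨hz1, hz2, ?_⟩
    push_cast
    rw [← hmdef]
    exact lt_max_of_lt_right (by linarith)
  have ht1 : m ^ (-δ) ≤ 1 := Real.rpow_le_one_of_one_le_of_nonpos hm (by linarith)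
  have hNn : (n : ℝ) ≤ N n := by exact_mod_cast hN n
  have hmain := (hu n).prob_gap_le_of_scale (c := c n) hβ (hpar n)
    (z' := ⟨z.re, max z.im (2 * m ^ a)⟩) hzp (le_max_left _ _) rfl hS (m := m) (t := m ^ (-δ)) hm
    (by rw [hmdef]; linarith) ht1 b1 b2 b3 K hA
    (by rw [← le_inv_mul_iff₀ hQ, mul_one]; exact ht) hε
  refine hmain.trans ?_
  rw [div_div, mul_comm (ε ^ (2 * K)), ← div_div]
  gcongr
  rw [add_div]
  have hpow : (m ^ (-δ)) ^ K ≤ (m ^ k)⁻¹ := by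
    rw [← Real.rpow_natCast, ← Real.rpow_mul hm0.le, ← Real.rpow_natCast m k, ← Real.rpow_neg hm0.le]
    exact Real.rpow_le_rpow_of_exponent_le hm (by linarith)
  refine add_le_add ?_ ?_
  · rw [mul_pow, div_eq_mul_inv]
    gcongr
  · calc _ ≤ K * (2 * A * (2 * m) ^ (2 * K + 1) * (C / m ^ (2 * K + 1 + k))) := by
          gcongr
          exact hn _ hz'
      _ = _ := by
          rw [mul_pow]
          field_simp
          ring

end asymptotic

/-! ### The estimate at a fixed spectral parameter -/

section fixedPoint

lemma laguerreParam_pos {n : ℕ} {β ρ : ℝ} (hβ : 0 < β) (hρ : β * n < ρ) (k : BidiagIdx n) :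
    0 < laguerreParam β ρ k := by
  rcases k with i | j
  · have : ((i : ℕ) : ℝ) ≤ n := by exact_mod_cast Nat.lt_succ_iff.1 i.isLt
    simp only [laguerreParam, Sum.elim_inl]
    nlinarith
  · have : ((j : ℕ) : ℝ) < n := by exact_mod_cast j.isLt
    simp only [laguerreParam, Sum.elim_inr]
    exact mul_pos hβ (by linarith)

/-- Each corner entry is its normalized trace plus its gap. Interlacing of the traces and the change
of normalization from n + 1 to n + 2 cost at most 1/((n + 2)η) each. -/
lemma norm_tail_sub_le {n : ℕ} {c : ℝ} {z : ℂ} (u : BidiagIdx (n + 1) → ℝ) (hz : 0 < z.im) :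
    ‖(1 + z * resolventLeft c (bidiagTail u) z 0 0) - (1 + z * resolventLeft c u z 0 0)‖
      ≤ ‖z‖ * (‖stieltjesGap c z (bidiagTail u)‖ + ‖stieltjesGap c z u‖
        + 2 * (((n : ℝ) + 2) * z.im)⁻¹) := by
  have h1 := norm_trace_resolventLeft_sub_tail_le (c := c) u hz.ne'
  have h2 := norm_trace_resolventMatrix_le (isHermitian_left c (bidiagTail u)) hz.ne'
  rw [abs_of_pos hz] at h1 h2
  rw [Fintype.card_fin] at h2
  set t := (resolventLeft c u z).trace with ht
  change ‖(resolventLeft c (bidiagTail u) z).trace‖ ≤ _ at h2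
  set t₁ := (resolventLeft c (bidiagTail u) z).trace with ht₁
  have hn1 : (n : ℂ) + 1 ≠ 0 := Nat.cast_add_one_ne_zero n
  have hn2 : (n : ℂ) + 1 + 1 ≠ 0 := by exact_mod_cast Nat.cast_add_one_ne_zero (R := ℂ) (n + 1)
  have key : (1 + z * resolventLeft c (bidiagTail u) z 0 0) - (1 + z * resolventLeft c u z 0 0)
      = z * (stieltjesGap c z (bidiagTail u) - stieltjesGap c z u
        + ((n : ℂ) + 1 + 1)⁻¹ * (((n : ℂ) + 1)⁻¹ * t₁ - (t - t₁))) := by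
    rw [stieltjesGap, stieltjesGap, ← ht, ← ht₁]
    push_cast
    field_simp
    ring
  rw [key, norm_mul]
  gcongr
  refine (norm_add_le _ _).trans (add_le_add (norm_sub_le _ _) ?_)
  have e1 : ‖((n : ℂ) + 1 + 1)⁻¹‖ = ((n : ℝ) + 2)⁻¹ := by
    rw [norm_inv, show (n : ℂ) + 1 + 1 = ((n + 2 : ℕ) : ℂ) by push_cast; ring, Complex.norm_natCast]
    push_cast; rfl
  have e2 : ‖((n : ℂ) + 1)⁻¹‖ = ((n : ℝ) + 1)⁻¹ := by
    rw [norm_inv, show (n : ℂ) + 1 = ((n + 1 : ℕ) : ℂ) by push_cast; ring, Complex.norm_natCast]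
    push_cast; rfl
  have e3 : ‖((n : ℂ) + 1)⁻¹ * t₁ - (t - t₁)‖ ≤ 2 * z.im⁻¹ := by
    refine (norm_sub_le _ _).trans ?_
    rw [norm_mul, e2]
    have : ((n : ℝ) + 1)⁻¹ * ‖t₁‖ ≤ z.im⁻¹ := by
      rw [inv_mul_le_iff₀ (by positivity)]
      push_cast at h2
      exact h2
    linarith
  rw [norm_mul, e1, mul_inv]
  calc ((n : ℝ) + 2)⁻¹ * _ ≤ ((n : ℝ) + 2)⁻¹ * (2 * z.im⁻¹) := by gcongr
    _ = _ := by ring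

variable {β d κ a δ : ℝ} {Ω : ℕ → Type*} [∀ n, MeasurableSpace (Ω n)] {P : ∀ n, Measure (Ω n)}
  [∀ n, IsProbabilityMeasure (P n)] {u : ∀ n, BidiagIdx (n + 1) → Ω n → ℝ}

/-- A uniform bound on the normalized trace from the Marchenko-Pastur law at one level. -/
lemma rapidlySmall_trace (hd : 0 < d) (hd1 : d ≤ 1) (hκ : 0 < κ) {c : ℕ → ℝ}
    (hs : RapidlySmall (fun n => bulkDomain d κ a (n + 2)) fun n z => (P n).real
      {ω | 1 ≤ ‖((n : ℂ) + 2)⁻¹ * (resolventLeft (c n) (fun k => u n k ω) z).trace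
        - mpStieltjes d z‖}) :
    RapidlySmall (fun n => bulkDomain d κ a (n + 2)) fun n z => (P n).real
      {ω | (1 / Real.sqrt d + 1) / κ + 1
        < ((n : ℝ) + 2)⁻¹ * (resolventLeft (c n) (fun k => u n k ω) z).trace.im} := by
  refine hs.mono (Filter.Eventually.of_forall fun n z hz => measureReal_mono fun ω hω => ?_)
  obtain ⟨hz1, -, hz3⟩ := hz
  have hzp : 0 < z.im := (Real.rpow_nonneg (Nat.cast_nonneg _) _).trans_lt hz3
  have h1 := norm_mpStieltjes_le_of_bulk hd hd1 hκ hz1 hzp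
  have h2 : (1 / Real.sqrt d + 1) / κ + 1
      < ((n : ℝ) + 2)⁻¹ * (resolventLeft (c n) (fun k => u n k ω) z).trace.im := hω
  set t := (resolventLeft (c n) (fun k => u n k ω) z).trace
  have h3 : ((n : ℝ) + 2)⁻¹ * t.im = (((n : ℂ) + 2)⁻¹ * t).im := by
    rw [← Complex.im_ofReal_mul]; push_cast; rfl
  have h4 : (((n : ℂ) + 2)⁻¹ * t).im ≤ ‖((n : ℂ) + 2)⁻¹ * t‖ :=
    (le_abs_self _).trans (Complex.abs_im_le_norm _)
  have h5 := norm_sub_norm_le (((n : ℂ) + 2)⁻¹ * t) (mpStieltjes d z)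
  change 1 ≤ ‖((n : ℂ) + 2)⁻¹ * t - mpStieltjes d z‖
  linarith

/-- Interlacing costs 1/((n + 2)η) in the normalized trace, at most 1 since a > −1. The
normalizations differ by a factor at most 2, hence 2S + 2. -/
lemma rapidlySmall_trace_tail (ha0 : -1 < a) {c : ℕ → ℝ} {S : ℝ}
    (hs : RapidlySmall (fun n => bulkDomain d κ a (n + 2)) fun n z => (P n).real
      {ω | S < ((n : ℝ) + 2)⁻¹ * (resolventLeft (c n) (fun k => u n k ω) z).trace.im}) :
    RapidlySmall (fun n => bulkDomain d κ a (n + 2)) fun n z => (P n).real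
      {ω | 2 * S + 2 < ((n : ℝ) + 1)⁻¹
        * (resolventLeft (c n) (bidiagTail fun k => u n k ω) z).trace.im} := by
  refine hs.mono (Filter.Eventually.of_forall fun n z hz => measureReal_mono fun ω hω => ?_)
  obtain ⟨-, -, hz3⟩ := hz
  have hzp : 0 < z.im := (Real.rpow_nonneg (Nat.cast_nonneg _) _).trans_lt hz3
  have h1 := norm_trace_resolventLeft_sub_tail_le (c := c n) (fun k => u n k ω) hzp.ne'
  rw [abs_of_pos hzp] at h1
  have h2 : 2 * S + 2 < ((n : ℝ) + 1)⁻¹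
        * (resolventLeft (c n) (bidiagTail fun k => u n k ω) z).trace.im := hω
  have h0 : 0 ≤ (resolventLeft (c n) (bidiagTail fun k => u n k ω) z).trace.im :=
    im_trace_resolventMatrix_nonneg (isHermitian_left _ _) hzp
  set t := (resolventLeft (c n) (fun k => u n k ω) z).trace
  set t₁ := (resolventLeft (c n) (bidiagTail fun k => u n k ω) z).trace
  change S < ((n : ℝ) + 2)⁻¹ * t.im
  have h3 : t₁.im - t.im ≤ z.im⁻¹ := by
    have := (le_abs_self _).trans (Complex.abs_im_le_norm (t₁ - t))
    rw [norm_sub_rev, Complex.sub_im] at this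
    exact this.trans h1
  have hn0 : (0 : ℝ) ≤ n := n.cast_nonneg
  have h4 : ((n : ℝ) + 2)⁻¹ * z.im⁻¹ ≤ 1 := by
    rw [← mul_inv]
    refine inv_le_one_of_one_le₀ ?_
    push_cast at hz3
    calc (1 : ℝ) ≤ ((n : ℝ) + 2) ^ (1 + a) := Real.one_le_rpow (by linarith) (by linarith)
      _ = ((n : ℝ) + 2) * ((n : ℝ) + 2) ^ a := by rw [Real.rpow_add (by positivity), Real.rpow_one]
      _ ≤ _ := by gcongr
  have h5 : ((n : ℝ) + 1)⁻¹ ≤ 2 * ((n : ℝ) + 2)⁻¹ := by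
    rw [← div_eq_mul_inv, inv_eq_one_div, div_le_div_iff₀ (by positivity) (by positivity)]
    linarith
  have h6 : ((n : ℝ) + 1)⁻¹ * t₁.im ≤ 2 * ((n : ℝ) + 2)⁻¹ * t₁.im := by gcongr
  have h7 : ((n : ℝ) + 2)⁻¹ * t₁.im ≤ ((n : ℝ) + 2)⁻¹ * (t.im + z.im⁻¹) := by
    gcongr; linarith
  linarith

/-- Concentration of the squared first diagonal entry. -/
lemma rapidlySmall_diag (D : ℕ → Set ℂ) (hβ : 0 < β) (hd : 0 < d)
    (hu : ∀ n, IsLaguerreFamily (P n) β (((n : ℝ) + 2) * β / d) (u n)) {ε : ℝ} (hε : 0 < ε) :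
    RapidlySmall D fun n _ => (P n).real
      {ω | ε < |d / (β * ((n : ℝ) + 2)) * u n (.inl 0) ω ^ 2 - 1|} := by
  obtain ⟨θ, hθ, h⟩ := exists_chiMeasure_concentration hε
  refine (rapidlySmall_exp D (θ := θ * (β / d)) (by positivity)).mono
    (Filter.Eventually.of_forall fun n z _ => ?_)
  have hr : 0 < ((n : ℝ) + 2) * β / d := by positivity
  have hl := (hu n).hasLaw (.inl 0)
  have hp : laguerreParam β (((n : ℝ) + 2) * β / d) (.inl 0 : BidiagIdx (n + 1))
      = ((n : ℝ) + 2) * β / d := by simp [laguerreParam]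
  rw [hp] at hl
  have hm : MeasurableSet {x : ℝ | ε * (((n : ℝ) + 2) * β / d) < |x ^ 2 - ((n : ℝ) + 2) * β / d|} :=
    measurableSet_lt measurable_const (by fun_prop)
  have h1 := h _ hr
  rw [← hl.map_eq, map_measureReal_apply_of_aemeasurable hl.aemeasurable hm] at h1
  refine le_trans (measureReal_mono fun ω hω => ?_) (h1.trans_eq (by congr 2; ring))
  have hω' : ε < |d / (β * ((n : ℝ) + 2)) * u n (.inl 0) ω ^ 2 - 1| := hω
  change ε * _ < |u n (.inl 0) ω ^ 2 - _|
  rw [show d / (β * ((n : ℝ) + 2)) * u n (.inl 0) ω ^ 2 - 1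
    = (u n (.inl 0) ω ^ 2 - ((n : ℝ) + 2) * β / d) / (((n : ℝ) + 2) * β / d) by field_simp,
    abs_div, abs_of_pos hr, lt_div_iff₀ hr] at hω'
  exact hω'

/-- Concentration of the squared first subdiagonal entry. -/
lemma rapidlySmall_sub (D : ℕ → Set ℂ) (hβ : 0 < β) (hd : 0 < d)
    (hu : ∀ n, IsLaguerreFamily (P n) β (((n : ℝ) + 2) * β / d) (u n)) {ε : ℝ} (hε : 0 < ε) :
    RapidlySmall D fun n _ => (P n).real
      {ω | ε < |d / (β * ((n : ℝ) + 2)) * u n (.inr 0) ω ^ 2 - d|} := by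
  obtain ⟨θ, hθ, h⟩ := exists_chiMeasure_concentration (ε := ε / (2 * d)) (by positivity)
  refine (rapidlySmall_exp D (θ := θ * (β / 2)) (by positivity)).mono ?_
  filter_upwards [eventually_rpow_neg_le one_pos (ε := ε / (2 * d)) (by positivity)] with n hn z _
  have hn0 : (0 : ℝ) ≤ n := n.cast_nonneg
  have hr : 0 < β * ((n : ℝ) + 1) := by positivity
  have hl := (hu n).hasLaw (.inr 0)
  have hp : laguerreParam β (((n : ℝ) + 2) * β / d) (.inr 0 : BidiagIdx (n + 1))
      = β * ((n : ℝ) + 1) := by simp [laguerreParam]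
  rw [hp] at hl
  have hm : MeasurableSet
      {x : ℝ | ε / (2 * d) * (β * ((n : ℝ) + 1)) < |x ^ 2 - β * ((n : ℝ) + 1)|} :=
    measurableSet_lt measurable_const (by fun_prop)
  have h1 := h _ hr
  rw [← hl.map_eq, map_measureReal_apply_of_aemeasurable hl.aemeasurable hm] at h1
  refine le_trans (measureReal_mono fun ω hω => ?_) (h1.trans ?_)
  · have hω' : ε < |d / (β * ((n : ℝ) + 2)) * u n (.inr 0) ω ^ 2 - d| := hω
    change ε / (2 * d) * _ < |u n (.inr 0) ω ^ 2 - _|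
    rw [show d / (β * ((n : ℝ) + 2)) * u n (.inr 0) ω ^ 2 - d
      = d / (β * ((n : ℝ) + 2)) * (u n (.inr 0) ω ^ 2 - β * ((n : ℝ) + 1)) - d * ((n : ℝ) + 2)⁻¹ by
        field_simp; ring] at hω'
    have h2 := hω'.trans_le (abs_sub _ _)
    rw [abs_mul, abs_of_pos (by positivity : 0 < d / (β * ((n : ℝ) + 2))),
      abs_of_pos (by positivity : 0 < d * ((n : ℝ) + 2)⁻¹)] at h2
    rw [Real.rpow_neg_one] at hn
    -- The mean of the normalized square is d(n + 1)/(n + 2); its distance d/(n + 2) from d uses up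
    -- half of the tolerance.
    have h3 : d * ((n : ℝ) + 2)⁻¹ ≤ ε / 2 := by
      calc _ ≤ d * (ε / (2 * d)) := by gcongr
        _ = _ := by field_simp
    have h4 : ε / 2 < d / (β * ((n : ℝ) + 2)) * |u n (.inr 0) ω ^ 2 - β * ((n : ℝ) + 1)| := by
      linarith
    rw [div_mul_eq_mul_div, lt_div_iff₀ (by positivity)] at h4
    rw [div_mul_eq_mul_div, div_lt_iff₀ (by positivity)]
    nlinarith [mul_pos hε hβ]
  · gcongr
    nlinarith [mul_pos hθ hβ]

/-- The resolvent entry is close to the Marchenko-Pastur transform at each fixed point. -/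
lemma rapidlySmall_resolvent (hβ : 0 < β) (hd : 0 < d) (hd1 : d ≤ 1) (hκ : 0 < κ) (ha0 : -1 < a)
    (hδ : 0 < δ) (hu : ∀ n, IsLaguerreFamily (P n) β (((n : ℝ) + 2) * β / d) (u n))
    (hs : RapidlySmall (fun n => bulkDomain d κ a (n + 2)) fun n z => (P n).real
      {ω | 1 ≤ ‖((n : ℂ) + 2)⁻¹
        * (resolventLeft (d / (β * ((n : ℝ) + 2))) (fun k => u n k ω) z).trace - mpStieltjes d z‖})
    (H : ℝ) {c₀ : ℝ} (hc₀ : 0 < c₀) :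
    RapidlySmall (fun n => bulkDomain d κ ((a - 1) / 2 + δ) (n + 2) ∩ {z | z.im ≤ H}) fun n z =>
      (P n).real {ω | c₀ < ‖resolventLeft (d / (β * ((n : ℝ) + 2))) (fun k => u n k ω) z 0 0
        - mpStieltjes d z‖} := by
  -- Stability concerns 1 + zX₁₁. Since |z| ≥ κ, accuracy c₀κ there gives accuracy c₀ for X₁₁.
  obtain ⟨ε, hε, hstab⟩ := mp_stability hd hd1 hκ (mpUpper d + |H|) (mul_pos hc₀ hκ)
  have hZ : 0 < mpUpper d + |H| + 1 := by
    have : 0 ≤ mpUpper d := sq_nonneg _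
    positivity
  set Z := mpUpper d + |H| + 1 with hZdef
  have hS : 0 ≤ (1 / Real.sqrt d + 1) / κ + 1 := by positivity
  -- Four equal shares of ε: the two gaps, and twice the term 1/(mη) of `norm_tail_sub_le`.
  have hε' : 0 < ε / (4 * Z) := by positivity
  -- Here d ≤ 1 is used: it makes all χ parameters positive, for the matrix and for its tail.
  have hbig : ∀ n : ℕ, β * ((n : ℝ) + 2) ≤ ((n : ℝ) + 2) * β / d := fun n => by
    rw [le_div_iff₀ hd]
    have : 0 < β * ((n : ℝ) + 2) := by positivity
    nlinarith
  have htr := rapidlySmall_trace hd hd1 hκ hs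
  have g1 := rapidlySmall_gap (N := fun n => n + 1) (c := fun n => d / (β * ((n : ℝ) + 2))) ha0 hδ hβ P (fun n => n.le_succ) hu
    (fun n k => laguerreParam_pos hβ (by have := hbig n; push_cast; linarith) k) hS
    (htr.mono (Filter.Eventually.of_forall fun n z _ => by
      push_cast; rw [add_assoc, one_add_one_eq_two])) hε'
  have g2 := rapidlySmall_gap (N := fun n => n) (c := fun n => d / (β * ((n : ℝ) + 2))) ha0 hδ hβ P (fun n => le_rfl)
    (fun n => (hu n).tail)
    (fun n k => laguerreParam_pos hβ (by have := hbig n; linarith) k) (by positivity)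
    (rapidlySmall_trace_tail ha0 htr) hε'
  have g3 := rapidlySmall_diag (fun n => bulkDomain d κ ((a - 1) / 2 + δ) (n + 2)) hβ hd hu hε
  have g4 := rapidlySmall_sub (fun n => bulkDomain d κ ((a - 1) / 2 + δ) (n + 2)) hβ hd hu hε
  refine ((((g1.add g2).add (g3.add g4))).mono_domain fun n => Set.inter_subset_left).mono ?_
  filter_upwards [eventually_rpow_neg_le hδ hε'] with n hn z hz
  obtain ⟨⟨hz1, hz2, hz3⟩, hzH⟩ := hz
  have hzH' : z.im ≤ H := hzH
  have hn0 : (0 : ℝ) ≤ n := n.cast_nonneg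
  push_cast at hz3
  have hzp : 0 < z.im := (Real.rpow_nonneg (by positivity) _).trans_lt hz3
  obtain ⟨b1, -, -⟩ := scale_bounds ha0 hδ (by linarith) hz3
  have hκz : κ ≤ ‖z‖ :=
    (by linarith [mpLower_nonneg d] : κ ≤ z.re).trans ((le_abs_self _).trans (Complex.abs_re_le_norm z))
  have hzZ : ‖z‖ ≤ mpUpper d + |H| := by
    refine (Complex.norm_le_abs_re_add_abs_im z).trans (add_le_add ?_ ?_)
    · rw [abs_of_nonneg (by linarith [mpLower_nonneg d])]
      linarith
    · rw [abs_of_pos hzp]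
      exact hzH'.trans (le_abs_self _)
  refine le_trans (measureReal_mono (s₂ := _ ∪ _ ∪ (_ ∪ _)) fun ω hω => ?_)
    ((measureReal_union_le _ _).trans
      (add_le_add (measureReal_union_le _ _) (measureReal_union_le _ _)))
  by_contra hcon
  simp only [Set.mem_union, not_or] at hcon
  obtain ⟨⟨c1, c2⟩, c3, c4⟩ := hcon
  have c1' : ‖stieltjesGap (d / (β * ((n : ℝ) + 2))) z fun k => u n k ω‖ ≤ ε / (4 * Z) :=
    (lt_of_not_ge fun h => c1 h).le
  have c2' : ‖stieltjesGap (d / (β * ((n : ℝ) + 2))) z (bidiagTail fun k => u n k ω)‖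
      ≤ ε / (4 * Z) := (lt_of_not_ge fun h => c2 h).le
  have c3' : |d / (β * ((n : ℝ) + 2)) * u n (.inl 0) ω ^ 2 - 1| ≤ ε := le_of_not_gt fun h => c3 h
  have c4' : |d / (β * ((n : ℝ) + 2)) * u n (.inr 0) ω ^ 2 - d| ≤ ε := le_of_not_gt fun h => c4 h
  have hω' : c₀ < ‖resolventLeft (d / (β * ((n : ℝ) + 2))) (fun k => u n k ω) z 0 0
        - mpStieltjes d z‖ := hω
  have hrel := resolventLeft_tail_relation (c := d / (β * ((n : ℝ) + 2))) (fun k => u n k ω) hzp.ne'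
  have him := im_one_add_mul_resolventLeft_nonneg (c := d / (β * ((n : ℝ) + 2))) (by positivity)
    (fun k => u n k ω) hzp
  have hdist := norm_tail_sub_le (c := d / (β * ((n : ℝ) + 2))) (fun k => u n k ω) hzp
  have hle : ‖z‖ * (‖stieltjesGap (d / (β * ((n : ℝ) + 2))) z (bidiagTail fun k => u n k ω)‖
      + ‖stieltjesGap (d / (β * ((n : ℝ) + 2))) z fun k => u n k ω‖
      + 2 * (((n : ℝ) + 2) * z.im)⁻¹) ≤ ε := by
    calc _ ≤ Z * (ε / (4 * Z) + ε / (4 * Z) + 2 * (ε / (4 * Z))) := by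
          gcongr
          · linarith
          · exact b1.trans hn
      _ = ε := by field_simp; ring
  have hfin := hstab z hz1 hz2 hzp hzZ _ _ _ _ c3' c4' (hdist.trans hle) him
    (by push_cast; push_cast at hrel; exact hrel)
  have e : (1 + z * resolventLeft (d / (β * ((n : ℝ) + 2))) (fun k => u n k ω) z 0 0)
      - (1 + z * mpStieltjes d z)
      = z * (resolventLeft (d / (β * ((n : ℝ) + 2))) (fun k => u n k ω) z 0 0 - mpStieltjes d z) := by
    ring
  rw [e, norm_mul] at hfin
  have : κ * c₀ < ‖z‖ * ‖resolventLeft (d / (β * ((n : ℝ) + 2))) (fun k => u n k ω) z 0 0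
        - mpStieltjes d z‖ := mul_lt_mul' hκz hω' hc₀.le (hκ.trans_le hκz)
  linarith

end fixedPoint

/-! ### From fixed points to the whole domain -/

section net

variable {Ω : ℕ → Type*} [∀ n, MeasurableSpace (Ω n)] {P : ∀ n, Measure (Ω n)}
  [∀ n, IsProbabilityMeasure (P n)]

/-- From fixed points to all points of the domain, for Lipschitz functions. -/
lemma eventually_measureReal_exists_le {d κ b : ℝ} (hb : -1 ≤ b) {F : ∀ n, Ω n → ℂ → ℝ}
    (hlarge : ∀ n ω z, 0 < z.im → F n ω z ≤ 3 * z.im⁻¹)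
    (hlip : ∀ n ω z w, 0 < z.im → 0 < w.im →
      F n ω z ≤ F n ω w + 3 * (‖z - w‖ * (z.im⁻¹ * w.im⁻¹)))
    {c : ℝ} (hc : 0 < c)
    (hF : ∀ H : ℝ, RapidlySmall (fun n => bulkDomain d κ b (n + 2) ∩ {z | z.im ≤ H})
      fun n z => (P n).real {ω | c / 2 < F n ω z}) (k : ℕ) :
    ∃ C : ℝ, ∀ᶠ n : ℕ in Filter.atTop,
      (P n).real {ω | ∃ z ∈ bulkDomain d κ b (n + 2), c < F n ω z} ≤ C / ((n : ℝ) + 2) ^ k := by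
  -- Above height 3/c the trivial bound suffices, and 1 leaves room for rounding upwards. The six
  -- extra powers pay for the L²m⁶ grid points.
  obtain ⟨C, hC⟩ := hF (3 / c + 1) (k + 6)
  obtain ⟨L, hL⟩ := exists_nat_gt (max (mpUpper d - κ - (mpLower d + κ)) (3 / c))
  refine ⟨(L : ℝ) ^ 2 * |C|, ?_⟩
  filter_upwards [hC, eventually_rpow_neg_le one_pos (ε := c / 12) (by positivity)] with n hn hnc
  have hn0 : (0 : ℝ) ≤ n := n.cast_nonneg
  set m : ℝ := (n : ℝ) + 2 with hm
  have hm1 : 1 ≤ m := by linarith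
  have hm0 : 0 < m := by linarith
  have hh1 : (m ^ 3)⁻¹ ≤ 1 := inv_le_one_of_one_le₀ (one_le_pow₀ hm1)
  have hmb : m⁻¹ ≤ m ^ b := by
    rw [← Real.rpow_neg_one]; exact Real.rpow_le_rpow_of_exponent_le hm1 hb
  -- The grid has spacing m⁻³. Real parts are rounded down and imaginary parts up, so the point
  -- chosen for z stays in the domain; the Lipschitz error is at most 6/m ≤ c/2.
  let pt : ℕ × ℕ → ℂ := fun p =>
    ⟨mpLower d + κ + p.1 * (m ^ 3)⁻¹, m ^ b + (p.2 + 1) * (m ^ 3)⁻¹⟩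
  set I := Finset.range (L * (n + 2) ^ 3) ×ˢ Finset.range (L * (n + 2) ^ 3) with hI
  have hcast : ((L * (n + 2) ^ 3 : ℕ) : ℝ) = L * m ^ 3 := by push_cast; rfl
  -- Some grid points may lie outside the domain, where no estimate holds; membership is part of the
  -- event so that they contribute the empty set.
  have hsub : {ω | ∃ z ∈ bulkDomain d κ b (n + 2), c < F n ω z} ⊆ ⋃ p ∈ I,
      {ω | pt p ∈ bulkDomain d κ b (n + 2) ∩ {z | z.im ≤ 3 / c + 1} ∧ c / 2 < F n ω (pt p)} := by
    rintro ω ⟨z, ⟨hz1, hz2, hz3⟩, hz⟩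
    have hz3' : m ^ b < z.im := by push_cast at hz3; exact hz3
    have hmbp : 0 < m ^ b := Real.rpow_pos_of_pos hm0 _
    have hzp : 0 < z.im := hmbp.trans hz3'
    have hzc : z.im < 3 / c := by
      have := hz.trans_le (hlarge n ω z hzp)
      rw [← div_eq_mul_inv, lt_div_iff₀ hzp] at this
      rw [lt_div_iff₀ hc]; linarith
    have hx0 : 0 ≤ (z.re - (mpLower d + κ)) * m ^ 3 := by
      have : 0 ≤ z.re - (mpLower d + κ) := by linarith
      positivity
    have hy0 : 0 ≤ (z.im - m ^ b) * m ^ 3 := by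
      have : 0 ≤ z.im - m ^ b := by linarith
      positivity
    set i := ⌊(z.re - (mpLower d + κ)) * m ^ 3⌋₊
    set j := ⌊(z.im - m ^ b) * m ^ 3⌋₊
    have i1 : (i : ℝ) * (m ^ 3)⁻¹ ≤ z.re - (mpLower d + κ) := by
      rw [← div_eq_mul_inv, div_le_iff₀ (by positivity)]; exact Nat.floor_le hx0
    have i2 : z.re - (mpLower d + κ) < (i + 1) * (m ^ 3)⁻¹ := by
      rw [← div_eq_mul_inv, lt_div_iff₀ (by positivity)]; exact Nat.lt_floor_add_one _
    have j1 : (j : ℝ) * (m ^ 3)⁻¹ ≤ z.im - m ^ b := by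
      rw [← div_eq_mul_inv, div_le_iff₀ (by positivity)]; exact Nat.floor_le hy0
    have j2 : z.im - m ^ b < (j + 1) * (m ^ 3)⁻¹ := by
      rw [← div_eq_mul_inv, lt_div_iff₀ (by positivity)]; exact Nat.lt_floor_add_one _
    have iL : i < L * (n + 2) ^ 3 := by
      rw [Nat.floor_lt hx0, hcast]
      gcongr
      exact lt_of_le_of_lt (by linarith [le_max_left (mpUpper d - κ - (mpLower d + κ)) (3 / c)]) hL
    have jL : j < L * (n + 2) ^ 3 := by
      rw [Nat.floor_lt hy0, hcast]
      gcongr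
      exact lt_of_le_of_lt (by linarith [le_max_right (mpUpper d - κ - (mpLower d + κ)) (3 / c)]) hL
    have hwim : (pt (i, j)).im = m ^ b + (j + 1) * (m ^ 3)⁻¹ := rfl
    have hwre : (pt (i, j)).re = mpLower d + κ + i * (m ^ 3)⁻¹ := rfl
    have hwz : z.im ≤ (pt (i, j)).im := by rw [hwim]; linarith
    have hwp : 0 < (pt (i, j)).im := hzp.trans_le hwz
    have hdist : ‖z - pt (i, j)‖ ≤ 2 * (m ^ 3)⁻¹ := by
      refine (Complex.norm_le_abs_re_add_abs_im _).trans ?_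
      rw [Complex.sub_re, Complex.sub_im, hwim, hwre]
      have k1 : |z.re - (mpLower d + κ + i * (m ^ 3)⁻¹)| ≤ (m ^ 3)⁻¹ :=
        abs_le.2 ⟨by linarith [inv_pos.2 (pow_pos hm0 3)], by linarith⟩
      have k2 : |z.im - (m ^ b + (j + 1) * (m ^ 3)⁻¹)| ≤ (m ^ 3)⁻¹ :=
        abs_le.2 ⟨by linarith, by linarith [inv_pos.2 (pow_pos hm0 3)]⟩
      linarith
    refine Set.mem_biUnion (show (i, j) ∈ I from Finset.mk_mem_product (Finset.mem_range.2 iL)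
      (Finset.mem_range.2 jL)) ⟨⟨⟨?_, ?_, ?_⟩, ?_⟩, ?_⟩
    · rw [hwre]
      have : 0 ≤ (i : ℝ) * (m ^ 3)⁻¹ := by positivity
      linarith
    · rw [hwre]; linarith
    · exact hz3.trans_le hwz
    · change (pt (i, j)).im ≤ 3 / c + 1
      rw [hwim]; linarith
    · have h1 := hlip n ω z (pt (i, j)) hzp hwp
      have hzi : z.im⁻¹ ≤ m := by
        rw [← inv_inv m]; exact inv_anti₀ (by positivity) (hmb.trans hz3'.le)
      have hwi : (pt (i, j)).im⁻¹ ≤ m := (inv_anti₀ hzp hwz).trans hzi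
      have h2 : ‖z - pt (i, j)‖ * (z.im⁻¹ * (pt (i, j)).im⁻¹) ≤ 2 * m⁻¹ := by
        calc _ ≤ 2 * (m ^ 3)⁻¹ * (m * m) := by gcongr
          _ = _ := by field_simp
      rw [Real.rpow_neg_one] at hnc
      linarith
  refine (measureReal_mono hsub (measure_ne_top (P n) _)).trans ((measureReal_biUnion_finset_le _ _).trans ?_)
  have hb2 : ∀ p ∈ I, (P n).real
      {ω | pt p ∈ bulkDomain d κ b (n + 2) ∩ {z | z.im ≤ 3 / c + 1} ∧ c / 2 < F n ω (pt p)}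
      ≤ |C| / m ^ (k + 6) := by
    intro p _
    by_cases hp : pt p ∈ bulkDomain d κ b (n + 2) ∩ {z | z.im ≤ 3 / c + 1}
    · simp only [hp, true_and]
      exact (hn _ hp).trans (by gcongr; exact le_abs_self C)
    · simp only [hp, false_and, Set.ofPred_false, measureReal_empty]
      positivity
  refine (Finset.sum_le_card_nsmul _ _ _ hb2).trans_eq ?_
  rw [hI, Finset.card_product, Finset.card_range, nsmul_eq_mul, Nat.cast_mul, hcast]
  field_simp
  ring

end net

/-! ### Translation to the stated ensemble and conclusion -/

lemma matrixResolvent_eq_resolventLeft {n : ℕ} (c : ℝ) (u : BidiagIdx n → ℝ) (z : ℂ) :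
    matrixResolvent (c • (lowerBidiagonal (m := n + 1) (fun i => u (.inl i)) (fun j => u (.inr j))
      * (lowerBidiagonal (m := n + 1) (fun i => u (.inl i)) (fun j => u (.inr j))).transpose)) z
      = resolventLeft c u z := by
  rw [matrixResolvent, resolventLeft, resolventMatrix, bidiag_eq_map]
  congr 2
  ext i j
  simp [Matrix.mul_apply]

lemma OverwhelmingProbOn.rapidlySmall {Ω : ℕ → Type*} [∀ m, MeasurableSpace (Ω m)]
    {P : ∀ m, Measure (Ω m)} {D : ℕ → Set ℂ} {E : ∀ (m : ℕ) [NeZero m], ℂ → Set (Ω m)}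
    (h : OverwhelmingProbOn P D E) :
    RapidlySmall (fun n => D (n + 2)) fun n z => (P (n + 2)).real (E (n + 2) z)ᶜ := fun k => by
  obtain ⟨C, hC⟩ := h k
  refine ⟨C, Filter.Eventually.of_forall fun n z hz => (hC (n + 2) z hz).trans_eq ?_⟩
  rw [Real.rpow_neg (Nat.cast_nonneg _), Real.rpow_natCast, div_eq_mul_inv]
  push_cast
  rfl

/-- Finitely many sizes are absorbed in the constant. Among them is m = 1, for which no tail matrix
exists; this is why the estimates are indexed by m = n + 2. -/
lemma OverwhelmingProb.of_eventually {Ω : ℕ → Type*} [∀ m, MeasurableSpace (Ω m)]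
    {P : ∀ m, Measure (Ω m)} [∀ m, IsProbabilityMeasure (P m)]
    {E : ∀ (m : ℕ) [NeZero m], Set (Ω m)}
    (h : ∀ k : ℕ, ∃ C : ℝ, ∀ᶠ n : ℕ in Filter.atTop,
      (P (n + 2)).real (E (n + 2))ᶜ ≤ C / ((n : ℝ) + 2) ^ k) : OverwhelmingProb P E := fun k => by
  obtain ⟨C, hC⟩ := h k
  obtain ⟨n₀, hn₀⟩ := Filter.eventually_atTop.1 hC
  refine ⟨|C| + ((n₀ : ℝ) + 2) ^ k, fun m _ => ?_⟩
  have hm0 : (0 : ℝ) < m := by exact_mod_cast Nat.pos_of_ne_zero (NeZero.ne m)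
  rw [Real.rpow_neg hm0.le, Real.rpow_natCast, ← div_eq_mul_inv]
  by_cases hm : n₀ + 2 ≤ m
  · obtain ⟨n, rfl⟩ : ∃ n, m = n + 2 := ⟨m - 2, by omega⟩
    refine (hn₀ n (by omega)).trans ?_
    push_cast
    gcongr
    have : 0 ≤ ((n₀ : ℝ) + 2) ^ k := by positivity
    linarith [le_abs_self C]
  · refine measureReal_le_one.trans ?_
    rw [le_div_iff₀ (by positivity), one_mul]
    have h1 : (m : ℝ) ≤ (n₀ : ℝ) + 2 := by exact_mod_cast (not_le.1 hm).le
    have h2 : (m : ℝ) ^ k ≤ ((n₀ : ℝ) + 2) ^ k := by gcongr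
    linarith [abs_nonneg C]

lemma IsBetaLaguerre.isLaguerreFamily {β d : ℝ} {n : ℕ} {Ω : Type*} [MeasurableSpace Ω]
    {P : Measure Ω} {x : Fin (n + 2) → Ω → ℝ} {y : Fin (n + 2 - 1) → Ω → ℝ}
    (hd : 0 < d) (h : IsBetaLaguerre β d P x y) :
    IsLaguerreFamily (n := n + 1) P β (((n : ℝ) + 2) * β / d) (Sum.elim x y) := by
  refine ⟨fun k => ?_, h.indep⟩
  rcases k with i | j
  · have e : laguerreParam β (((n : ℝ) + 2) * β / d) (.inl i : BidiagIdx (n + 1))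
        = 2 * (((n + 2 : ℕ) : ℝ) * β / (2 * d)) - β * ((i : ℕ) : ℝ) := by
      change ((n : ℝ) + 2) * β / d - β * ((i : ℕ) : ℝ) = _
      push_cast
      field_simp
    rw [e]
    exact h.hasLaw_diag i
  · have e : laguerreParam β (((n : ℝ) + 2) * β / d) (.inr j : BidiagIdx (n + 1))
        = β * (((n + 2 : ℕ) : ℝ) - 1 - ((j : ℕ) : ℝ)) := by
      change β * (((n + 1 : ℕ) : ℝ) - ((j : ℕ) : ℝ)) = _
      push_cast
      ring
    rw [e]
    exact h.hasLaw_sub j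

theorem mainTheorem4 {Ω : ℕ → Type*} [∀ m, MeasurableSpace (Ω m)]
    (P : ∀ m, Measure (Ω m)) [∀ m, IsProbabilityMeasure (P m)]
    (β d κ a : ℝ) (hβ : 0 < β) (hd0 : 0 < d) (hd1 : d ≤ 1) (hκ : 0 < κ)
    (ha0 : -1 < a) (ha1 : a ≤ 0)
    (x : ∀ m : ℕ, Fin m → Ω m → ℝ) (y : ∀ m : ℕ, Fin (m - 1) → Ω m → ℝ)
    (hxy : ∀ m : ℕ, IsBetaLaguerre β d (P m) (x m) (y m))
    (M : ∀ m : ℕ, Ω m → Matrix (Fin m) (Fin m) ℝ)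
    (hM : ∀ (m : ℕ) (ω : Ω m), M m ω = laguerreMatrix β d (fun i => x m i ω) (fun i => y m i ω))
    (hMP : MPLawAtLevel P M d κ a)
    (hR : ∃ K : ℝ, OverwhelmingProbOn P (bulkDomain d κ a)
      fun m _ z => {ω | ‖matrixResolvent (M m ω) z 0 0 - mpStieltjes d z‖ ≤ K}) :
    ∀ δ : ℝ, 0 < δ → ∀ c : ℝ, 0 < c → OverwhelmingProb P
      fun m _ => {ω | ∀ z ∈ bulkDomain d κ ((a - 1) / 2 + δ) m,
        ‖matrixResolvent (M m ω) z 0 0 - mpStieltjes d z‖ ≤ c} := by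
  intro δ hδ c hc
  set u : ∀ n : ℕ, BidiagIdx (n + 1) → Ω (n + 2) → ℝ := fun n => Sum.elim (x (n + 2)) (y (n + 2))
    with hu
  have hfam : ∀ n, IsLaguerreFamily (P (n + 2)) β (((n : ℝ) + 2) * β / d) (u n) := fun n =>
    (hxy (n + 2)).isLaguerreFamily hd0
  have hres : ∀ n ω z, matrixResolvent (M (n + 2) ω) z
      = resolventLeft (d / (β * ((n : ℝ) + 2))) (fun k => u n k ω) z := fun n ω z => by
    rw [hM, laguerreMatrix, ← matrixResolvent_eq_resolventLeft]
    push_cast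
    rfl
  -- Accuracy 1 is enough, because the law at level m^a only serves to bound the normalized trace.
  have hs := (hMP 1 one_pos).rapidlySmall.mono (q := fun n z => (P (n + 2)).real
      {ω | 1 ≤ ‖((n : ℂ) + 2)⁻¹
        * (resolventLeft (d / (β * ((n : ℝ) + 2))) (fun k => u n k ω) z).trace - mpStieltjes d z‖})
    (Filter.Eventually.of_forall fun n z _ => measureReal_mono fun ω hω hω' => by
      have h1 : ‖empiricalStieltjes (M (n + 2) ω) z - mpStieltjes d z‖ < 1 := hω'
      rw [empiricalStieltjes, hres, one_div] at h1
      push_cast at h1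
      exact absurd h1 (not_lt.2 hω))
  refine OverwhelmingProb.of_eventually fun k => ?_
  obtain ⟨C, hC⟩ := eventually_measureReal_exists_le (P := fun n => P (n + 2))
    (d := d) (κ := κ) (b := (a - 1) / 2 + δ) (by linarith)
    (F := fun n ω z => ‖resolventLeft (d / (β * ((n : ℝ) + 2))) (fun k => u n k ω) z 0 0
      - mpStieltjes d z‖)
    (fun n ω z hz => by
      have h1 := norm_resolventMatrix_apply_le
        (isHermitian_left (d / (β * ((n : ℝ) + 2))) fun k => u n k ω) hz.ne' 0 0
      have h2 := norm_mpStieltjes_le hd0 hz.ne'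
      rw [abs_of_pos hz] at h1 h2
      refine (norm_sub_le _ _).trans ?_
      change ‖resolventLeft (d / (β * ((n : ℝ) + 2))) (fun k => u n k ω) z 0 0‖ ≤ _ at h1
      linarith)
    (fun n ω z w hz hw => by
      have h1 := norm_resolventMatrix_sub_le
        (isHermitian_left (d / (β * ((n : ℝ) + 2))) fun k => u n k ω) hz.ne' hw.ne' 0
      have h2 := norm_mpStieltjes_sub_le hd0 hz.ne' hw.ne'
      rw [abs_of_pos hz, abs_of_pos hw] at h1 h2
      change ‖resolventLeft (d / (β * ((n : ℝ) + 2))) (fun k => u n k ω) z 0 0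
        - resolventLeft (d / (β * ((n : ℝ) + 2))) (fun k => u n k ω) w 0 0‖ ≤ _ at h1
      set r₁ := resolventLeft (d / (β * ((n : ℝ) + 2))) (fun k => u n k ω) z 0 0
      set r₂ := resolventLeft (d / (β * ((n : ℝ) + 2))) (fun k => u n k ω) w 0 0
      have h3 : r₁ - mpStieltjes d z
          = (r₂ - mpStieltjes d w) + ((r₁ - r₂) - (mpStieltjes d z - mpStieltjes d w)) := by ring
      have h4 := norm_add_le (r₂ - mpStieltjes d w)
        ((r₁ - r₂) - (mpStieltjes d z - mpStieltjes d w))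
      have h5 := norm_sub_le (r₁ - r₂) (mpStieltjes d z - mpStieltjes d w)
      rw [← h3] at h4
      linarith) hc
    (fun H => rapidlySmall_resolvent hβ hd0 hd1 hκ ha0 hδ hfam hs H (half_pos hc)) k
  refine ⟨C, hC.mono fun n hn => le_trans (measureReal_mono fun ω hω => ?_) hn⟩
  by_contra hcon
  refine hω fun z hz => ?_
  rw [hres]
  exact not_lt.1 fun hlt => hcon ⟨z, hz, hlt⟩
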